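/- **Theorem (crude chord-arc bound).** Let $\Omega\subset\mathbb{R}^2$ be a closed convex set with non-empty interior and boundary of class $C^2$, and let $N^S$ denote the outward unit normal to $S=\partial\Omega$. Let $0<T<\infty$ and let $\{\Gamma_t\}_{t\in[0,T)}$ be a compact embedded free boundary curve shortening flow in $\Omega$. That is, $\Gamma_t=\gamma([0,1],t)$, where $\gamma:[0,1]\times[0,T)\to\Omega$ is smooth; each $\gamma(\cdot,t)$ is an injective immersion mapping $(0,1)$ into the interior of $\Omega$ and $\{0,1\}$ into $\partial\Omega$; and $$\partial_t\gamma=-\kappa N\ \text{ on }(0,1)\times[0,T),\qquad \langle N,N^S\rangle=0\ \text{ on }\{0,1\}\times[0,T),$$ where $N$ is the unit normal and $\kappa$ the curvature of $\Gamma_t$ with respect to $N$ (so that $-\kappa N$ is the curvature vector). For a compact embedded curve $\Gamma\subset\Omega$ with its two endpoints $\partial\Gamma$ on $\partial\Omega$, let $\ell(x,y)$ be the arclength along $\Gamma$ between $x,y\in\Gamma$, and put $$\tilde d(x,y)=\min_{z\in\partial\Omega}\big(|x-z|+|y-z|\big),\qquad \tilde\ell(x,y)=\min_{s\in\partial\Gamma}\big(\ell(x,s)+\ell(y,s)\big).$$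 The extended chord-arc profile of $\Gamma$ is $$\boldsymbol\psi_\Gamma(\delta)=\min\Big\{\inf\{|x-y|:x,y\in\Gamma,\ \ell(x,y)=\delta\},\ \inf\{\tilde d(x,y):x,y\in\Gamma,\ \tilde\ell(x,y)=\delta\}\Big\},$$ with $\inf\emptyset=+\infty$. Write $\boldsymbol\psi(\delta,t)=\boldsymbol\psi_{\Gamma_t}(\delta)$, and let $\boldsymbol L(t)$ be twice the length of $\Gamma_t$ (the length of the formal double of $\Gamma_t$). Suppose that $\boldsymbol L_T:=\lim_{t\to T}\boldsymbol L(t)>0$ and that, for some $c\in\mathbb{R}$, $$\boldsymbol\psi(\delta,0)\ \ge\ c\,\boldsymbol L(0)\,\sin\!\Big(\frac{\pi\delta}{\boldsymbol L(0)}\Big)\qquad\text{for all }\delta.$$ Then, for all $t\in[0,T)$ and all $\delta$, $$\boldsymbol\psi(\delta,t)\ \ge\ c\,\boldsymbol L(t)\,e^{-4\pi^2T/\boldsymbol L_T^2}\,\sin\!\Big(\frac{\pi\delta}{\boldsymbol L(t)}\Big).$$ (Since $\boldsymbol\psi(\delta,t)=+\infty$ unless $0\le\delta\le\boldsymbol L(t)/2$,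 only such $\delta$ matter.) -/

import Mathlib

open Set Filter Topology
open scoped ContDiff

noncomputable section

/-- The Euclidean plane. -/
abbrev Plane : Type := EuclideanSpace ℝ (Fin 2)

/-- Counterclockwise rotation by `π / 2`. -/
def rotJ (v : Plane) : Plane := !₂[-(v 1), v 0]

/-- `ρ` is a `C²` defining function of `Ω` on the open neighbourhood `U` of the point `p`. -/
structure IsLocalDefiningFunction (Ω : Set Plane) (p : Plane) (U : Set Plane)
    (ρ : Plane → ℝ) : Prop where
  isOpen : IsOpen U
  mem : p ∈ U
  contDiffOn : ContDiffOn ℝ 2 ρ U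
  gradient_ne_zero : gradient ρ p ≠ 0
  inter_eq : Ω ∩ U = {q | q ∈ U ∧ ρ q ≤ 0}

/-- A closed convex domain in the plane with non-empty interior and boundary of class `C²`. -/
structure IsConvexC2Domain (Ω : Set Plane) : Prop where
  isClosed : IsClosed Ω
  convex : Convex ℝ Ω
  interior_nonempty : (interior Ω).Nonempty
  boundary : ∀ p ∈ frontier Ω, ∃ U ρ, IsLocalDefiningFunction Ω p U ρ

/-- `ν` is the outward unit normal `N^S` to `S = ∂Ω` at the boundary point `p`. -/
def IsOutwardUnitNormal (Ω : Set Plane) (p ν : Plane) : Prop :=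
  ∃ U ρ, IsLocalDefiningFunction Ω p U ρ ∧ ν = ‖gradient ρ p‖⁻¹ • gradient ρ p

/-! ### Regular curves parametrised by `[0, 1]` -/

/-- The derivative `g'` of a curve `g : [0, 1] → ℝ²` (one-sided at the endpoints). -/
def velocity (g : ℝ → Plane) (x : ℝ) : Plane := derivWithin g (Icc 0 1) x

/-- The unit normal field `N` with `J N = T = g' / |g'|`. -/
def unitNormal (g : ℝ → Plane) (x : ℝ) : Plane :=
  -(‖velocity g x‖⁻¹ • rotJ (velocity g x))

/-- The curvature `κ = det (g', g'') / |g'|³` with respect to `N`; thus `-κ N` is the curvature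
vector, and `κ > 0` on a circle whose unit normal `N` points outwards. -/
def signedCurvature (g : ℝ → Plane) (x : ℝ) : ℝ :=
  inner ℝ (rotJ (velocity g x)) (velocity (velocity g) x) / ‖velocity g x‖ ^ 3

/-- The arclength `ℓ(x, y)` between the points with parameters `x` and `y`. -/
def arcDist (g : ℝ → Plane) (x y : ℝ) : ℝ := |∫ u in x..y, ‖velocity g u‖|

/-- The length of the curve. -/
def curveLength (g : ℝ → Plane) : ℝ := ∫ u in (0 : ℝ)..1, ‖velocity g u‖

/-- The length of the formal double of the curve, i.e. twice its length. -/
def doubledLength (g : ℝ → Plane) : ℝ := 2 * curveLength g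

/-- The reflected distance `min_{z ∈ ∂Ω} (|p - z| + |q - z|)` (the minimum is attained as soon as
`∂Ω` is non-empty). -/
def reflectedDist (Ω : Set Plane) (p q : Plane) : ℝ :=
  sInf ((fun z => dist p z + dist q z) '' frontier Ω)

/-- The reflected arclength: the minimum over the two endpoints `s` of `ℓ(x, s) + ℓ(y, s)`. -/
def reflectedArcDist (g : ℝ → Plane) (x y : ℝ) : ℝ :=
  min (arcDist g x 0 + arcDist g y 0) (arcDist g x 1 + arcDist g y 1)

/-- The classical chord-arc profile; the infimum is taken in the extended reals, so that it is
`+∞` if no two points have arclength distance `δ`. -/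
def chordArcProfile (g : ℝ → Plane) (δ : ℝ) : EReal :=
  sInf {r : EReal | ∃ x ∈ Icc (0 : ℝ) 1, ∃ y ∈ Icc (0 : ℝ) 1,
    arcDist g x y = δ ∧ r = ((dist (g x) (g y) : ℝ) : EReal)}

/-- The reflected chord-arc profile. -/
def reflectedChordArcProfile (Ω : Set Plane) (g : ℝ → Plane) (δ : ℝ) : EReal :=
  sInf {r : EReal | ∃ x ∈ Icc (0 : ℝ) 1, ∃ y ∈ Icc (0 : ℝ) 1,
    reflectedArcDist g x y = δ ∧ r = ((reflectedDist Ω (g x) (g y) : ℝ) : EReal)}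

/-- The extended (completed) chord-arc profile. -/
def extendedChordArcProfile (Ω : Set Plane) (g : ℝ → Plane) (δ : ℝ) : EReal :=
  min (chordArcProfile g δ) (reflectedChordArcProfile Ω g δ)

/-- The family of curves `γ · t`, `t ∈ [0, T)`, parametrised by `M = [0, 1]`, is a compact embedded
free boundary curve shortening flow in `Ω`. -/
structure IsFreeBoundaryCSF (Ω : Set Plane) (T : ℝ) (γ : ℝ → ℝ → Plane) : Prop where
  smooth : ContDiffOn ℝ ∞ (fun p : ℝ × ℝ => γ p.1 p.2) (Icc (0 : ℝ) 1 ×ˢ Ico 0 T)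
  immersed : ∀ t ∈ Ico 0 T, ∀ x ∈ Icc (0 : ℝ) 1, velocity (fun u => γ u t) x ≠ 0
  embedded : ∀ t ∈ Ico 0 T, InjOn (fun x => γ x t) (Icc (0 : ℝ) 1)
  mem_interior : ∀ t ∈ Ico 0 T, ∀ x ∈ Ioo (0 : ℝ) 1, γ x t ∈ interior Ω
  endpoint_mem : ∀ t ∈ Ico 0 T, ∀ x ∈ ({0, 1} : Set ℝ), γ x t ∈ frontier Ω
  evolution : ∀ t ∈ Ico 0 T, ∀ x ∈ Ioo (0 : ℝ) 1,
    HasDerivWithinAt (fun s => γ x s)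
      (-(signedCurvature (fun u => γ u t) x • unitNormal (fun u => γ u t) x)) (Ico 0 T) t
  orthogonal : ∀ t ∈ Ico 0 T, ∀ x ∈ ({0, 1} : Set ℝ), ∀ ν : Plane,
    IsOutwardUnitNormal Ω (γ x t) ν → inner ℝ (unitNormal (fun u => γ u t) x) ν = 0

end

/-!
The proof is a maximum principle for the two-point function `d / F` on pairs of points of the curves,
where `F = L sin (π a / L)`. For chords, `d = |x - y|` and `a` is the length of the arc between `x`
and `y`; for reflected pairs, `d` is the reflected distance and `a` is the sum of the arclengths to an
endpoint. In both cases `L` is the doubled length, and `F` is unchanged when `a` is replaced by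
`L - a`, so it does not matter which endpoint is taken.

*Time.* As the flow moves in the normal direction, `∂_t |γ_x| = -κ² |γ_x| ≤ 0` pointwise, so the
lengths of all arcs decrease. Since `F` is increasing in the two lengths `a` and `L - a`
(`mul_sin_mono`), `F` decreases in time. Hence, if `d ≥ m e^{-μ t} F` up to the time `t₀`, with
equality at some pair at the time `t₀ > 0`, then `∂_t d ≤ -μ d` there
(`inner_deriv_le_of_exp_barrier`).

*Space.* At such a pair the first variation shows that the two unit tangents have equal components
along the chord up to sign, hence also equal components orthogonal to it up to sign. Moving along the
one and plus or minus the other keeps the direction of the chord, and the second variation in this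
direction gives `∂_t d ≥ -(4 π² / L²) d` (`second_variation`). For `μ > 4 π² / L_T²` the two
inequalities contradict each other.

*Reflection.* If `R` is the reflection in a supporting line of `Ω`, then `|p - R q|` is at least the
reflected distance of `p, q ∈ Ω`, because any point outside the interior may serve as `z` in its
definition (`reflectedDist_le_dist_lineReflection`). Equality holds for the supporting line at a point
`z` that realises the minimum. So a reflected pair of interior points is handled as a chord from one
curve to the mirror image of the other, and the curvature of `∂Ω` never enters. At an endpoint of the
curve, reflection in the tangent line of `∂Ω` prolongs the curve to second order, because the curve is
orthogonal to `∂Ω`; the reflected pairs then supply the variations beyond the endpoint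
(`second_variation_chord`).

*Degenerate pairs.* Near the diagonal, `d / a → 1` locally uniformly in time. For reflected pairs near
an endpoint this uses that the curve is orthogonal to `∂Ω` and that `∂Ω` is differentiable
(`exists_boundary_dist_lower_bound`). Since `F ≤ π a` and the constant of the initial bound is at most
`1 / π` (`mul_pi_le_one`), after a slight decrease of this constant the infimum of `e^{μ t} d / F`,
if below it, is attained away from the degenerate pairs (`exists_touching_multiple`). The room needed
for this decrease, and for taking `μ` strictly larger than `4 π² / L_T²`, comes from `t < T`.
-/

/-! ### One-sided second-order expansions -/

open Asymptotics in
/-- `f u = f₀ + u f₁ + (u² / 2) f₂ + o(u²)` as `u → 0⁺`. -/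
def HasJetRight {E : Type*} [NormedAddCommGroup E] [NormedSpace ℝ E]
    (f : ℝ → E) (f₀ f₁ f₂ : E) : Prop :=
  (fun u => f u - (f₀ + u • f₁ + (u ^ 2 / 2) • f₂)) =o[𝓝[>] 0] fun u : ℝ => u ^ 2

namespace HasJetRight

open Asymptotics

variable {E F : Type*} [NormedAddCommGroup E] [NormedSpace ℝ E]
  [NormedAddCommGroup F] [NormedSpace ℝ F]

theorem sq_isBigO_id : (fun u : ℝ => u ^ 2) =O[𝓝[>] 0] fun u : ℝ => u := by
  have h : (fun u : ℝ => u ^ 2) =o[𝓝 0] fun u : ℝ => u ^ 1 := isLittleO_pow_pow (by norm_num)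
  simpa using (h.mono nhdsWithin_le_nhds).isBigO

theorem sq_isLittleO_id : (fun u : ℝ => u ^ 2) =o[𝓝[>] 0] fun u : ℝ => u := by
  have h : (fun u : ℝ => u ^ 2) =o[𝓝 0] fun u : ℝ => u ^ 1 := isLittleO_pow_pow (by norm_num)
  simpa using h.mono nhdsWithin_le_nhds

theorem const (a : E) : HasJetRight (fun _ => a) a 0 0 := by
  simp [HasJetRight]

theorem sub {f g : ℝ → E} {f₀ f₁ f₂ g₀ g₁ g₂ : E} (hf : HasJetRight f f₀ f₁ f₂)
    (hg : HasJetRight g g₀ g₁ g₂) :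
    HasJetRight (fun u => f u - g u) (f₀ - g₀) (f₁ - g₁) (f₂ - g₂) := by
  refine (IsLittleO.sub hf hg).congr_left fun u => ?_
  module

theorem add {f g : ℝ → E} {f₀ f₁ f₂ g₀ g₁ g₂ : E} (hf : HasJetRight f f₀ f₁ f₂)
    (hg : HasJetRight g g₀ g₁ g₂) :
    HasJetRight (fun u => f u + g u) (f₀ + g₀) (f₁ + g₁) (f₂ + g₂) := by
  refine (IsLittleO.add hf hg).congr_left fun u => ?_
  module

theorem congr_coeff {f : ℝ → E} {f₀ f₁ f₂ g₀ g₁ g₂ : E} (hf : HasJetRight f f₀ f₁ f₂)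
    (h₀ : f₀ = g₀) (h₁ : f₁ = g₁) (h₂ : f₂ = g₂) : HasJetRight f g₀ g₁ g₂ := by
  subst h₀ h₁ h₂
  exact hf

theorem clm {f : ℝ → E} {f₀ f₁ f₂ : E} (hf : HasJetRight f f₀ f₁ f₂) (A : E →L[ℝ] F) :
    HasJetRight (fun u => A (f u)) (A f₀) (A f₁) (A f₂) := by
  refine ((A.isBigO_comp _ _).trans_isLittleO hf).congr_left fun u => ?_
  simp [map_sub, map_add, map_smul]

theorem isBigO_sub {f : ℝ → E} {f₀ f₁ f₂ : E} (hf : HasJetRight f f₀ f₁ f₂) :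
    (fun u => f u - f₀) =O[𝓝[>] 0] fun u : ℝ => u := by
  have h1 : (fun u : ℝ => u • f₁) =O[𝓝[>] 0] fun u : ℝ => u :=
    IsBigO.of_bound ‖f₁‖ (Eventually.of_forall fun u => by rw [norm_smul, mul_comm])
  have h2 : (fun u : ℝ => (u ^ 2 / 2) • f₂) =O[𝓝[>] 0] fun u : ℝ => u := by
    refine IsBigO.trans (g := fun u : ℝ => u ^ 2) ?_ sq_isBigO_id
    refine IsBigO.of_bound (‖f₂‖ / 2) (Eventually.of_forall fun u => ?_)
    rw [norm_smul, norm_div]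
    simp
    ring_nf
    rfl
  refine (((IsLittleO.isBigO hf).trans sq_isBigO_id).add (h1.add h2)).congr_left fun u => ?_
  module

theorem tendsto {f : ℝ → E} {f₀ f₁ f₂ : E} (hf : HasJetRight f f₀ f₁ f₂) :
    Tendsto f (𝓝[>] 0) (𝓝 f₀) := by
  have h : Tendsto (fun u : ℝ => u) (𝓝[>] 0) (𝓝 0) := nhdsWithin_le_nhds
  have := hf.isBigO_sub.trans_tendsto h
  simpa using this.add_const f₀

theorem isLittleO_sub {f : ℝ → E} {f₀ f₁ f₂ : E} (hf : HasJetRight f f₀ f₁ f₂) :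
    (fun u => f u - f₀ - u • f₁) =o[𝓝[>] 0] fun u : ℝ => u := by
  have h2 : (fun u : ℝ => (u ^ 2 / 2) • f₂) =o[𝓝[>] 0] fun u : ℝ => u := by
    refine IsBigO.trans_isLittleO (g := fun u : ℝ => u ^ 2) ?_ sq_isLittleO_id
    refine IsBigO.of_bound (‖f₂‖ / 2) (Eventually.of_forall fun u => ?_)
    rw [norm_smul, norm_div]
    simp
    ring_nf
    rfl
  refine ((IsLittleO.trans_isBigO hf sq_isBigO_id).add h2).congr_left fun u => ?_
  module

/-- Chain rule for second-order expansions. -/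
theorem comp {f : ℝ → E} {f₀ f₁ f₂ : E} {s : Set ℝ} {ξ : ℝ → ℝ} {x₀ ξ₁ ξ₂ : ℝ}
    (hf : (fun x => f x - (f₀ + (x - x₀) • f₁ + ((x - x₀) ^ 2 / 2) • f₂)) =o[𝓝[s] x₀]
      fun x => (x - x₀) ^ 2)
    (hξ : HasJetRight ξ x₀ ξ₁ ξ₂) (hs : ∀ᶠ u in 𝓝[>] 0, ξ u ∈ s) :
    HasJetRight (fun u => f (ξ u)) f₀ (ξ₁ • f₁) (ξ₁ ^ 2 • f₂ + ξ₂ • f₁) := by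
  have ht : Tendsto ξ (𝓝[>] 0) (𝓝[s] x₀) := tendsto_nhdsWithin_iff.2 ⟨hξ.tendsto, hs⟩
  have hO := hξ.isBigO_sub
  have h1 := (hf.comp_tendsto ht).trans_isBigO (hO.pow 2)
  have h2 : (fun u => (ξ u - (x₀ + u • ξ₁ + (u ^ 2 / 2) • ξ₂)) • f₁) =o[𝓝[>] 0]
      fun u : ℝ => u ^ 2 := by
    have := IsLittleO.smul_isBigO hξ (isBigO_refl (fun _ : ℝ => f₁) (𝓝[>] 0))
    refine this.trans_isBigO (IsBigO.of_bound ‖f₁‖ (Eventually.of_forall fun u => ?_))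
    rw [norm_smul, mul_comm]
  have h3 : (fun u => (((ξ u - x₀) ^ 2 - (u * ξ₁) ^ 2) / 2) • f₂) =o[𝓝[>] 0]
      fun u : ℝ => u ^ 2 := by
    have hb : (fun u => ξ u - x₀ + u * ξ₁) =O[𝓝[>] 0] fun u : ℝ => u := by
      refine hO.add (IsBigO.of_bound ‖ξ₁‖ (Eventually.of_forall fun u => ?_))
      rw [norm_mul, mul_comm]
    have hm := hξ.isLittleO_sub.mul_isBigO hb
    simp only [← sq] at hm
    have := hm.smul_isBigO (isBigO_refl (fun _ : ℝ => (2⁻¹ : ℝ) • f₂) (𝓝[>] 0))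
    refine (this.trans_isBigO (k := fun u : ℝ => u ^ 2)
      (IsBigO.of_bound ‖(2⁻¹ : ℝ) • f₂‖ (Eventually.of_forall fun u => ?_))).congr_left
        fun u => ?_
    · rw [norm_smul, mul_comm]
    · rw [smul_smul, smul_eq_mul]
      congr 1
      ring
  refine ((h1.add h2).add h3).congr_left fun u => ?_
  simp only [Function.comp, smul_eq_mul]
  module

theorem norm_sq {E : Type*} [NormedAddCommGroup E] [InnerProductSpace ℝ E]
    {f : ℝ → E} {f₀ f₁ f₂ : E} (hf : HasJetRight f f₀ f₁ f₂) :
    HasJetRight (fun u => ‖f u‖ ^ 2) (‖f₀‖ ^ 2) (2 * inner ℝ f₀ f₁)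
      (2 * (‖f₁‖ ^ 2 + inner ℝ f₀ f₂)) := by
  have hid : Tendsto (fun u : ℝ => u) (𝓝[>] 0) (𝓝 0) := nhdsWithin_le_nhds
  set q : ℝ → E := fun u => f₀ + u • f₁ + (u ^ 2 / 2) • f₂ with hq
  have hqt : Tendsto q (𝓝[>] 0) (𝓝 f₀) := by
    have : Continuous q := by fun_prop
    have h := this.tendsto 0
    simp only [hq, zero_smul, add_zero] at h
    simpa using h.mono_left nhdsWithin_le_nhds
  have h1 : (fun u => inner ℝ (f u - q u) (f u + q u)) =o[𝓝[>] 0] fun u : ℝ => u ^ 2 := by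
    have hO : (fun u => f u + q u) =O[𝓝[>] 0] fun _ : ℝ => (1 : ℝ) :=
      (hf.tendsto.add hqt).isBigO_one ℝ
    have hm : (fun u => ‖f u - q u‖ * ‖f u + q u‖) =o[𝓝[>] 0] fun u : ℝ => u ^ 2 * 1 :=
      (IsLittleO.norm_left hf).mul_isBigO hO.norm_left
    simp only [mul_one] at hm
    refine IsBigO.trans_isLittleO (IsBigO.of_bound 1 (Eventually.of_forall fun u => ?_)) hm
    rw [one_mul, norm_mul, norm_norm, norm_norm]
    exact norm_inner_le_norm _ _
  have h2 : (fun u : ℝ => u ^ 3 * inner ℝ f₁ f₂ + u ^ 4 * (‖f₂‖ ^ 2 / 4)) =o[𝓝[>] 0]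
      fun u : ℝ => u ^ 2 := by
    have h3 : (fun u : ℝ => u ^ 3) =o[𝓝[>] 0] fun u : ℝ => u ^ 2 :=
      (isLittleO_pow_pow (by norm_num)).mono nhdsWithin_le_nhds
    have h4 : (fun u : ℝ => u ^ 4) =o[𝓝[>] 0] fun u : ℝ => u ^ 2 :=
      (isLittleO_pow_pow (by norm_num)).mono nhdsWithin_le_nhds
    refine IsLittleO.add ?_ ?_
    · simpa [mul_comm] using h3.const_mul_left (inner ℝ f₁ f₂)
    · simpa [mul_comm] using h4.const_mul_left (‖f₂‖ ^ 2 / 4)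
  refine (h1.add h2).congr_left fun u => ?_
  have e1 : (inner ℝ (f u - q u) (f u + q u) : ℝ) = ‖f u‖ ^ 2 - ‖q u‖ ^ 2 := by
    generalize q u = w
    rw [inner_sub_left, inner_add_right, inner_add_right, real_inner_self_eq_norm_sq,
      real_inner_self_eq_norm_sq, real_inner_comm]
    ring
  have e2 : ‖q u‖ ^ 2 = ‖f₀‖ ^ 2 + 2 * u * inner ℝ f₀ f₁
      + u ^ 2 * (‖f₁‖ ^ 2 + inner ℝ f₀ f₂) + u ^ 3 * inner ℝ f₁ f₂
      + u ^ 4 * (‖f₂‖ ^ 2 / 4) := by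
    simp only [hq, ← real_inner_self_eq_norm_sq, inner_add_left, inner_add_right,
      real_inner_smul_left, real_inner_smul_right]
    rw [real_inner_comm f₀ f₁, real_inner_comm f₀ f₂, real_inner_comm f₁ f₂]
    ring
  rw [e1, e2]
  simp only [smul_eq_mul]
  ring

/-- First and second derivative test at a one-sided minimum. -/
theorem nonneg_coeff {f : ℝ → ℝ} {c₁ c₂ : ℝ} (hf : HasJetRight f 0 c₁ c₂)
    (h : ∀ᶠ u in 𝓝[>] 0, 0 ≤ f u) : 0 ≤ c₁ ∧ (c₁ = 0 → 0 ≤ c₂) := by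
  have hpos : ∀ᶠ u : ℝ in 𝓝[>] 0, 0 < u := self_mem_nhdsWithin
  constructor
  · have h1 := hf.isLittleO_sub.tendsto_div_nhds_zero
    have h2 : Tendsto (fun u => (f u - 0 - u • c₁) / u + c₁) (𝓝[>] 0) (𝓝 (0 + c₁)) :=
      h1.add_const c₁
    rw [zero_add] at h2
    refine ge_of_tendsto h2 ?_
    filter_upwards [h, hpos] with u hu hu0
    have : (f u - 0 - u • c₁) / u + c₁ = f u / u := by
      rw [smul_eq_mul]
      field_simp
      ring
    rw [this]
    positivity
  · rintro rfl
    have h1 := IsLittleO.tendsto_div_nhds_zero hf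
    have h2 := h1.add_const (c₂ / 2)
    rw [zero_add] at h2
    have : 0 ≤ c₂ / 2 := by
      refine ge_of_tendsto h2 ?_
      filter_upwards [h, hpos] with u hu hu0
      have : (f u - (0 + u • (0 : ℝ) + (u ^ 2 / 2) • c₂)) / u ^ 2 + c₂ / 2 = f u / u ^ 2 := by
        simp only [smul_eq_mul]
        field_simp
        ring
      rw [this]
      positivity
    linarith

end HasJetRight

/-- Second-order Taylor expansion of a `C²` function on a convex set of reals. -/
theorem ContDiffOn.isLittleO_taylor_two {E : Type*} [NormedAddCommGroup E] [NormedSpace ℝ E]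
    {f : ℝ → E} {s : Set ℝ} {x₀ : ℝ} (hs : Convex ℝ s) (hx₀ : x₀ ∈ s)
    (hf : ContDiffOn ℝ 2 f s) :
    (fun x => f x - (f x₀ + (x - x₀) • derivWithin f s x₀
      + ((x - x₀) ^ 2 / 2) • derivWithin (derivWithin f s) s x₀)) =o[𝓝[s] x₀]
      fun x => (x - x₀) ^ 2 := by
  have h := taylor_isLittleO (n := 2) hs hx₀ (by exact_mod_cast hf)
  refine h.congr_left fun x => ?_
  rw [taylorWithinEval_succ, taylorWithinEval_succ, taylor_within_zero_eval]
  simp only [iteratedDerivWithin_succ, iteratedDerivWithin_zero]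
  norm_num
  congr 1
  ring

/-! ### First and second variation of a distance -/

theorem inner_plane (v w : Plane) : inner ℝ v w = v 0 * w 0 + v 1 * w 1 := by
  simp [PiLp.inner_apply, Fin.sum_univ_two, mul_comm]

theorem rotJ_zero_apply (v : Plane) : rotJ v 0 = -(v 1) := by simp [rotJ]

theorem rotJ_one_apply (v : Plane) : rotJ v 1 = v 0 := by simp [rotJ]

theorem inner_rotJ_self (v : Plane) : inner ℝ (rotJ v) v = 0 := by
  rw [inner_plane, rotJ_zero_apply, rotJ_one_apply]
  ring

/-- Pythagoras in the orthogonal frame `v, J v`. -/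
theorem norm_sq_mul_norm_sq (v w : Plane) :
    ‖v‖ ^ 2 * ‖w‖ ^ 2 = (inner ℝ v w) ^ 2 + (inner ℝ (rotJ v) w) ^ 2 := by
  simp only [← real_inner_self_eq_norm_sq, inner_plane, rotJ_zero_apply, rotJ_one_apply]
  ring

/-- Decomposition of a vector in the orthogonal frame `v, J v`. -/
theorem norm_sq_smul_eq (v w : Plane) :
    ‖v‖ ^ 2 • w = (inner ℝ v w : ℝ) • v + (inner ℝ (rotJ v) w : ℝ) • rotJ v := by
  rw [← real_inner_self_eq_norm_sq, inner_plane, inner_plane, inner_plane]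
  ext i
  fin_cases i <;>
  · simp [rotJ_zero_apply, rotJ_one_apply]
    ring

theorem contDiff_rotJ {n : WithTop ℕ∞} : ContDiff ℝ n rotJ := by
  rw [contDiff_euclidean]
  intro i
  fin_cases i
  · simpa [rotJ_zero_apply] using (contDiff_euclidean.1 contDiff_id (1 : Fin 2)).neg
  · simpa [rotJ_one_apply] using contDiff_euclidean.1 contDiff_id (0 : Fin 2)

/-- Two vectors whose components along `D` agree up to sign and which have the same norm differ,
up to sign, by a multiple of `D`. -/
theorem exists_sign_norm_sq_mul_norm_sq_sub {D T T' : Plane} (hT : ‖T‖ = 1) (hT' : ‖T'‖ = 1)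
    (h : (inner ℝ D T : ℝ) ^ 2 = (inner ℝ D T' : ℝ) ^ 2) :
    ∃ b : ℝ, (b = 1 ∨ b = -1) ∧
      ‖D‖ ^ 2 * ‖T - b • T'‖ ^ 2 = (inner ℝ D (T - b • T') : ℝ) ^ 2 := by
  have h1 := norm_sq_mul_norm_sq D T
  have h2 := norm_sq_mul_norm_sq D T'
  rw [hT] at h1
  rw [hT'] at h2
  have h3 : (inner ℝ (rotJ D) T : ℝ) ^ 2 = (inner ℝ (rotJ D) T' : ℝ) ^ 2 := by linarith
  rcases sq_eq_sq_iff_eq_or_eq_neg.1 h3 with h4 | h4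
  · refine ⟨1, Or.inl rfl, ?_⟩
    rw [norm_sq_mul_norm_sq, inner_sub_right (rotJ D), real_inner_smul_right, h4]
    ring
  · refine ⟨-1, Or.inr rfl, ?_⟩
    rw [norm_sq_mul_norm_sq, inner_sub_right (rotJ D), real_inner_smul_right, h4]
    ring

/-- Expansion of the square of the sine barrier along a path. -/
theorem HasJetRight.sin_sq {σ : ℝ → ℝ} {σ₀ σ₁ : ℝ} (hσ : HasJetRight σ σ₀ σ₁ 0) (A B : ℝ) :
    HasJetRight (fun u => (A * Real.sin (B * σ u)) ^ 2) ((A * Real.sin (B * σ₀)) ^ 2)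
      (σ₁ * (2 * (A * Real.sin (B * σ₀)) * (A * B * Real.cos (B * σ₀))))
      (σ₁ ^ 2 * (2 * ((A * B * Real.cos (B * σ₀)) ^ 2
        - B ^ 2 * (A * Real.sin (B * σ₀)) ^ 2))) := by
  have hd1 : ∀ x, HasDerivAt (fun x : ℝ => (A * Real.sin (B * x)) ^ 2)
      (2 * (A * Real.sin (B * x)) * (A * B * Real.cos (B * x))) x := by
    intro x
    have h := ((((hasDerivAt_id x).const_mul B).sin).const_mul A).pow 2
    refine h.congr_deriv ?_
    simp only [id_eq, Nat.cast_ofNat, Nat.reduceSub, pow_one, mul_one]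
    ring
  have hd2 : ∀ x, HasDerivAt
      (fun x : ℝ => 2 * (A * Real.sin (B * x)) * (A * B * Real.cos (B * x)))
      (2 * ((A * B * Real.cos (B * x)) ^ 2 - B ^ 2 * (A * Real.sin (B * x)) ^ 2)) x := by
    intro x
    have h := (((((hasDerivAt_id x).const_mul B).sin).const_mul A).const_mul 2).mul
      ((((hasDerivAt_id x).const_mul B).cos).const_mul (A * B))
    refine h.congr_deriv ?_
    simp
    ring
  have e1 : deriv (fun x : ℝ => (A * Real.sin (B * x)) ^ 2)
      = fun x => 2 * (A * Real.sin (B * x)) * (A * B * Real.cos (B * x)) :=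
    funext fun x => (hd1 x).deriv
  have hc : ContDiffOn ℝ 2 (fun x : ℝ => (A * Real.sin (B * x)) ^ 2) univ := by
    apply ContDiff.contDiffOn
    fun_prop
  have ht := hc.isLittleO_taylor_two convex_univ (mem_univ σ₀)
  simp only [derivWithin_univ, e1, (hd2 σ₀).deriv] at ht
  refine (HasJetRight.comp ht hσ (by simp)).congr_coeff rfl (by simp) (by simp)

/-- The second variation inequality at a pair of points `P₀, Q₀` where the distance touches the
barrier `A sin (B σ)` from above. `TP, TQ` are the unit tangents, `kP, kQ` the curvature vectors
and `e₁, e₂` record whether `σ` grows along the two tangents. The first variation shows that `TP`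
and `± TQ` have the same component orthogonal to the chord; moving along `TP` and this `± TQ`
keeps the chord direction fixed, so that the quadratic term of the distance cancels. Only the
paths of the directions `(a, b)` below are used, never a path retreating at both points. -/
theorem second_variation {P₀ Q₀ TP TQ kP kQ : Plane} {σ₀ A B e₁ e₂ : ℝ}
    (he₁ : e₁ = 1 ∨ e₁ = -1) (he₂ : e₂ = 1 ∨ e₂ = -1)
    (hTP : ‖TP‖ = 1) (hTQ : ‖TQ‖ = 1) (hpos : 0 < ‖P₀ - Q₀‖)
    (heq : ‖P₀ - Q₀‖ = A * Real.sin (B * σ₀))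
    (hpaths : ∀ a b : ℝ, ((a = 1 ∨ a = -1) ∧ b = 0) ∨ (a = 0 ∧ (b = 1 ∨ b = -1)) ∨
        (a = 1 ∧ (b = 1 ∨ b = -1)) →
      ∃ (P Q : ℝ → Plane) (σ : ℝ → ℝ), HasJetRight P P₀ (a • TP) (a ^ 2 • kP) ∧
        HasJetRight Q Q₀ (b • TQ) (b ^ 2 • kQ) ∧ HasJetRight σ σ₀ (a * e₁ + b * e₂) 0 ∧
        ∀ᶠ u in 𝓝[>] 0, 0 ≤ A * Real.sin (B * σ u) ∧ A * Real.sin (B * σ u) ≤ ‖P u - Q u‖) :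
    -(4 * B ^ 2 * ‖P₀ - Q₀‖ ^ 2) ≤ inner ℝ (P₀ - Q₀) (kP - kQ) := by
  set D := P₀ - Q₀ with hD
  set Ψ := A * Real.sin (B * σ₀) with hΨ
  set Ψ' := A * B * Real.cos (B * σ₀) with hΨ'
  have key : ∀ a b : ℝ, ((a = 1 ∨ a = -1) ∧ b = 0) ∨ (a = 0 ∧ (b = 1 ∨ b = -1)) ∨
        (a = 1 ∧ (b = 1 ∨ b = -1)) →
      (0 ≤ 2 * inner ℝ D (a • TP - b • TQ) - (a * e₁ + b * e₂) * (2 * Ψ * Ψ')) ∧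
      (2 * inner ℝ D (a • TP - b • TQ) - (a * e₁ + b * e₂) * (2 * Ψ * Ψ') = 0 →
        0 ≤ 2 * (‖a • TP - b • TQ‖ ^ 2 + inner ℝ D (a ^ 2 • kP - b ^ 2 • kQ))
          - (a * e₁ + b * e₂) ^ 2 * (2 * (Ψ' ^ 2 - B ^ 2 * Ψ ^ 2))) := by
    intro a b hab
    obtain ⟨P, Q, σ, hP, hQ, hσ, hev⟩ := hpaths a b hab
    have hj := ((hP.sub hQ).norm_sq.sub (hσ.sin_sq A B)).congr_coeff
      (by rw [← hD, ← hΨ, heq, sub_self]) rfl rfl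
    refine hj.nonneg_coeff ?_
    filter_upwards [hev] with u hu
    have := pow_le_pow_left₀ hu.1 hu.2 2
    linarith
  -- Moving one point at a time, in both directions, the first variation vanishes.
  have hP1 := (key 1 0 (by simp)).1
  have hP2 := (key (-1) 0 (by simp)).1
  have hQ1 := (key 0 1 (by simp)).1
  have hQ2 := (key 0 (-1) (by simp)).1
  simp only [inner_sub_right, real_inner_smul_right] at hP1 hP2 hQ1 hQ2
  have hp : (inner ℝ D TP : ℝ) = e₁ * (Ψ * Ψ') := by linarith
  have hq : (inner ℝ D TQ : ℝ) = -(e₂ * (Ψ * Ψ')) := by linarith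
  have he₁2 : e₁ ^ 2 = 1 := by rcases he₁ with rfl | rfl <;> norm_num
  have he₂2 : e₂ ^ 2 = 1 := by rcases he₂ with rfl | rfl <;> norm_num
  -- With this sign `b`, the vector `TP - b • TQ` is parallel to the chord `D`.
  obtain ⟨b, hb, hb2⟩ := exists_sign_norm_sq_mul_norm_sq_sub (D := D) hTP hTQ
    (by rw [hp, hq, neg_sq, mul_pow e₁, mul_pow e₂, he₁2, he₂2])
  have hin : (inner ℝ D (TP - b • TQ) : ℝ) = (e₁ + b * e₂) * (Ψ * Ψ') := by
    rw [inner_sub_right, real_inner_smul_right, hp, hq]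
    ring
  have hk := (key 1 b (Or.inr (Or.inr ⟨rfl, hb⟩))).2 (by
    rw [one_smul, hin]
    ring)
  rw [hin, heq] at hb2
  have hΨ0 : 0 < Ψ := heq ▸ hpos
  have hn : ‖TP - b • TQ‖ ^ 2 = (e₁ + b * e₂) ^ 2 * Ψ' ^ 2 := by
    have : Ψ ^ 2 * ‖TP - b • TQ‖ ^ 2 = Ψ ^ 2 * ((e₁ + b * e₂) ^ 2 * Ψ' ^ 2) := by
      rw [hb2]
      ring
    exact mul_left_cancel₀ (by positivity) this
  have hb1 : b ^ 2 = 1 := by rcases hb with rfl | rfl <;> norm_num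
  rw [one_smul, hn, one_pow, one_smul, hb1, one_smul, one_mul] at hk
  -- The arclength between the two points is stationary or changes at rate two.
  have hs : (e₁ + b * e₂) ^ 2 ≤ 4 := by
    rcases he₁ with rfl | rfl <;> rcases he₂ with rfl | rfl <;> rcases hb with rfl | rfl <;>
      norm_num
  rw [heq]
  have : (e₁ + b * e₂) ^ 2 * (B ^ 2 * Ψ ^ 2) ≤ 4 * (B ^ 2 * Ψ ^ 2) :=
    mul_le_mul_of_nonneg_right hs (by positivity)
  linarith

/-- The first-order condition in time: a difference `D` that stays above an exponentially
decreasing barrier on `[0, t₀]` and touches it at `t₀` decreases at least at its rate. -/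
theorem inner_deriv_le_of_exp_barrier {D : ℝ → Plane} {D' : Plane} {t₀ μ K : ℝ} {s : Set ℝ}
    (ht₀ : 0 < t₀) (hs : Ico 0 t₀ ⊆ s) (hD : HasDerivWithinAt D D' s t₀) (hK : 0 ≤ K)
    (hle : ∀ t ∈ Ico 0 t₀, K * Real.exp (-(μ * t)) ≤ ‖D t‖)
    (heq : ‖D t₀‖ = K * Real.exp (-(μ * t₀))) :
    inner ℝ (D t₀) D' ≤ -(μ * ‖D t₀‖ ^ 2) := by
  have h1 : HasDerivWithinAt (fun t => ‖D t‖ ^ 2 - (K * Real.exp (-(μ * t))) ^ 2)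
      (2 * inner ℝ (D t₀) D' - 2 * (K * Real.exp (-(μ * t₀))) *
        (K * (Real.exp (-(μ * t₀)) * -μ))) s t₀ := by
    have he : HasDerivWithinAt (fun t => K * Real.exp (-(μ * t)))
        (K * (Real.exp (-(μ * t₀)) * -μ)) s t₀ := by
      have := ((((hasDerivAt_id t₀).const_mul μ).neg).exp).const_mul K
      simpa using this.hasDerivWithinAt
    refine ((hD.norm_sq).sub (he.pow 2)).congr_deriv ?_
    simp
  have h2 := h1.mono hs
  rw [hasDerivWithinAt_iff_tendsto_slope] at h2
  have hne : (𝓝[Ico 0 t₀ \ {t₀}] t₀).NeBot := by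
    have : Ico 0 t₀ \ {t₀} = Ico 0 t₀ := sdiff_singleton_eq_self (by simp)
    rw [this, nhdsWithin_Ico_eq_nhdsLT ht₀]
    infer_instance
  have h3 : 2 * inner ℝ (D t₀) D' - 2 * (K * Real.exp (-(μ * t₀))) *
        (K * (Real.exp (-(μ * t₀)) * -μ)) ≤ 0 := by
    refine le_of_tendsto h2 ?_
    filter_upwards [self_mem_nhdsWithin] with t ht
    have hlt : t - t₀ < 0 := by linarith [ht.1.2]
    rw [slope_def_field, heq, sub_self, sub_zero]
    refine div_nonpos_of_nonneg_of_nonpos ?_ hlt.le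
    have := pow_le_pow_left₀ (by positivity) (hle t ht.1) 2
    linarith
  rw [heq]
  linarith

/-! ### Reflected distance, reflections and supporting lines -/

section ReflectedDistance

variable {Ω : Set Plane}

theorem bddBelow_image_dist_add_dist (p q : Plane) (s : Set Plane) :
    BddBelow ((fun z => dist p z + dist q z) '' s) :=
  ⟨0, by rintro _ ⟨z, _, rfl⟩; positivity⟩

theorem reflectedDist_le {z : Plane} (hz : z ∈ frontier Ω) (p q : Plane) :
    reflectedDist Ω p q ≤ dist p z + dist q z :=
  csInf_le (bddBelow_image_dist_add_dist p q _) ⟨z, hz, rfl⟩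

theorem le_reflectedDist (h : (frontier Ω).Nonempty) {p q : Plane} {r : ℝ}
    (hr : ∀ z ∈ frontier Ω, r ≤ dist p z + dist q z) : r ≤ reflectedDist Ω p q :=
  le_csInf (h.image _) (by rintro _ ⟨z, hz, rfl⟩; exact hr z hz)

theorem reflectedDist_nonneg (h : (frontier Ω).Nonempty) (p q : Plane) :
    0 ≤ reflectedDist Ω p q :=
  le_reflectedDist h fun _ _ => by positivity

theorem reflectedDist_comm (p q : Plane) : reflectedDist Ω p q = reflectedDist Ω q p := by
  simp only [reflectedDist, add_comm]

theorem reflectedDist_eq_dist {p : Plane} (hp : p ∈ frontier Ω) (q : Plane) :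
    reflectedDist Ω p q = dist p q := by
  refine le_antisymm ?_ (le_reflectedDist ⟨p, hp⟩ fun z _ => dist_triangle_right _ _ _)
  simpa [dist_comm] using reflectedDist_le hp p q

theorem exists_reflectedDist_eq (h : (frontier Ω).Nonempty) (p q : Plane) :
    ∃ z ∈ frontier Ω, reflectedDist Ω p q = dist p z + dist q z := by
  obtain ⟨z₀, hz₀⟩ := h
  have hcomp : IsCompact (frontier Ω ∩ Metric.closedBall p (dist p z₀ + dist q z₀)) :=
    (isCompact_closedBall _ _).inter_left isClosed_frontier
  obtain ⟨z, hz, hmin⟩ := hcomp.exists_isMinOn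
    (f := fun z => dist p z + dist q z)
    ⟨z₀, hz₀, by rw [Metric.mem_closedBall, dist_comm]; linarith [dist_nonneg (x := q) (y := z₀)]⟩
    (by fun_prop)
  refine ⟨z, hz.1, le_antisymm (reflectedDist_le hz.1 p q)
    (le_reflectedDist ⟨z₀, hz₀⟩ fun y hy => ?_)⟩
  by_cases hyb : y ∈ Metric.closedBall p (dist p z₀ + dist q z₀)
  · exact hmin ⟨hy, hyb⟩
  · rw [Metric.mem_closedBall, not_le, dist_comm y] at hyb
    have h0 : dist p z + dist q z ≤ dist p z₀ + dist q z₀ :=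
      hmin ⟨hz₀, by
        rw [Metric.mem_closedBall, dist_comm]; linarith [dist_nonneg (x := q) (y := z₀)]⟩
    linarith [dist_nonneg (x := q) (y := y)]

theorem reflectedDist_le_add (h : (frontier Ω).Nonempty) (p q p' q' : Plane) :
    reflectedDist Ω p q ≤ reflectedDist Ω p' q' + (dist p p' + dist q q') := by
  obtain ⟨z, hz, he⟩ := exists_reflectedDist_eq h p' q'
  have := reflectedDist_le hz p q
  linarith [dist_triangle p p' z, dist_triangle q q' z]

theorem continuous_reflectedDist (h : (frontier Ω).Nonempty) :
    Continuous fun r : Plane × Plane => reflectedDist Ω r.1 r.2 := by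
  refine (LipschitzWith.of_dist_le_mul (K := 2) fun r r' => ?_).continuous
  have h1 := reflectedDist_le_add h r.1 r.2 r'.1 r'.2
  have h2 := reflectedDist_le_add h r'.1 r'.2 r.1 r.2
  rw [dist_comm r'.1, dist_comm r'.2] at h2
  have h3 : dist r.1 r'.1 ≤ dist r r' := le_max_left _ _
  have h4 : dist r.2 r'.2 ≤ dist r r' := le_max_right _ _
  rw [Real.dist_eq, abs_le]
  norm_num
  constructor <;> linarith

theorem ContinuousOn.reflectedDist {X : Type*} [TopologicalSpace X] {K : Set X} {f g : X → Plane}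
    (h : (frontier Ω).Nonempty) (hf : ContinuousOn f K) (hg : ContinuousOn g K) :
    ContinuousOn (fun p => reflectedDist Ω (f p) (g p)) K := by
  have hc := (continuous_reflectedDist h).comp_continuousOn (hf.prodMk hg)
  exact hc

/-- In the definition of the reflected distance, the point `z` may range over the whole complement
of the interior. -/
theorem reflectedDist_le_of_notMem_interior (hΩ : IsClosed Ω) {p z : Plane} (hp : p ∈ Ω)
    (hz : z ∉ interior Ω) (q : Plane) : reflectedDist Ω p q ≤ dist p z + dist q z := by
  by_cases hzΩ : z ∈ Ω
  · exact reflectedDist_le (by rw [hΩ.frontier_eq]; exact ⟨hzΩ, hz⟩) p q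
  · obtain ⟨w, hw, hwf⟩ : ∃ w ∈ segment ℝ p z, w ∈ frontier Ω := by
      by_contra! hno
      have hsub : segment ℝ p z ⊆ interior Ω ∪ Ωᶜ := fun w hw => by
        by_cases hwΩ : w ∈ Ω
        · refine Or.inl (by_contra fun hwi => hno w hw ?_)
          rw [hΩ.frontier_eq]
          exact ⟨hwΩ, hwi⟩
        · exact Or.inr hwΩ
      have hpi : p ∈ interior Ω := (hsub (left_mem_segment ℝ p z)).resolve_right fun h => h hp
      obtain ⟨w, -, hw1, hw2⟩ := (convex_segment p z).isPreconnected _ _ isOpen_interior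
        hΩ.isOpen_compl hsub ⟨p, left_mem_segment ℝ p z, hpi⟩
        ⟨z, right_mem_segment ℝ p z, hzΩ⟩
      exact hw2 (interior_subset hw1)
    have h1 := reflectedDist_le hwf p q
    have h2 := dist_add_dist_of_mem_segment hw
    linarith [dist_triangle_right q w z, dist_triangle q z w, dist_comm z w]

end ReflectedDistance

/-- The affine reflection of the plane in the line through `z` orthogonal to the unit vector `n`. -/
noncomputable def lineReflection (z n p : Plane) : Plane := p - (2 * inner ℝ n (p - z)) • n

/-- The linear part of `lineReflection z n`. -/
noncomputable def lineReflectionLinear (n : Plane) : Plane →L[ℝ] Plane :=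
  ContinuousLinearMap.id ℝ Plane - ((2 : ℝ) • innerSL ℝ n).smulRight n

theorem lineReflectionLinear_apply (n v : Plane) :
    lineReflectionLinear n v = v - (2 * inner ℝ n v) • n := by
  simp [lineReflectionLinear]

theorem lineReflection_eq (z n p : Plane) :
    lineReflection z n p = z + lineReflectionLinear n (p - z) := by
  rw [lineReflectionLinear_apply, lineReflection]
  abel

theorem norm_lineReflectionLinear {n : Plane} (hn : ‖n‖ = 1) (v : Plane) :
    ‖lineReflectionLinear n v‖ = ‖v‖ := by
  have : ‖lineReflectionLinear n v‖ ^ 2 = ‖v‖ ^ 2 := by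
    rw [lineReflectionLinear_apply, norm_sub_sq_real, norm_smul, mul_pow, hn,
      real_inner_smul_right, real_inner_comm, Real.norm_eq_abs, sq_abs]
    ring
  exact (pow_left_inj₀ (norm_nonneg _) (norm_nonneg _) two_ne_zero).1 this

theorem lineReflectionLinear_of_inner_eq_zero {n v : Plane} (h : inner ℝ n v = 0) :
    lineReflectionLinear n v = v := by
  simp [lineReflectionLinear_apply, h]

theorem lineReflectionLinear_self {n : Plane} (hn : ‖n‖ = 1) : lineReflectionLinear n n = -n := by
  rw [lineReflectionLinear_apply, real_inner_self_eq_norm_sq, hn]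
  module

theorem lineReflection_self (z n : Plane) : lineReflection z n z = z := by
  simp [lineReflection]

theorem HasJetRight.lineReflection {f : ℝ → Plane} {f₀ f₁ f₂ : Plane} (hf : HasJetRight f f₀ f₁ f₂)
    (z n : Plane) :
    HasJetRight (fun u => lineReflection z n (f u)) (lineReflection z n f₀)
      (lineReflectionLinear n f₁) (lineReflectionLinear n f₂) := by
  simp only [lineReflection_eq]
  have h := (HasJetRight.const z).add ((hf.sub (HasJetRight.const z)).clm (lineReflectionLinear n))
  exact h.congr_coeff rfl (by simp) (by simp)

/-- No point of a supporting line is interior. -/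
theorem notMem_interior_of_support {Ω : Set Plane} {z n w : Plane} (hn : ‖n‖ = 1)
    (hsup : ∀ q ∈ Ω, inner ℝ n (q - z) ≤ 0) (hw : inner ℝ n (w - z) = 0) : w ∉ interior Ω := by
  intro hwi
  have hc : Tendsto (fun t : ℝ => w + t • n) (𝓝[>] 0) (𝓝 w) := by
    have : Continuous fun t : ℝ => w + t • n := by fun_prop
    have h := this.tendsto 0
    simp only [zero_smul, add_zero] at h
    exact h.mono_left nhdsWithin_le_nhds
  have hev := hc.eventually (isOpen_interior.mem_nhds hwi)
  have hpos : ∀ᶠ t : ℝ in 𝓝[>] 0, 0 < t := self_mem_nhdsWithin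
  obtain ⟨t, ht, ht0⟩ := (hev.and hpos).exists
  have h1 := hsup _ (interior_subset ht)
  have h2 : w + t • n - z = (w - z) + t • n := by abel
  rw [h2, inner_add_right, hw, real_inner_smul_right, real_inner_self_eq_norm_sq, hn] at h1
  linarith

/-- Reflecting one of the two points in a supporting line can only increase the reflected
distance. -/
theorem reflectedDist_le_dist_lineReflection {Ω : Set Plane} (hΩ : IsClosed Ω) {z n p q : Plane}
    (hn : ‖n‖ = 1) (hsup : ∀ q ∈ Ω, inner ℝ n (q - z) ≤ 0) (hp : p ∈ Ω) (hq : q ∈ Ω) :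
    reflectedDist Ω p q ≤ dist p (lineReflection z n q) := by
  have hcont : ContinuousOn (fun w => (inner ℝ n (w - z) : ℝ))
      (segment ℝ p (lineReflection z n q)) := by fun_prop
  have hRq : inner ℝ n (lineReflection z n q - z) = -inner ℝ n (q - z) := by
    rw [lineReflection, sub_right_comm, inner_sub_right, real_inner_smul_right,
      real_inner_self_eq_norm_sq, hn]
    ring
  obtain ⟨w, hw, hw0⟩ := (convex_segment p (lineReflection z n q)).isPreconnected.intermediate_value
    (left_mem_segment ℝ _ _) (right_mem_segment ℝ _ _) hcont
    (show (0 : ℝ) ∈ Icc _ _ from ⟨hsup p hp, by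
      show 0 ≤ inner ℝ n (lineReflection z n q - z)
      rw [hRq]; linarith [hsup q hq]⟩)
  have h1 := reflectedDist_le_of_notMem_interior hΩ hp (notMem_interior_of_support hn hsup hw0) q
  have h2 := dist_add_dist_of_mem_segment hw
  have h3 : dist w (lineReflection z n q) = dist q w := by
    have hww : lineReflectionLinear n (w - z) = w - z := lineReflectionLinear_of_inner_eq_zero hw0
    have : w - lineReflection z n q = lineReflectionLinear n (w - q) := by
      rw [lineReflection_eq, show w - q = (w - z) - (q - z) by abel,
        map_sub (lineReflectionLinear n) (w - z), hww]
      abel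
    rw [dist_eq_norm, this, norm_lineReflectionLinear hn, ← dist_eq_norm, dist_comm]
  linarith

section Boundary

variable {Ω : Set Plane} {p : Plane} {U : Set Plane} {ρ : Plane → ℝ}

theorem IsLocalDefiningFunction.eq_zero (h : IsLocalDefiningFunction Ω p U ρ) (hΩ : IsClosed Ω)
    {z : Plane} (hz : z ∈ frontier Ω) (hzU : z ∈ U) : ρ z = 0 := by
  have hzΩ : z ∈ Ω ∩ U := ⟨hΩ.frontier_subset hz, hzU⟩
  rw [h.inter_eq] at hzΩ
  refine le_antisymm hzΩ.2 (not_lt.1 fun hlt => ?_)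
  have hc : ContinuousAt ρ z := h.contDiffOn.continuousOn.continuousAt (h.isOpen.mem_nhds hzU)
  have hmem : Ω ∈ 𝓝 z := by
    filter_upwards [hc.eventually (gt_mem_nhds hlt), h.isOpen.mem_nhds hzU] with w hw hwU
    have : w ∈ Ω ∩ U := by
      rw [h.inter_eq]
      exact ⟨hwU, hw.le⟩
    exact this.1
  exact hz.2 (mem_interior_iff_mem_nhds.2 hmem)

theorem IsLocalDefiningFunction.contDiffAt (h : IsLocalDefiningFunction Ω p U ρ) :
    ContDiffAt ℝ 2 ρ p :=
  h.contDiffOn.contDiffAt (h.isOpen.mem_nhds h.mem)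

/-- The tangent line at a boundary point is a supporting line. -/
theorem IsLocalDefiningFunction.inner_gradient_nonpos (h : IsLocalDefiningFunction Ω p U ρ)
    (hΩ : IsClosed Ω) (hconv : Convex ℝ Ω) (hp : p ∈ frontier Ω) {q : Plane} (hq : q ∈ Ω) :
    inner ℝ (gradient ρ p) (q - p) ≤ 0 := by
  have hg : HasFDerivAt ρ (InnerProductSpace.toDual ℝ Plane (gradient ρ p)) p :=
    (h.contDiffAt.differentiableAt (by norm_num)).hasGradientAt
  have hline : HasDerivAt (fun t : ℝ => p + t • (q - p)) (q - p) 0 := by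
    simpa using ((hasDerivAt_id (0 : ℝ)).smul_const (q - p)).const_add p
  have hg' : HasFDerivAt ρ (InnerProductSpace.toDual ℝ Plane (gradient ρ p))
      (p + (0 : ℝ) • (q - p)) := by simpa using hg
  have hd := (hg'.comp_hasDerivAt (0 : ℝ) hline).hasDerivWithinAt (s := Ioi 0)
  rw [hasDerivWithinAt_iff_tendsto_slope' (by simp)] at hd
  rw [InnerProductSpace.toDual_apply_apply] at hd
  refine le_of_tendsto hd ?_
  have hU : ∀ᶠ t : ℝ in 𝓝[>] 0, p + t • (q - p) ∈ U := by
    have hc := hline.continuousAt.tendsto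
    simp only [zero_smul, add_zero] at hc
    exact (hc.mono_left nhdsWithin_le_nhds) (h.isOpen.mem_nhds h.mem)
  have hlt : ∀ᶠ t : ℝ in 𝓝[>] 0, t < 1 :=
    nhdsWithin_le_nhds (gt_mem_nhds (by norm_num))
  filter_upwards [hU, hlt, self_mem_nhdsWithin] with t htU ht1 ht0
  have hpΩ := hΩ.frontier_subset hp
  have ht0' : 0 < t := ht0
  have hmem : p + t • (q - p) ∈ Ω ∩ U :=
    ⟨hconv.add_smul_sub_mem hpΩ hq ⟨ht0'.le, ht1.le⟩, htU⟩
  rw [h.inter_eq] at hmem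
  rw [slope_def_field]
  simp only [Function.comp, zero_smul, add_zero, sub_zero, h.eq_zero hΩ hp h.mem]
  exact div_nonpos_of_nonpos_of_nonneg hmem.2 ht0'.le

/-- Boundary chords near `p` are almost orthogonal to the normal at `p`. -/
theorem IsLocalDefiningFunction.eventually_abs_inner_le (h : IsLocalDefiningFunction Ω p U ρ)
    (hΩ : IsClosed Ω) {ε : ℝ} (hε : 0 < ε) :
    ∀ᶠ r : Plane × Plane in 𝓝 (p, p), r.1 ∈ frontier Ω → r.2 ∈ frontier Ω →
      |inner ℝ (gradient ρ p) (r.1 - r.2)| ≤ ε * ‖r.1 - r.2‖ := by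
  have hs := h.contDiffAt.hasStrictFDerivAt (by norm_num)
  have hf : fderiv ℝ ρ p = InnerProductSpace.toDual ℝ Plane (gradient ρ p) :=
    HasFDerivAt.fderiv (h.contDiffAt.differentiableAt (by norm_num)).hasGradientAt
  rw [hf] at hs
  have h1 := hs.isLittleO.def hε
  have hU : ∀ᶠ r : Plane × Plane in 𝓝 (p, p), r.1 ∈ U ∧ r.2 ∈ U := by
    have := (h.isOpen.prod h.isOpen).mem_nhds (show (p, p) ∈ U ×ˢ U from ⟨h.mem, h.mem⟩)
    exact this
  filter_upwards [h1, hU] with r hr hrU hr1 hr2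
  rw [h.eq_zero hΩ hr1 hrU.1, h.eq_zero hΩ hr2 hrU.2, InnerProductSpace.toDual_apply_apply] at hr
  simpa [abs_sub_comm] using hr

end Boundary

/-- At every boundary point there is an outward unit normal, and it defines a supporting
half-plane. -/
theorem IsConvexC2Domain.exists_normal {Ω : Set Plane} (hΩ : IsConvexC2Domain Ω) {p : Plane}
    (hp : p ∈ frontier Ω) :
    ∃ ν : Plane, IsOutwardUnitNormal Ω p ν ∧ ‖ν‖ = 1 ∧ (∀ q ∈ Ω, inner ℝ ν (q - p) ≤ 0) ∧
      ∀ ε > 0, ∀ᶠ r : Plane × Plane in 𝓝 (p, p), r.1 ∈ frontier Ω → r.2 ∈ frontier Ω →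
        |inner ℝ ν (r.1 - r.2)| ≤ ε * ‖r.1 - r.2‖ := by
  obtain ⟨U, ρ, h⟩ := hΩ.boundary p hp
  have hg : 0 < ‖gradient ρ p‖ := norm_pos_iff.2 h.gradient_ne_zero
  refine ⟨_, ⟨U, ρ, h, rfl⟩, ?_, fun q hq => ?_, fun ε hε => ?_⟩
  · rw [norm_smul, norm_inv, norm_norm, inv_mul_cancel₀ hg.ne']
  · rw [real_inner_smul_left]
    exact mul_nonpos_of_nonneg_of_nonpos (by positivity)
      (h.inner_gradient_nonpos hΩ.isClosed hΩ.convex hp hq)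
  · filter_upwards [h.eventually_abs_inner_le hΩ.isClosed (mul_pos hε hg)] with r hr h1 h2
    rw [real_inner_smul_left, abs_mul, abs_of_pos (by positivity), inv_mul_le_iff₀ hg]
    have := hr h1 h2
    linarith

/-! ### Second variation along a curve orthogonal to the boundary -/

/-- The arclength parameter of a curve `g : [0, 1] → ℝ²`, measured from `g 0`. -/
noncomputable def arcParam (g : ℝ → Plane) (x : ℝ) : ℝ := ∫ u in (0 : ℝ)..x, ‖velocity g u‖

/-- The unit tangent `T = g' / |g'|`. -/
noncomputable def unitTangent (g : ℝ → Plane) (x : ℝ) : Plane :=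
  ‖velocity g x‖⁻¹ • velocity g x

/-- The curvature vector `-κ N`. -/
noncomputable def curvatureVector (g : ℝ → Plane) (x : ℝ) : Plane :=
  -(signedCurvature g x • unitNormal g x)

theorem norm_unitTangent {g : ℝ → Plane} {x : ℝ} (h : velocity g x ≠ 0) :
    ‖unitTangent g x‖ = 1 := by
  rw [unitTangent, norm_smul, norm_inv, norm_norm, inv_mul_cancel₀ (norm_ne_zero_iff.2 h)]

theorem curvatureVector_eq (g : ℝ → Plane) (x : ℝ) :
    curvatureVector g x = (inner ℝ (rotJ (velocity g x)) (velocity (velocity g) x) /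
      ‖velocity g x‖ ^ 3 * ‖velocity g x‖⁻¹) • rotJ (velocity g x) := by
  rw [curvatureVector, signedCurvature, unitNormal, smul_neg, neg_neg, smul_smul]

theorem inner_velocity_curvatureVector (g : ℝ → Plane) (x : ℝ) :
    inner ℝ (velocity g x) (curvatureVector g x) = 0 := by
  rw [curvatureVector_eq, real_inner_smul_right, real_inner_comm (rotJ (velocity g x)), inner_rotJ_self,
    mul_zero]

theorem inner_unitTangent_curvatureVector (g : ℝ → Plane) (x : ℝ) :
    inner ℝ (unitTangent g x) (curvatureVector g x) = 0 := by
  rw [unitTangent, real_inner_smul_left, inner_velocity_curvatureVector, mul_zero]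

/-- The curvature vector is the normal part of `g''`, divided by the square of the speed. -/
theorem norm_sq_smul_curvatureVector {g : ℝ → Plane} {x : ℝ} (h : velocity g x ≠ 0) :
    ‖velocity g x‖ ^ 2 • curvatureVector g x = velocity (velocity g) x -
      (inner ℝ (velocity g x) (velocity (velocity g) x) / ‖velocity g x‖ ^ 2) • velocity g x := by
  have hv : ‖velocity g x‖ ≠ 0 := norm_ne_zero_iff.2 h
  have h2 : ‖velocity g x‖ ^ 2 ≠ 0 := pow_ne_zero 2 hv
  have hd := norm_sq_smul_eq (velocity g x) (velocity (velocity g) x)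
  apply smul_right_injective _ h2
  simp only
  rw [smul_sub, hd, smul_smul _ (_ / _), mul_div_cancel₀ _ h2, add_sub_cancel_left,
    curvatureVector_eq, smul_smul, smul_smul]
  congr 1
  field_simp

section Curve

variable {g : ℝ → Plane}

theorem contDiffOn_velocity (hg : ContDiffOn ℝ ∞ g (Icc 0 1)) :
    ContDiffOn ℝ ∞ (velocity g) (Icc 0 1) :=
  hg.derivWithin (uniqueDiffOn_Icc zero_lt_one) (by norm_num)

theorem contDiffOn_norm_velocity (hg : ContDiffOn ℝ ∞ g (Icc 0 1))
    (himm : ∀ x ∈ Icc (0 : ℝ) 1, velocity g x ≠ 0) :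
    ContDiffOn ℝ ∞ (fun x => ‖velocity g x‖) (Icc 0 1) :=
  (contDiffOn_velocity hg).norm ℝ himm

theorem continuousOn_norm_velocity (hg : ContDiffOn ℝ ∞ g (Icc 0 1)) :
    ContinuousOn (fun x => ‖velocity g x‖) (Icc 0 1) :=
  (contDiffOn_velocity hg).continuousOn.norm

theorem intervalIntegrable_norm_velocity (hg : ContDiffOn ℝ ∞ g (Icc 0 1)) {x y : ℝ}
    (hx : x ∈ Icc (0 : ℝ) 1) (hy : y ∈ Icc (0 : ℝ) 1) :
    IntervalIntegrable (fun u => ‖velocity g u‖) MeasureTheory.volume x y :=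
  ((continuousOn_norm_velocity hg).mono (uIcc_subset_Icc hx hy)).intervalIntegrable

theorem integral_norm_velocity (hg : ContDiffOn ℝ ∞ g (Icc 0 1)) {x y : ℝ}
    (hx : x ∈ Icc (0 : ℝ) 1) (hy : y ∈ Icc (0 : ℝ) 1) :
    ∫ u in x..y, ‖velocity g u‖ = arcParam g y - arcParam g x :=
  (intervalIntegral.integral_interval_sub_left
    (intervalIntegrable_norm_velocity hg (by simp) hy)
    (intervalIntegrable_norm_velocity hg (by simp) hx)).symm

theorem arcParam_zero (g : ℝ → Plane) : arcParam g 0 = 0 := by simp [arcParam]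

theorem hasDerivWithinAt_arcParam (hg : ContDiffOn ℝ ∞ g (Icc 0 1)) {x : ℝ}
    (hx : x ∈ Icc (0 : ℝ) 1) :
    HasDerivWithinAt (arcParam g) ‖velocity g x‖ (Icc 0 1) x := by
  have : Fact (x ∈ Icc (0 : ℝ) 1) := ⟨hx⟩
  exact intervalIntegral.integral_hasDerivWithinAt_right
    (intervalIntegrable_norm_velocity hg (by simp) hx)
    ((continuousOn_norm_velocity hg).stronglyMeasurableAtFilter_nhdsWithin measurableSet_Icc x)
    (continuousOn_norm_velocity hg x hx)

theorem strictMonoOn_arcParam (hg : ContDiffOn ℝ ∞ g (Icc 0 1))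
    (himm : ∀ x ∈ Icc (0 : ℝ) 1, velocity g x ≠ 0) : StrictMonoOn (arcParam g) (Icc 0 1) := by
  refine strictMonoOn_of_hasDerivWithinAt_pos (convex_Icc 0 1)
    (fun x hx => (hasDerivWithinAt_arcParam hg hx).continuousWithinAt)
    (fun x hx => (hasDerivWithinAt_arcParam hg (interior_subset hx)).mono interior_subset)
    fun x hx => norm_pos_iff.2 (himm x (interior_subset hx))

theorem arcParam_mem (hg : ContDiffOn ℝ ∞ g (Icc 0 1))
    (himm : ∀ x ∈ Icc (0 : ℝ) 1, velocity g x ≠ 0) {x : ℝ} (hx : x ∈ Icc (0 : ℝ) 1) :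
    arcParam g x ∈ Icc 0 (arcParam g 1) := by
  have hm := (strictMonoOn_arcParam hg himm).monotoneOn
  constructor
  · simpa [arcParam_zero] using hm (by simp) hx hx.1
  · exact hm hx (by simp) hx.2

theorem arcParam_isLittleO_taylor (hg : ContDiffOn ℝ ∞ g (Icc 0 1))
    (himm : ∀ x ∈ Icc (0 : ℝ) 1, velocity g x ≠ 0) {x₀ : ℝ} (hx₀ : x₀ ∈ Icc (0 : ℝ) 1) :
    (fun x => arcParam g x - (arcParam g x₀ + (x - x₀) • ‖velocity g x₀‖
      + ((x - x₀) ^ 2 / 2) • (inner ℝ (velocity g x₀) (velocity (velocity g) x₀)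
        / ‖velocity g x₀‖))) =o[𝓝[Icc 0 1] x₀] fun x => (x - x₀) ^ 2 := by
  have hu := uniqueDiffOn_Icc (zero_lt_one (α := ℝ))
  have hd : EqOn (derivWithin (arcParam g) (Icc 0 1)) (fun x => ‖velocity g x‖) (Icc 0 1) :=
    fun x hx => (hasDerivWithinAt_arcParam hg hx).derivWithin (hu x hx)
  have hc : ContDiffOn ℝ (1 + 1) (arcParam g) (Icc 0 1) := by
    rw [contDiffOn_succ_iff_derivWithin hu]
    refine ⟨fun x hx => (hasDerivWithinAt_arcParam hg hx).differentiableWithinAt, by simp, ?_⟩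
    exact ((contDiffOn_norm_velocity hg himm).of_le (by exact_mod_cast le_top)).congr hd
  have hc' : ContDiffOn ℝ 2 (arcParam g) (Icc 0 1) := by
    rwa [one_add_one_eq_two] at hc
  have ht := hc'.isLittleO_taylor_two (convex_Icc 0 1) hx₀
  have hv : HasDerivWithinAt (velocity g) (velocity (velocity g) x₀) (Icc 0 1) x₀ :=
    ((contDiffOn_velocity hg).differentiableOn (by norm_num) x₀ hx₀).hasDerivWithinAt
  have hn : 0 < ‖velocity g x₀‖ := norm_pos_iff.2 (himm x₀ hx₀)
  have hd2 : derivWithin (derivWithin (arcParam g) (Icc 0 1)) (Icc 0 1) x₀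
      = inner ℝ (velocity g x₀) (velocity (velocity g) x₀) / ‖velocity g x₀‖ := by
    rw [derivWithin_congr hd (hd hx₀)]
    have h1 := hv.norm_sq.sqrt (by positivity)
    simp only [Real.sqrt_sq (norm_nonneg _)] at h1
    rw [h1.derivWithin (hu x₀ hx₀)]
    field_simp
  rwa [hd hx₀, hd2] at ht

/-- Through every point of the curve there is a path along the curve, in each direction in which
the curve continues, that is parametrised by arclength up to second order. -/
theorem exists_arclength_path (hg : ContDiffOn ℝ ∞ g (Icc 0 1))
    (himm : ∀ x ∈ Icc (0 : ℝ) 1, velocity g x ≠ 0) {x₀ a : ℝ} (hx₀ : x₀ ∈ Icc (0 : ℝ) 1)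
    (ha : a = 0 ∨ (a = 1 ∧ x₀ < 1) ∨ (a = -1 ∧ 0 < x₀)) :
    ∃ ξ : ℝ → ℝ, (∀ᶠ u in 𝓝[>] 0, ξ u ∈ Icc (0 : ℝ) 1) ∧ Tendsto ξ (𝓝[>] 0) (𝓝 x₀) ∧
      HasJetRight (fun u => g (ξ u)) (g x₀) (a • unitTangent g x₀)
        (a ^ 2 • curvatureVector g x₀) ∧
      HasJetRight (fun u => arcParam g (ξ u)) (arcParam g x₀) a 0 := by
  have hn : 0 < ‖velocity g x₀‖ := norm_pos_iff.2 (himm x₀ hx₀)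
  set v := ‖velocity g x₀‖ with hv
  set I : ℝ := inner ℝ (velocity g x₀) (velocity (velocity g) x₀) with hI
  -- The second-order coefficient is chosen so that the speed is constant to first order.
  set c : ℝ := -(a ^ 2 * I / v ^ 4) with hc
  have hξ : HasJetRight (fun u : ℝ => x₀ + u * (a / v) + u ^ 2 / 2 * c) x₀ (a / v) c := by
    simp [HasJetRight]
  have hmem : ∀ᶠ u : ℝ in 𝓝[>] 0, x₀ + u * (a / v) + u ^ 2 / 2 * c ∈ Icc (0 : ℝ) 1 := by
    have hpos : ∀ᶠ u : ℝ in 𝓝[>] 0, 0 < u := self_mem_nhdsWithin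
    have hlim : Tendsto (fun u : ℝ => a / v + u / 2 * c) (𝓝[>] 0) (𝓝 (a / v)) := by
      have : Continuous fun u : ℝ => a / v + u / 2 * c := by fun_prop
      have h := this.tendsto 0
      simp only [zero_div, zero_mul, add_zero] at h
      exact h.mono_left nhdsWithin_le_nhds
    rcases ha with rfl | ⟨rfl, h1⟩ | ⟨rfl, h0⟩
    · simpa [hc] using hx₀
    · filter_upwards [hpos, hlim.eventually (lt_mem_nhds (by positivity)),
        hξ.tendsto.eventually (gt_mem_nhds h1)] with u hu hu1 hu2
      refine ⟨?_, hu2.le⟩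
      have := mul_pos hu hu1
      linarith [hx₀.1]
    · filter_upwards [hpos, hlim.eventually (gt_mem_nhds (div_neg_of_neg_of_pos (by norm_num) hn)),
        hξ.tendsto.eventually (lt_mem_nhds h0)] with u hu hu1 hu2
      refine ⟨hu2.le, ?_⟩
      have := mul_neg_of_pos_of_neg hu hu1
      linarith [hx₀.2]
  refine ⟨_, hmem, hξ.tendsto, ?_, ?_⟩
  · have ht := (hg.of_le (m := 2) (WithTop.coe_le_coe.2 (le_top : (2 : ℕ∞) ≤ ⊤))).isLittleO_taylor_two
      (convex_Icc 0 1) hx₀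
    refine (HasJetRight.comp ht hξ hmem).congr_coeff rfl ?_ ?_
    · change (a / v) • velocity g x₀ = a • (v⁻¹ • velocity g x₀)
      rw [smul_smul, div_eq_mul_inv]
    · change (a / v) ^ 2 • velocity (velocity g) x₀ + c • velocity g x₀ = _
      have hk := norm_sq_smul_curvatureVector (himm x₀ hx₀)
      rw [← hv, ← hI] at hk
      have hk' : curvatureVector g x₀ = (v ^ 2)⁻¹ • (velocity (velocity g) x₀
          - (I / v ^ 2) • velocity g x₀) := by
        rw [← hk, smul_smul, inv_mul_cancel₀ (by positivity), one_smul]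
      rw [hk', hc, smul_sub, smul_sub, smul_smul, smul_smul, smul_smul, sub_eq_add_neg, ← neg_smul]
      congr 2 <;> field_simp
  · refine (HasJetRight.comp (arcParam_isLittleO_taylor hg himm hx₀) hξ hmem).congr_coeff
      rfl ?_ ?_
    · rw [smul_eq_mul, ← hv]
      field_simp
    · simp only [smul_eq_mul]
      rw [hc, ← hv, ← hI]
      field_simp
      ring

end Curve

/-- At the endpoint with parameter `e` the curve `g` meets `∂Ω` orthogonally: the line through
`g e` orthogonal to the curve supports `Ω`. -/
def MeetsBoundaryOrthogonally (Ω : Set Plane) (g : ℝ → Plane) (e : ℝ) : Prop :=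
  ∃ n : Plane, ‖n‖ = 1 ∧ (∀ q ∈ Ω, inner ℝ n (q - g e) ≤ 0) ∧
    (unitTangent g e = n ∨ unitTangent g e = -n)

/-- Reflection in the supporting line at an orthogonal endpoint prolongs the curve in a way that
preserves its expansion up to second order. -/
theorem MeetsBoundaryOrthogonally.exists_reflected_jet {Ω : Set Plane} {g : ℝ → Plane} {e : ℝ}
    (h : MeetsBoundaryOrthogonally Ω g e) :
    ∃ n : Plane, ‖n‖ = 1 ∧ (∀ q ∈ Ω, inner ℝ n (q - g e) ≤ 0) ∧ ∀ (P : ℝ → Plane) (a : ℝ),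
      HasJetRight P (g e) (a • unitTangent g e) (a ^ 2 • curvatureVector g e) →
      HasJetRight (fun u => lineReflection (g e) n (P u)) (g e) ((-a) • unitTangent g e)
        ((-a) ^ 2 • curvatureVector g e) := by
  obtain ⟨n, hn, hsup, hT⟩ := h
  refine ⟨n, hn, hsup, fun P a hP => ?_⟩
  refine (hP.lineReflection (g e) n).congr_coeff (lineReflection_self _ _) ?_ ?_
  · have : lineReflectionLinear n (unitTangent g e) = -unitTangent g e := by
      rcases hT with hT | hT
      · rw [hT, lineReflectionLinear_self hn]
      · rw [hT, map_neg, lineReflectionLinear_self hn]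
    rw [map_smul, this, smul_neg, neg_smul]
  · have h0 := inner_unitTangent_curvatureVector g e
    have : inner ℝ n (curvatureVector g e) = 0 := by
      rcases hT with hT | hT
      · rwa [hT] at h0
      · rwa [hT, inner_neg_left, neg_eq_zero] at h0
    rw [map_smul, lineReflectionLinear_of_inner_eq_zero this, neg_sq]

theorem sin_pi_div_mul_nonneg {L σ : ℝ} (h0 : 0 ≤ σ) (hL : σ ≤ L) :
    0 ≤ Real.sin (Real.pi / L * σ) := by
  rcases (h0.trans hL).eq_or_lt with rfl | hpos
  · simp
  · refine Real.sin_nonneg_of_nonneg_of_le_pi (by positivity) ?_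
    rw [div_mul_eq_mul_div, div_le_iff₀ hpos]
    exact mul_le_mul_of_nonneg_left hL Real.pi_pos.le

theorem sin_pi_div_mul_sub {L : ℝ} (hL : L ≠ 0) (σ : ℝ) :
    Real.sin (Real.pi / L * (L - σ)) = Real.sin (Real.pi / L * σ) := by
  rw [mul_sub, div_mul_cancel₀ _ hL, Real.sin_pi_sub]

section SecondVariation

variable {Ω : Set Plane} {g : ℝ → Plane} {A : ℝ}

/-- Second variation at a minimal chord `g x₀, g y₀`. At an endpoint of the curve the chord may
also be varied beyond the endpoint, to the reflected copy of the curve, where the barrier for the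
reflected distance applies. -/
theorem second_variation_chord (hΩ : IsClosed Ω) (hg : ContDiffOn ℝ ∞ g (Icc 0 1))
    (himm : ∀ x ∈ Icc (0 : ℝ) 1, velocity g x ≠ 0) (hmem : ∀ x ∈ Icc (0 : ℝ) 1, g x ∈ Ω)
    (h0 : MeetsBoundaryOrthogonally Ω g 0) (h1 : MeetsBoundaryOrthogonally Ω g 1) (hA : 0 ≤ A)
    (hchord : ∀ x ∈ Icc (0 : ℝ) 1, ∀ y ∈ Icc (0 : ℝ) 1, x ≤ y →
      A * Real.sin (Real.pi / (2 * arcParam g 1) * (arcParam g y - arcParam g x))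
        ≤ dist (g x) (g y))
    (hrefl : ∀ x ∈ Icc (0 : ℝ) 1, ∀ y ∈ Icc (0 : ℝ) 1,
      A * Real.sin (Real.pi / (2 * arcParam g 1) * (arcParam g x + arcParam g y))
        ≤ reflectedDist Ω (g x) (g y))
    {x₀ y₀ : ℝ} (hx₀ : x₀ ∈ Icc (0 : ℝ) 1) (hy₀ : y₀ ∈ Icc (0 : ℝ) 1) (hlt : x₀ < y₀)
    (hpos : 0 < ‖g x₀ - g y₀‖)
    (heq : ‖g x₀ - g y₀‖
      = A * Real.sin (Real.pi / (2 * arcParam g 1) * (arcParam g y₀ - arcParam g x₀))) :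
    -(4 * (Real.pi / (2 * arcParam g 1)) ^ 2 * ‖g x₀ - g y₀‖ ^ 2)
      ≤ inner ℝ (g x₀ - g y₀) (curvatureVector g x₀ - curvatureVector g y₀) := by
  have hL : 0 < arcParam g 1 := by
    have := strictMonoOn_arcParam hg himm (a := 0) (b := 1) (by simp) (by simp) zero_lt_one
    rwa [arcParam_zero] at this
  refine second_variation (e₁ := -1) (e₂ := 1) (by simp) (by simp)
    (norm_unitTangent (himm x₀ hx₀)) (norm_unitTangent (himm y₀ hy₀)) hpos heq fun a b hab => ?_
  -- The path leaves the curve at the endpoint `0`: continue on its mirror image. Then `b = 0`.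
  by_cases hcx : x₀ = 0 ∧ a = -1
  · obtain ⟨rfl, rfl⟩ := hcx
    obtain rfl : b = 0 := by
      rcases hab with h | h | h
      · exact h.2
      · norm_num at h
      · norm_num at h
    obtain ⟨ξ, hξm, -, hξg, hξs⟩ := exists_arclength_path hg himm (a := 1) hx₀
      (Or.inr (Or.inl ⟨rfl, zero_lt_one⟩))
    obtain ⟨n, hn, hsup, hjet⟩ := h0.exists_reflected_jet
    have hconst := HasJetRight.const (g y₀)
    refine ⟨_, _, fun u => arcParam g y₀ + arcParam g (ξ u), hjet _ _ hξg,
      hconst.congr_coeff rfl (by simp) (by simp),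
      ((HasJetRight.const (arcParam g y₀)).add hξs).congr_coeff ?_ ?_ ?_, ?_⟩
    · rw [arcParam_zero, sub_zero, add_zero]
    · norm_num
    · norm_num
    · filter_upwards [hξm] with u hu
      have m1 := arcParam_mem hg himm hu
      have m2 := arcParam_mem hg himm hy₀
      refine ⟨mul_nonneg hA (sin_pi_div_mul_nonneg (by linarith [m1.1, m2.1])
        (by linarith [m1.2, m2.2])), (hrefl y₀ hy₀ _ hu).trans ?_⟩
      rw [← dist_eq_norm, dist_comm]
      exact reflectedDist_le_dist_lineReflection hΩ hn hsup (hmem _ hy₀) (hmem _ hu)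
  have hax : a = 0 ∨ (a = 1 ∧ x₀ < 1) ∨ (a = -1 ∧ 0 < x₀) := by
    have hx1 : x₀ < 1 := hlt.trans_le hy₀.2
    rcases hab with ⟨rfl | rfl, -⟩ | ⟨rfl, -⟩ | ⟨rfl, -⟩
    · exact Or.inr (Or.inl ⟨rfl, hx1⟩)
    · exact Or.inr (Or.inr ⟨rfl, lt_of_le_of_ne hx₀.1 fun h => hcx ⟨h.symm, rfl⟩⟩)
    · exact Or.inl rfl
    · exact Or.inr (Or.inl ⟨rfl, hx1⟩)
  obtain ⟨ξ, hξm, hξt, hξg, hξs⟩ := exists_arclength_path hg himm hx₀ hax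
  -- The path leaves the curve at the endpoint `1`: continue on its mirror image.
  by_cases hcy : y₀ = 1 ∧ b = 1
  · obtain ⟨rfl, rfl⟩ := hcy
    obtain ⟨η, hηm, -, hηg, hηs⟩ := exists_arclength_path hg himm (a := -1) hy₀
      (Or.inr (Or.inr ⟨rfl, zero_lt_one⟩))
    obtain ⟨n, hn, hsup, hjet⟩ := h1.exists_reflected_jet
    have hQ := hjet _ _ hηg
    rw [neg_neg] at hQ
    refine ⟨_, _, fun u => 2 * arcParam g 1 - (arcParam g (ξ u) + arcParam g (η u)), hξg, hQ,
      ((HasJetRight.const (2 * arcParam g 1)).sub (hξs.add hηs)).congr_coeff ?_ ?_ ?_, ?_⟩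
    · ring
    · ring
    · norm_num
    · filter_upwards [hξm, hηm] with u hu hu'
      have m1 := arcParam_mem hg himm hu
      have m2 := arcParam_mem hg himm hu'
      rw [sin_pi_div_mul_sub (by positivity)]
      refine ⟨mul_nonneg hA (sin_pi_div_mul_nonneg (by linarith [m1.1, m2.1])
        (by linarith [m1.2, m2.2])), (hrefl _ hu _ hu').trans ?_⟩
      rw [← dist_eq_norm]
      exact reflectedDist_le_dist_lineReflection hΩ hn hsup (hmem _ hu) (hmem _ hu')
  have hby : b = 0 ∨ (b = 1 ∧ y₀ < 1) ∨ (b = -1 ∧ 0 < y₀) := by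
    have hy0 : 0 < y₀ := hx₀.1.trans_lt hlt
    have hb : b = 0 ∨ b = 1 ∨ b = -1 := by tauto
    rcases hb with rfl | rfl | rfl
    · exact Or.inl rfl
    · exact Or.inr (Or.inl ⟨rfl, lt_of_le_of_ne hy₀.2 fun h => hcy ⟨h, rfl⟩⟩)
    · exact Or.inr (Or.inr ⟨rfl, hy0⟩)
  obtain ⟨η, hηm, hηt, hηg, hηs⟩ := exists_arclength_path hg himm hy₀ hby
  refine ⟨_, _, fun u => arcParam g (η u) - arcParam g (ξ u), hξg, hηg,
    (hηs.sub hξs).congr_coeff rfl (by ring) (by norm_num), ?_⟩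
  filter_upwards [hξm, hηm, hξt.eventually_lt hηt hlt] with u hu hu' hlt'
  have m1 := arcParam_mem hg himm hu
  have m2 := arcParam_mem hg himm hu'
  have hm := (strictMonoOn_arcParam hg himm).monotoneOn hu hu' hlt'.le
  refine ⟨mul_nonneg hA (sin_pi_div_mul_nonneg (by linarith) (by linarith [m1.1, m2.2])), ?_⟩
  rw [← dist_eq_norm]
  exact hchord _ hu _ hu' hlt'.le

/-- Second variation at a minimal reflected pair of interior points, in terms of the chord that
joins one of the points to the mirror image of the other in a supporting line. -/
theorem second_variation_reflected (hΩ : IsClosed Ω) (hg : ContDiffOn ℝ ∞ g (Icc 0 1))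
    (himm : ∀ x ∈ Icc (0 : ℝ) 1, velocity g x ≠ 0) (hmem : ∀ x ∈ Icc (0 : ℝ) 1, g x ∈ Ω)
    (hA : 0 ≤ A)
    (hrefl : ∀ x ∈ Icc (0 : ℝ) 1, ∀ y ∈ Icc (0 : ℝ) 1,
      A * Real.sin (Real.pi / (2 * arcParam g 1) * (arcParam g x + arcParam g y))
        ≤ reflectedDist Ω (g x) (g y))
    {x₀ y₀ : ℝ} (hx₀ : x₀ ∈ Ioo (0 : ℝ) 1) (hy₀ : y₀ ∈ Ioo (0 : ℝ) 1)
    {z n : Plane} (hn : ‖n‖ = 1) (hsup : ∀ q ∈ Ω, inner ℝ n (q - z) ≤ 0)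
    (hpos : 0 < ‖g x₀ - lineReflection z n (g y₀)‖)
    (heq : ‖g x₀ - lineReflection z n (g y₀)‖
      = A * Real.sin (Real.pi / (2 * arcParam g 1) * (arcParam g x₀ + arcParam g y₀))) :
    -(4 * (Real.pi / (2 * arcParam g 1)) ^ 2 * ‖g x₀ - lineReflection z n (g y₀)‖ ^ 2)
      ≤ inner ℝ (g x₀ - lineReflection z n (g y₀))
        (curvatureVector g x₀ - lineReflectionLinear n (curvatureVector g y₀)) := by
  have hx := Ioo_subset_Icc_self hx₀
  have hy := Ioo_subset_Icc_self hy₀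
  refine second_variation (e₁ := 1) (e₂ := 1) (by simp) (by simp)
    (norm_unitTangent (himm x₀ hx)) (TQ := lineReflectionLinear n (unitTangent g y₀))
    (by rw [norm_lineReflectionLinear hn, norm_unitTangent (himm y₀ hy)]) hpos heq
    fun a b hab => ?_
  have ha : a = 0 ∨ (a = 1 ∧ x₀ < 1) ∨ (a = -1 ∧ 0 < x₀) := by
    have := hx₀.1
    have := hx₀.2
    tauto
  have hb : b = 0 ∨ (b = 1 ∧ y₀ < 1) ∨ (b = -1 ∧ 0 < y₀) := by
    have := hy₀.1
    have := hy₀.2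
    tauto
  obtain ⟨ξ, hξm, -, hξg, hξs⟩ := exists_arclength_path hg himm hx ha
  obtain ⟨η, hηm, -, hηg, hηs⟩ := exists_arclength_path hg himm hy hb
  refine ⟨_, _, fun u => arcParam g (ξ u) + arcParam g (η u), hξg,
    (hηg.lineReflection z n).congr_coeff rfl (by simp) (by simp),
    (hξs.add hηs).congr_coeff rfl (by ring) (by norm_num), ?_⟩
  filter_upwards [hξm, hηm] with u hu hu'
  have m1 := arcParam_mem hg himm hu
  have m2 := arcParam_mem hg himm hu'
  refine ⟨mul_nonneg hA (sin_pi_div_mul_nonneg (by linarith [m1.1, m2.1])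
    (by linarith [m1.2, m2.2])), (hrefl _ hu _ hu').trans ?_⟩
  rw [← dist_eq_norm]
  exact reflectedDist_le_dist_lineReflection hΩ hn hsup (hmem _ hu) (hmem _ hu')

end SecondVariation

/-! ### Regularity of the flow and monotonicity of lengths -/

section SpaceTime

variable {E : Type*} [NormedAddCommGroup E] [NormedSpace ℝ E] {T : ℝ}

theorem uniqueDiffOn_spaceTime : UniqueDiffOn ℝ (Icc (0 : ℝ) 1 ×ˢ Ico 0 T) :=
  (uniqueDiffOn_Icc zero_lt_one).prod (uniqueDiffOn_Ico 0 T)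

theorem spaceTime_subset_closure_interior (hT : 0 < T) :
    Icc (0 : ℝ) 1 ×ˢ Ico 0 T ⊆ closure (interior (Icc (0 : ℝ) 1 ×ˢ Ico 0 T)) := by
  rw [interior_prod_eq, closure_prod_eq, interior_Icc, interior_Ico, closure_Ioo zero_ne_one,
    closure_Ioo hT.ne]
  exact prod_mono_right Ico_subset_Icc_self

theorem HasFDerivWithinAt.hasDerivWithinAt_space {f : ℝ × ℝ → E} {f' : ℝ × ℝ →L[ℝ] E}
    {x t : ℝ} (hf : HasFDerivWithinAt f f' (Icc (0 : ℝ) 1 ×ˢ Ico 0 T) (x, t))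
    (ht : t ∈ Ico 0 T) :
    HasDerivWithinAt (fun u => f (u, t)) (f' (1, 0)) (Icc 0 1) x := by
  have h : HasDerivWithinAt (fun u : ℝ => (u, t)) ((1 : ℝ), (0 : ℝ)) (Icc 0 1) x :=
    (hasDerivWithinAt_id x _).prodMk (hasDerivWithinAt_const x _ t)
  exact hf.comp_hasDerivWithinAt x h fun u hu => (⟨hu, ht⟩ : (u, t) ∈ Icc (0 : ℝ) 1 ×ˢ Ico 0 T)

theorem HasFDerivWithinAt.hasDerivWithinAt_time {f : ℝ × ℝ → E} {f' : ℝ × ℝ →L[ℝ] E}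
    {x t : ℝ} (hf : HasFDerivWithinAt f f' (Icc (0 : ℝ) 1 ×ˢ Ico 0 T) (x, t))
    (hx : x ∈ Icc (0 : ℝ) 1) :
    HasDerivWithinAt (fun s => f (x, s)) (f' (0, 1)) (Ico 0 T) t := by
  have h : HasDerivWithinAt (fun s : ℝ => (x, s)) ((0 : ℝ), (1 : ℝ)) (Ico 0 T) t :=
    (hasDerivWithinAt_const t _ x).prodMk (hasDerivWithinAt_id t _)
  exact hf.comp_hasDerivWithinAt t h fun u hu => (⟨hx, hu⟩ : (x, u) ∈ Icc (0 : ℝ) 1 ×ˢ Ico 0 T)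

theorem ContDiffOn.hasFDerivWithinAt_spaceTime {f : ℝ × ℝ → E}
    (hf : ContDiffOn ℝ ∞ f (Icc (0 : ℝ) 1 ×ˢ Ico 0 T)) {p : ℝ × ℝ}
    (hp : p ∈ Icc (0 : ℝ) 1 ×ˢ Ico 0 T) :
    HasFDerivWithinAt f (fderivWithin ℝ f (Icc (0 : ℝ) 1 ×ˢ Ico 0 T) p)
      (Icc (0 : ℝ) 1 ×ˢ Ico 0 T) p :=
  (hf.differentiableOn (by norm_num) p hp).hasFDerivWithinAt

theorem ContDiffOn.fderivWithin_spaceTime {f : ℝ × ℝ → E}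
    (hf : ContDiffOn ℝ ∞ f (Icc (0 : ℝ) 1 ×ˢ Ico 0 T)) (v : ℝ × ℝ) :
    ContDiffOn ℝ ∞ (fun p => fderivWithin ℝ f (Icc (0 : ℝ) 1 ×ˢ Ico 0 T) p v)
      (Icc (0 : ℝ) 1 ×ˢ Ico 0 T) :=
  (hf.fderivWithin (uniqueDiffOn_spaceTime) (by norm_num)).clm_apply contDiffOn_const

theorem ContDiffOn.derivWithin_space_eq {f : ℝ × ℝ → E}
    (hf : ContDiffOn ℝ ∞ f (Icc (0 : ℝ) 1 ×ˢ Ico 0 T)) {x t : ℝ} (hx : x ∈ Icc (0 : ℝ) 1)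
    (ht : t ∈ Ico 0 T) :
    derivWithin (fun u => f (u, t)) (Icc 0 1) x
      = fderivWithin ℝ f (Icc (0 : ℝ) 1 ×ˢ Ico 0 T) (x, t) (1, 0) :=
  ((hf.hasFDerivWithinAt_spaceTime ⟨hx, ht⟩).hasDerivWithinAt_space ht).derivWithin
    (uniqueDiffOn_Icc zero_lt_one x hx)

/-- Mixed second derivatives on the space-time strip commute, up to its boundary. -/
theorem ContDiffOn.fderivWithin_fderivWithin_comm {f : ℝ × ℝ → E}
    (hf : ContDiffOn ℝ ∞ f (Icc (0 : ℝ) 1 ×ˢ Ico 0 T)) {p : ℝ × ℝ}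
    (hp : p ∈ Icc (0 : ℝ) 1 ×ˢ Ico 0 T) (v w : ℝ × ℝ) :
    fderivWithin ℝ (fun q => fderivWithin ℝ f (Icc (0 : ℝ) 1 ×ˢ Ico 0 T) q v)
        (Icc (0 : ℝ) 1 ×ˢ Ico 0 T) p w
      = fderivWithin ℝ (fun q => fderivWithin ℝ f (Icc (0 : ℝ) 1 ×ˢ Ico 0 T) q w)
        (Icc (0 : ℝ) 1 ×ˢ Ico 0 T) p v := by
  have hu := uniqueDiffOn_spaceTime (T := T)
  have hd : HasFDerivWithinAt (fderivWithin ℝ f (Icc (0 : ℝ) 1 ×ˢ Ico 0 T)) _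
      (Icc (0 : ℝ) 1 ×ˢ Ico 0 T) p :=
    ((hf.fderivWithin hu (m := ∞) (by norm_num)).differentiableOn (by norm_num) p
      hp).hasFDerivWithinAt
  have h (v w : ℝ × ℝ) : fderivWithin ℝ
      (fun q => fderivWithin ℝ f (Icc (0 : ℝ) 1 ×ˢ Ico 0 T) q v)
        (Icc (0 : ℝ) 1 ×ˢ Ico 0 T) p w
      = fderivWithin ℝ (fderivWithin ℝ f (Icc (0 : ℝ) 1 ×ˢ Ico 0 T))
        (Icc (0 : ℝ) 1 ×ˢ Ico 0 T) p w v := by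
    rw [(hd.clm_apply (hasFDerivWithinAt_const v p _)).fderivWithin (hu p hp)]
    simp
  rw [h v w, h w v]
  exact ((hf p hp).isSymmSndFDerivWithinAt (by
    rw [minSmoothness_of_isRCLikeNormedField]
    exact WithTop.coe_le_coe.2 (le_top : (2 : ℕ∞) ≤ ⊤)) hu
    (spaceTime_subset_closure_interior (hp.2.1.trans_lt hp.2.2) hp) hp) w v

end SpaceTime

theorem inner_acceleration_curvatureVector_nonneg (g : ℝ → Plane) (x : ℝ) :
    0 ≤ inner ℝ (velocity (velocity g) x) (curvatureVector g x) := by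
  rw [curvatureVector_eq, real_inner_smul_right, real_inner_comm (rotJ (velocity g x))]
  have : inner ℝ (rotJ (velocity g x)) (velocity (velocity g) x) / ‖velocity g x‖ ^ 3 *
      ‖velocity g x‖⁻¹ * inner ℝ (rotJ (velocity g x)) (velocity (velocity g) x)
      = inner ℝ (rotJ (velocity g x)) (velocity (velocity g) x) ^ 2 / ‖velocity g x‖ ^ 3 *
      ‖velocity g x‖⁻¹ := by ring
  rw [this]
  positivity

namespace IsFreeBoundaryCSF

variable {Ω : Set Plane} {T : ℝ} {γ : ℝ → ℝ → Plane}

theorem contDiffOn_slice (hγ : IsFreeBoundaryCSF Ω T γ) {t : ℝ} (ht : t ∈ Ico 0 T) :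
    ContDiffOn ℝ ∞ (fun u => γ u t) (Icc 0 1) :=
  hγ.smooth.comp (contDiffOn_id.prodMk contDiffOn_const) fun _ hu => ⟨hu, ht⟩

theorem velocity_eq (hγ : IsFreeBoundaryCSF Ω T γ) {x t : ℝ} (hx : x ∈ Icc (0 : ℝ) 1)
    (ht : t ∈ Ico 0 T) :
    velocity (fun u => γ u t) x
      = fderivWithin ℝ (fun p : ℝ × ℝ => γ p.1 p.2) (Icc (0 : ℝ) 1 ×ˢ Ico 0 T) (x, t) (1, 0) :=
  hγ.smooth.derivWithin_space_eq hx ht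

theorem contDiffOn_velocity_spaceTime (hγ : IsFreeBoundaryCSF Ω T γ) :
    ContDiffOn ℝ ∞ (fun p : ℝ × ℝ => velocity (fun u => γ u p.2) p.1)
      (Icc (0 : ℝ) 1 ×ˢ Ico 0 T) :=
  (hγ.smooth.fderivWithin_spaceTime (1, 0)).congr fun _ hp => hγ.velocity_eq hp.1 hp.2

theorem contDiffOn_acceleration_spaceTime (hγ : IsFreeBoundaryCSF Ω T γ) :
    ContDiffOn ℝ ∞ (fun p : ℝ × ℝ => velocity (velocity (fun u => γ u p.2)) p.1)
      (Icc (0 : ℝ) 1 ×ˢ Ico 0 T) :=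
  ((hγ.contDiffOn_velocity_spaceTime).fderivWithin_spaceTime (1, 0)).congr
    fun _ hp => (hγ.contDiffOn_velocity_spaceTime).derivWithin_space_eq hp.1 hp.2

theorem continuousOn_curvatureVector (hγ : IsFreeBoundaryCSF Ω T γ) :
    ContinuousOn (fun p : ℝ × ℝ => curvatureVector (fun u => γ u p.2) p.1)
      (Icc (0 : ℝ) 1 ×ˢ Ico 0 T) := by
  simp only [curvatureVector_eq]
  have hv := (hγ.contDiffOn_velocity_spaceTime).continuousOn
  have ha := (hγ.contDiffOn_acceleration_spaceTime).continuousOn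
  have hj := (contDiff_rotJ (n := 0)).continuous.comp_continuousOn hv
  have hne : ∀ p ∈ Icc (0 : ℝ) 1 ×ˢ Ico 0 T, ‖velocity (fun u => γ u p.2) p.1‖ ≠ 0 :=
    fun p hp => norm_ne_zero_iff.2 (hγ.immersed p.2 hp.2 p.1 hp.1)
  exact (((ContinuousOn.inner (𝕜 := ℝ) hj ha).div (hv.norm.pow 3) fun p hp => pow_ne_zero 3 (hne p hp)).mul
    (hv.norm.inv₀ hne)).smul hj

/-- The evolution equation persists at the endpoints of the curve, by continuity. -/
theorem fderivWithin_time_eq (hγ : IsFreeBoundaryCSF Ω T γ) {x t : ℝ}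
    (hx : x ∈ Icc (0 : ℝ) 1) (ht : t ∈ Ico 0 T) :
    fderivWithin ℝ (fun p : ℝ × ℝ => γ p.1 p.2) (Icc (0 : ℝ) 1 ×ˢ Ico 0 T) (x, t) (0, 1)
      = curvatureVector (fun u => γ u t) x := by
  have hsub : Ioo (0 : ℝ) 1 ×ˢ Ico 0 T ⊆ Icc (0 : ℝ) 1 ×ˢ Ico 0 T :=
    prod_mono_left Ioo_subset_Icc_self
  have heq : EqOn (fun p : ℝ × ℝ => fderivWithin ℝ (fun p : ℝ × ℝ => γ p.1 p.2)
      (Icc (0 : ℝ) 1 ×ˢ Ico 0 T) p (0, 1))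
      (fun p : ℝ × ℝ => curvatureVector (fun u => γ u p.2) p.1) (Ioo (0 : ℝ) 1 ×ˢ Ico 0 T) := by
    rintro ⟨y, s⟩ hp
    exact (uniqueDiffOn_Ico 0 T s hp.2).eq_deriv _
      ((hγ.smooth.hasFDerivWithinAt_spaceTime (hsub hp)).hasDerivWithinAt_time (hsub hp).1)
      (hγ.evolution s hp.2 y hp.1)
  refine heq.of_subset_closure (hγ.smooth.fderivWithin_spaceTime (0, 1)).continuousOn
    (hγ.continuousOn_curvatureVector) hsub ?_ (show (x, t) ∈ _ from ⟨hx, ht⟩)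
  rw [closure_prod_eq, closure_Ioo zero_ne_one]
  exact prod_mono_right subset_closure

theorem hasDerivWithinAt_time (hγ : IsFreeBoundaryCSF Ω T γ) {x t : ℝ}
    (hx : x ∈ Icc (0 : ℝ) 1) (ht : t ∈ Ico 0 T) :
    HasDerivWithinAt (fun s => γ x s) (curvatureVector (fun u => γ u t) x) (Ico 0 T) t := by
  rw [← hγ.fderivWithin_time_eq hx ht]
  exact (hγ.smooth.hasFDerivWithinAt_spaceTime ⟨hx, ht⟩).hasDerivWithinAt_time hx

/-- The speed `|γ_x|` is non-increasing in time: `∂_t |γ_x| = -κ² |γ_x|`, because the flow moves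
in the normal direction. -/
theorem antitoneOn_norm_velocity (hγ : IsFreeBoundaryCSF Ω T γ) {x : ℝ}
    (hx : x ∈ Icc (0 : ℝ) 1) :
    AntitoneOn (fun t => ‖velocity (fun u => γ u t) x‖) (Ico 0 T) := by
  set S := Icc (0 : ℝ) 1 ×ˢ Ico 0 T with hS
  set Γ : ℝ × ℝ → Plane := fun p => γ p.1 p.2 with hΓ
  have hV := hγ.smooth.fderivWithin_spaceTime (1, 0)
  have hW := hγ.smooth.fderivWithin_spaceTime (0, 1)
  have hderiv : ∀ t ∈ Ico 0 T, HasDerivWithinAt (fun s => fderivWithin ℝ Γ S (x, s) (1, 0))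
      (fderivWithin ℝ (fun q => fderivWithin ℝ Γ S q (0, 1)) S (x, t) (1, 0)) (Ico 0 T) t := by
    intro t ht
    rw [hγ.smooth.fderivWithin_fderivWithin_comm ⟨hx, ht⟩]
    exact (hV.hasFDerivWithinAt_spaceTime ⟨hx, ht⟩).hasDerivWithinAt_time hx
  have hsign : ∀ t ∈ Ico 0 T, (inner ℝ (fderivWithin ℝ Γ S (x, t) (1, 0))
      (fderivWithin ℝ (fun q => fderivWithin ℝ Γ S q (0, 1)) S (x, t) (1, 0)) : ℝ) ≤ 0 := by
    intro t ht
    have hVx := (hV.hasFDerivWithinAt_spaceTime ⟨hx, ht⟩).hasDerivWithinAt_space ht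
    have hWx := (hW.hasFDerivWithinAt_spaceTime ⟨hx, ht⟩).hasDerivWithinAt_space ht
    have hzero : HasDerivWithinAt (fun u => (inner ℝ (fderivWithin ℝ Γ S (u, t) (1, 0))
        (fderivWithin ℝ Γ S (u, t) (0, 1)) : ℝ)) 0 (Icc 0 1) x := by
      refine (hasDerivWithinAt_const x (Icc (0 : ℝ) 1) (0 : ℝ)).congr (fun u hu => ?_) ?_
      · rw [← hγ.velocity_eq hu ht, hγ.fderivWithin_time_eq hu ht,
          inner_velocity_curvatureVector]
      · rw [← hγ.velocity_eq hx ht, hγ.fderivWithin_time_eq hx ht,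
          inner_velocity_curvatureVector]
    -- Differentiating `⟨γ_x, γ_t⟩ = 0` in `x` turns `⟨γ_x, γ_tx⟩` into `-⟨γ_xx, γ_t⟩`.
    have hsum := (uniqueDiffOn_Icc (zero_lt_one (α := ℝ)) x hx).eq_deriv _ (hVx.inner ℝ hWx) hzero
    have hacc : fderivWithin ℝ (fun q => fderivWithin ℝ Γ S q (1, 0)) S (x, t) (1, 0)
        = velocity (velocity (fun u => γ u t)) x := by
      rw [← hV.derivWithin_space_eq hx ht]
      exact (derivWithin_congr (fun u hu => hγ.velocity_eq hu ht) (hγ.velocity_eq hx ht)).symm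
    rw [hacc, hγ.fderivWithin_time_eq hx ht] at hsum
    have := inner_acceleration_curvatureVector_nonneg (fun u => γ u t) x
    linarith
  have hanti : AntitoneOn (fun t => ‖fderivWithin ℝ Γ S (x, t) (1, 0)‖ ^ 2) (Ico 0 T) := by
    refine antitoneOn_of_hasDerivWithinAt_nonpos (convex_Ico 0 T)
      (fun t ht => (hderiv t ht).norm_sq.continuousWithinAt)
      (fun t ht => (hderiv t (interior_subset ht)).norm_sq.mono interior_subset) fun t ht => ?_
    have := hsign t (interior_subset ht)
    linarith
  intro s hs t ht hst
  simp only [hγ.velocity_eq hx hs, hγ.velocity_eq hx ht]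
  exact (pow_le_pow_iff_left₀ (norm_nonneg _) (norm_nonneg _) two_ne_zero).1 (hanti hs ht hst)

/-- The length of each arc is non-increasing in time. -/
theorem arcParam_sub_le (hγ : IsFreeBoundaryCSF Ω T γ) {x y s t : ℝ}
    (hx : x ∈ Icc (0 : ℝ) 1) (hy : y ∈ Icc (0 : ℝ) 1) (hxy : x ≤ y) (hs : s ∈ Ico 0 T)
    (ht : t ∈ Ico 0 T) (hst : s ≤ t) :
    arcParam (fun u => γ u t) y - arcParam (fun u => γ u t) x
      ≤ arcParam (fun u => γ u s) y - arcParam (fun u => γ u s) x := by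
  rw [← integral_norm_velocity (hγ.contDiffOn_slice ht) hx hy,
    ← integral_norm_velocity (hγ.contDiffOn_slice hs) hx hy]
  refine intervalIntegral.integral_mono_on hxy
    (intervalIntegrable_norm_velocity (hγ.contDiffOn_slice ht) hx hy)
    (intervalIntegrable_norm_velocity (hγ.contDiffOn_slice hs) hx hy) fun u hu => ?_
  exact hγ.antitoneOn_norm_velocity ⟨hx.1.trans hu.1, hu.2.trans hy.2⟩ hs ht hst

theorem continuousOn_arcParam (hγ : IsFreeBoundaryCSF Ω T γ) {t₁ : ℝ}
    (ht₁ : t₁ ∈ Ico 0 T) :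
    ContinuousOn (fun p : ℝ × ℝ => arcParam (fun u => γ u p.2) p.1)
      (Icc (0 : ℝ) 1 ×ˢ Icc 0 t₁) := by
  set h : ℝ → ℝ → ℝ := fun t u => ‖velocity (fun w => γ w (projIcc 0 t₁ ht₁.1 t))
    (projIcc (0 : ℝ) 1 zero_le_one u)‖ with hh
  have hcont : Continuous (Function.uncurry h) := by
    have hc : Continuous fun p : ℝ × ℝ =>
        (((projIcc (0 : ℝ) 1 zero_le_one p.2 : ℝ), (projIcc 0 t₁ ht₁.1 p.1 : ℝ)) : ℝ × ℝ) := by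
      fun_prop
    exact ((hγ.contDiffOn_velocity_spaceTime).continuousOn.comp_continuous hc fun p =>
      ⟨Subtype.coe_prop _, (projIcc 0 t₁ ht₁.1 p.1).2.1,
        (projIcc 0 t₁ ht₁.1 p.1).2.2.trans_lt ht₁.2⟩).norm
  have hprim : Continuous fun p : ℝ × ℝ => ∫ u in (0 : ℝ)..p.1, h p.2 u := by
    have hc : Continuous (Function.uncurry fun (p : ℝ × ℝ) (u : ℝ) => h p.2 u) :=
      hcont.comp (f := fun q : (ℝ × ℝ) × ℝ => (q.1.2, q.2)) (by fun_prop)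
    exact intervalIntegral.continuous_parametric_intervalIntegral_of_continuous hc continuous_fst
  refine hprim.continuousOn.congr fun p hp => ?_
  refine intervalIntegral.integral_congr fun u hu => ?_
  rw [uIcc_of_le hp.1.1] at hu
  simp only [hh]
  rw [projIcc_of_mem ht₁.1 hp.2, projIcc_of_mem zero_le_one ⟨hu.1, hu.2.trans hp.1.2⟩]

theorem mem (hγ : IsFreeBoundaryCSF Ω T γ) (hΩ : IsClosed Ω) {x t : ℝ}
    (hx : x ∈ Icc (0 : ℝ) 1) (ht : t ∈ Ico 0 T) : γ x t ∈ Ω := by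
  rcases hx.1.eq_or_lt with rfl | h0
  · exact hΩ.frontier_subset (hγ.endpoint_mem t ht 0 (by simp))
  rcases hx.2.eq_or_lt with rfl | h1
  · exact hΩ.frontier_subset (hγ.endpoint_mem t ht 1 (by simp))
  exact interior_subset (hγ.mem_interior t ht x ⟨h0, h1⟩)

/-- The tangent at an endpoint is normal to `∂Ω`. -/
theorem unitTangent_eq_or_eq_neg (hγ : IsFreeBoundaryCSF Ω T γ) {e t : ℝ}
    (he : e ∈ ({0, 1} : Set ℝ)) (ht : t ∈ Ico 0 T) {ν : Plane} (hν : ‖ν‖ = 1)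
    (hout : IsOutwardUnitNormal Ω (γ e t) ν) :
    unitTangent (fun u => γ u t) e = ν ∨ unitTangent (fun u => γ u t) e = -ν := by
  have heI : e ∈ Icc (0 : ℝ) 1 := by
    rcases he with rfl | he
    · simp
    · rw [mem_singleton_iff.1 he]
      simp
  set V := velocity (fun u => γ u t) e with hV
  have hVn : 0 < ‖V‖ := norm_pos_iff.2 (hγ.immersed t ht e heI)
  have h0 : inner ℝ (rotJ V) ν = 0 := by
    have h := hγ.orthogonal t ht e he ν hout
    rw [unitNormal, inner_neg_left, real_inner_smul_left, neg_eq_zero] at h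
    exact (mul_eq_zero.1 h).resolve_left (inv_ne_zero hVn.ne')
  have h1 := norm_sq_mul_norm_sq V ν
  have h2 := norm_sq_smul_eq V ν
  rw [h0, hν] at h1
  rw [h0, zero_smul, add_zero] at h2
  have h3 : (inner ℝ V ν : ℝ) ^ 2 = ‖V‖ ^ 2 := by linarith
  have hU : unitTangent (fun u => γ u t) e = ‖V‖⁻¹ • V := rfl
  rcases sq_eq_sq_iff_eq_or_eq_neg.1 h3 with h4 | h4
  · left
    rw [h4] at h2
    rw [hU]
    apply smul_right_injective _ (pow_ne_zero 2 hVn.ne')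
    simp only
    rw [h2, smul_smul]
    congr 1
    field_simp
  · right
    rw [h4] at h2
    rw [hU]
    apply smul_right_injective _ (pow_ne_zero 2 hVn.ne')
    simp only
    rw [smul_neg, h2, smul_smul, neg_smul, neg_neg]
    congr 1
    field_simp

theorem meetsBoundaryOrthogonally (hγ : IsFreeBoundaryCSF Ω T γ) (hΩ : IsConvexC2Domain Ω)
    {e t : ℝ} (he : e ∈ ({0, 1} : Set ℝ)) (ht : t ∈ Ico 0 T) :
    MeetsBoundaryOrthogonally Ω (fun u => γ u t) e := by
  obtain ⟨ν, hout, hν, hsup, -⟩ := hΩ.exists_normal (hγ.endpoint_mem t ht e he)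
  exact ⟨ν, hν, hsup, hγ.unitTangent_eq_or_eq_neg he ht hν hout⟩

end IsFreeBoundaryCSF

/-! ### Short chords, and monotonicity of the barrier -/

/-- A chord is not longer than its arc. -/
theorem norm_sub_le_arcParam_sub {g : ℝ → Plane} (hg : ContDiffOn ℝ ∞ g (Icc 0 1)) {x y : ℝ}
    (hx : x ∈ Icc (0 : ℝ) 1) (hy : y ∈ Icc (0 : ℝ) 1) (hxy : x ≤ y) :
    ‖g y - g x‖ ≤ arcParam g y - arcParam g x := by
  -- Integrate `⟨w, g'⟩ ≤ |w| |g'|` for the fixed vector `w = g y - g x`.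
  set w := g y - g x with hw
  have hd : ∀ u ∈ Icc (0 : ℝ) 1, HasDerivWithinAt (fun u => ‖w‖ * arcParam g u - inner ℝ w (g u))
      (‖w‖ * ‖velocity g u‖ - inner ℝ w (velocity g u)) (Icc 0 1) u := by
    intro u hu
    have h1 : HasDerivWithinAt g (velocity g u) (Icc 0 1) u :=
      (hg.differentiableOn (by norm_num) u hu).hasDerivWithinAt
    have h2 := (hasDerivWithinAt_const u (Icc (0 : ℝ) 1) w).inner ℝ h1
    rw [inner_zero_left, add_zero] at h2
    exact ((hasDerivWithinAt_arcParam hg hu).const_mul ‖w‖).sub h2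
  have hm : MonotoneOn (fun u => ‖w‖ * arcParam g u - inner ℝ w (g u)) (Icc 0 1) :=
    monotoneOn_of_hasDerivWithinAt_nonneg (convex_Icc 0 1)
      (fun u hu => (hd u hu).continuousWithinAt)
      (fun u hu => (hd u (interior_subset hu)).mono interior_subset)
      fun u _ => sub_nonneg.2 (real_inner_le_norm _ _)
  have h := hm hx hy hxy
  have h2 : (inner ℝ w (g y) : ℝ) - inner ℝ w (g x) = ‖w‖ ^ 2 := by
    rw [← inner_sub_right, ← hw, real_inner_self_eq_norm_sq]
  simp only at h
  by_cases h0 : ‖w‖ = 0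
  · rw [h0]
    have := intervalIntegral.integral_nonneg (μ := MeasureTheory.volume) hxy
      fun u _ => norm_nonneg (velocity g u)
    rwa [integral_norm_velocity hg hx hy] at this
  · have hpos : 0 < ‖w‖ := lt_of_le_of_ne (norm_nonneg _) (Ne.symm h0)
    have : ‖w‖ * ‖w‖ ≤ ‖w‖ * (arcParam g y - arcParam g x) := by
      rw [← sq]
      linarith
    exact le_of_mul_le_mul_left this hpos

namespace IsFreeBoundaryCSF

variable {Ω : Set Plane} {T : ℝ} {γ : ℝ → ℝ → Plane}

/-- Near a given point of space-time, the curves advance in the direction of the tangent at this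
point almost at the rate of their arclength. -/
theorem exists_tangential_progress (hγ : IsFreeBoundaryCSF Ω T γ) {x₀ t₀ ε : ℝ}
    (hx₀ : x₀ ∈ Icc (0 : ℝ) 1) (ht₀ : t₀ ∈ Ico 0 T) (hε : 0 < ε) :
    ∃ r > 0, ∀ t ∈ Ico 0 T, |t - t₀| < r → ∀ x ∈ Icc (0 : ℝ) 1, ∀ y ∈ Icc (0 : ℝ) 1,
      |x - x₀| < r → |y - x₀| < r → x ≤ y →
      (1 - ε) * (arcParam (fun u => γ u t) y - arcParam (fun u => γ u t) x)
        ≤ inner ℝ (unitTangent (fun u => γ u t₀) x₀) (γ y t - γ x t) := by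
  set e := unitTangent (fun u => γ u t₀) x₀ with he
  have hv := hγ.contDiffOn_velocity_spaceTime.continuousOn
  have hf : ContinuousOn (fun p : ℝ × ℝ => (inner ℝ e (velocity (fun u => γ u p.2) p.1) : ℝ)
      - (1 - ε) * ‖velocity (fun u => γ u p.2) p.1‖) (Icc (0 : ℝ) 1 ×ˢ Ico 0 T) :=
    (ContinuousOn.inner (𝕜 := ℝ) continuousOn_const hv).sub (continuousOn_const.mul hv.norm)
  have hn : 0 < ‖velocity (fun u => γ u t₀) x₀‖ := norm_pos_iff.2 (hγ.immersed t₀ ht₀ x₀ hx₀)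
  have hpos : 0 < (inner ℝ e (velocity (fun u => γ u t₀) x₀) : ℝ)
      - (1 - ε) * ‖velocity (fun u => γ u t₀) x₀‖ := by
    have : (inner ℝ e (velocity (fun u => γ u t₀) x₀) : ℝ)
        = ‖velocity (fun u => γ u t₀) x₀‖ := by
      rw [he, unitTangent, real_inner_smul_left, real_inner_self_eq_norm_sq]
      field_simp
    rw [this]
    nlinarith
  have hev := (hf (x₀, t₀) ⟨hx₀, ht₀⟩).eventually (lt_mem_nhds hpos)
  obtain ⟨r, hr, hball⟩ := Metric.mem_nhdsWithin_iff.1 hev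
  refine ⟨r, hr, fun t ht htr x hx y hy hxr hyr hxy => ?_⟩
  have hg := hγ.contDiffOn_slice ht
  have hsub : Icc x y ⊆ Icc 0 1 := Icc_subset_Icc hx.1 hy.2
  have hd : ∀ u ∈ Icc x y, HasDerivWithinAt
      (fun u => inner ℝ e (γ u t) - (1 - ε) * arcParam (fun u => γ u t) u)
      (inner ℝ e (velocity (fun u => γ u t) u) - (1 - ε) * ‖velocity (fun u => γ u t) u‖)
      (Icc x y) u := by
    intro u hu
    have h1 : HasDerivWithinAt (fun u => γ u t) (velocity (fun u => γ u t) u) (Icc 0 1) u :=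
      (hg.differentiableOn (by norm_num) u (hsub hu)).hasDerivWithinAt
    have h2 := (hasDerivWithinAt_const u (Icc (0 : ℝ) 1) e).inner ℝ h1
    rw [inner_zero_left, add_zero] at h2
    exact (h2.sub ((hasDerivWithinAt_arcParam hg (hsub hu)).const_mul (1 - ε))).mono hsub
  have hm := monotoneOn_of_hasDerivWithinAt_nonneg (convex_Icc x y)
      (fun u hu => (hd u hu).continuousWithinAt)
      (fun u hu => (hd u (interior_subset hu)).mono interior_subset) fun u hu => by
    have hu' := interior_subset hu
    refine le_of_lt (hball (a := (u, t)) ⟨?_, hsub hu', ht⟩)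
    rw [abs_lt] at hxr hyr
    rw [Metric.mem_ball, Prod.dist_eq, max_lt_iff, Real.dist_eq, Real.dist_eq]
    exact ⟨abs_lt.2 ⟨by linarith [hu'.1], by linarith [hu'.2]⟩, htr⟩
  have h := hm (left_mem_Icc.2 hxy) (right_mem_Icc.2 hxy) hxy
  rw [inner_sub_right]
  simp only at h
  linarith

/-- Short chords are almost as long as their arcs, locally uniformly in time. -/
theorem exists_chord_lower_bound (hγ : IsFreeBoundaryCSF Ω T γ) {x₀ t₀ ε : ℝ}
    (hx₀ : x₀ ∈ Icc (0 : ℝ) 1) (ht₀ : t₀ ∈ Ico 0 T) (hε : 0 < ε) :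
    ∃ r > 0, ∀ t ∈ Ico 0 T, |t - t₀| < r → ∀ x ∈ Icc (0 : ℝ) 1, ∀ y ∈ Icc (0 : ℝ) 1,
      |x - x₀| < r → |y - x₀| < r → x ≤ y →
      (1 - ε) * (arcParam (fun u => γ u t) y - arcParam (fun u => γ u t) x)
        ≤ dist (γ x t) (γ y t) := by
  obtain ⟨r, hr, h⟩ := hγ.exists_tangential_progress hx₀ ht₀ hε
  refine ⟨r, hr, fun t ht htr x hx y hy hxr hyr hxy => (h t ht htr x hx y hy hxr hyr hxy).trans ?_⟩
  have h1 := real_inner_le_norm (unitTangent (fun u => γ u t₀) x₀) (γ y t - γ x t)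
  rwa [norm_unitTangent (hγ.immersed t₀ ht₀ x₀ hx₀), one_mul, ← dist_eq_norm, dist_comm] at h1

/-- Near an endpoint, the distance to `∂Ω` is almost the arclength distance to the endpoint,
because the curve is orthogonal to `∂Ω` and `∂Ω` is differentiable. -/
theorem exists_boundary_dist_lower_bound (hγ : IsFreeBoundaryCSF Ω T γ)
    (hΩ : IsConvexC2Domain Ω) {e t₀ ε : ℝ} (he : e ∈ ({0, 1} : Set ℝ)) (ht₀ : t₀ ∈ Ico 0 T)
    (hε : 0 < ε) (hε1 : ε < 1) :
    ∃ r > 0, ∀ t ∈ Ico 0 T, |t - t₀| < r → ∀ x ∈ Icc (0 : ℝ) 1, |x - e| < r →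
      ∀ z ∈ frontier Ω,
      (1 - ε) * |arcParam (fun u => γ u t) x - arcParam (fun u => γ u t) e| ≤ dist (γ x t) z := by
  have heI : e ∈ Icc (0 : ℝ) 1 := by
    rcases he with rfl | he
    · simp
    · rw [mem_singleton_iff.1 he]
      simp
  -- The loss is `(1 - 2 δ) / (1 + δ)`, which is at least `1 - ε` for `δ = ε / 3`.
  set δ := ε / 3 with hδ
  have hδ0 : 0 < δ := by positivity
  obtain ⟨ν, hout, hν, -, hflat⟩ := hΩ.exists_normal (hγ.endpoint_mem t₀ ht₀ e he)
  have hTν := hγ.unitTangent_eq_or_eq_neg he ht₀ hν hout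
  obtain ⟨r₁, hr₁, hprog⟩ := hγ.exists_tangential_progress heI ht₀ hδ0
  have hflat' := hflat δ hδ0
  rw [nhds_prod_eq, Metric.nhds_basis_ball.prod_self.eventually_iff] at hflat'
  obtain ⟨ρ, hρ, hflat''⟩ := hflat'
  have hcont : ContinuousWithinAt (fun p : ℝ × ℝ => γ p.1 p.2) (Icc (0 : ℝ) 1 ×ˢ Ico 0 T)
    (e, t₀) := hγ.smooth.continuousOn (e, t₀) ⟨heI, ht₀⟩
  obtain ⟨r₂, hr₂, hball⟩ := Metric.continuousWithinAt_iff.1 hcont (ρ / 4) (by positivity)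
  refine ⟨min r₁ r₂, lt_min hr₁ hr₂, fun t ht htr x hx hxr z hz => ?_⟩
  have ht1 := htr.trans_le (min_le_left _ _)
  have ht2 := htr.trans_le (min_le_right _ _)
  have hx1 := hxr.trans_le (min_le_left _ _)
  have hx2 := hxr.trans_le (min_le_right _ _)
  have hnear : ∀ y ∈ Icc (0 : ℝ) 1, |y - e| < r₂ → dist (γ y t) (γ e t₀) < ρ / 4 := by
    intro y hy hyr
    refine hball (x := (y, t)) ⟨hy, ht⟩ ?_
    rw [Prod.dist_eq, max_lt_iff, Real.dist_eq, Real.dist_eq]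
    exact ⟨hyr, ht2⟩
  have hp := hnear x hx hx2
  have ho := hnear e heI (by simpa using hr₂)
  set s := |arcParam (fun u => γ u t) x - arcParam (fun u => γ u t) e| with hs
  have hg := hγ.contDiffOn_slice ht
  have hs0 : 0 ≤ s := abs_nonneg _
  have hprog' : (1 - δ) * s ≤ |inner ℝ ν (γ x t - γ e t)| := by
    have hT : ∀ v : Plane, |inner ℝ (unitTangent (fun u => γ u t₀) e) v| = |inner ℝ ν v| := by
      intro v
      rcases hTν with h | h
      · rw [h]
      · rw [h, inner_neg_left, abs_neg]
    have hδ1 : 0 ≤ 1 - δ := by linarith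
    rw [← hT, hs]
    rcases le_total e x with hle | hle
    · have h1 := hprog t ht ht1 e heI x hx (by simpa using hr₁) hx1 hle
      have h2 := norm_sub_le_arcParam_sub hg heI hx hle
      rw [abs_of_nonneg ((norm_nonneg _).trans h2)]
      exact h1.trans (le_abs_self _)
    · have h1 := hprog t ht ht1 x hx e heI hx1 (by simpa using hr₁) hle
      have h2 := norm_sub_le_arcParam_sub hg hx heI hle
      rw [abs_sub_comm, abs_of_nonneg ((norm_nonneg _).trans h2)]
      rw [← neg_sub (γ e t), inner_neg_right, abs_neg]
      exact h1.trans (le_abs_self _)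
  have hchord : ‖γ x t - γ e t‖ ≤ s := by
    rcases le_total e x with hle | hle
    · exact (norm_sub_le_arcParam_sub hg heI hx hle).trans (le_abs_self _)
    · rw [norm_sub_rev, hs, abs_sub_comm]
      exact (norm_sub_le_arcParam_sub hg hx heI hle).trans (le_abs_self _)
  have habs : ∀ v : Plane, |inner ℝ ν v| ≤ ‖v‖ := by
    intro v
    simpa [hν] using abs_real_inner_le_norm ν v
  -- Boundary points near the endpoint almost lie on the tangent line; the others are far away.
  by_cases hzρ : dist z (γ e t₀) < ρ
  · have h1 := hflat'' (x := (z, γ e t)) ⟨hzρ, by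
      rw [Metric.mem_ball]; linarith⟩ hz (hγ.endpoint_mem t ht e he)
    have h2 : ‖z - γ e t‖ ≤ dist (γ x t) z + s := by
      have := norm_sub_le_norm_sub_add_norm_sub z (γ x t) (γ e t)
      rw [dist_eq_norm, norm_sub_rev (γ x t) z]
      linarith
    have h3 : |inner ℝ ν (γ x t - γ e t)| ≤ |inner ℝ ν (γ x t - z)| + |inner ℝ ν (z - γ e t)| := by
      have : (inner ℝ ν (γ x t - γ e t) : ℝ)
          = inner ℝ ν (γ x t - z) + inner ℝ ν (z - γ e t) := by
        rw [← inner_add_right]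
        congr 1
        abel
      rw [this]
      exact abs_add_le _ _
    have h4 := habs (γ x t - z)
    rw [← dist_eq_norm] at h4
    simp only at h1
    have h5 : δ * ‖z - γ e t‖ ≤ δ * (dist (γ x t) z + s) := mul_le_mul_of_nonneg_left h2 hδ0.le
    have h6 : (1 - 2 * δ) * s ≤ (1 + δ) * dist (γ x t) z := by linarith
    have h7 : (1 + δ) * ((1 - ε) * s) ≤ (1 - 2 * δ) * s := by
      have : (1 + δ) * (1 - ε) ≤ 1 - 2 * δ := by
        rw [hδ]
        nlinarith
      calc (1 + δ) * ((1 - ε) * s) = (1 + δ) * (1 - ε) * s := by ring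
        _ ≤ _ := mul_le_mul_of_nonneg_right this hs0
    exact le_of_mul_le_mul_left (h7.trans h6) (by positivity)
  · rw [not_lt] at hzρ
    have h1 : (1 - ε) * s ≤ (1 - δ) * s :=
      mul_le_mul_of_nonneg_right (by rw [hδ]; linarith) hs0
    have h2 := habs (γ x t - γ e t)
    rw [← dist_eq_norm] at h2
    have h3 := dist_triangle_right (γ x t) (γ e t) (γ e t₀)
    have h4 := dist_triangle_left z (γ e t₀) (γ x t)
    linarith

end IsFreeBoundaryCSF

/-- The function `(a, b) ↦ (a + b) sin (π a / (a + b))` is monotone in `a`. -/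
theorem add_mul_sin_mono_left {a a' b : ℝ} (ha' : 0 ≤ a') (hb : 0 ≤ b) (hab : 0 < a' + b)
    (h : a' ≤ a) :
    (a' + b) * Real.sin (Real.pi / (a' + b) * a') ≤ (a + b) * Real.sin (Real.pi / (a + b) * a) := by
  have hd : ∀ u ∈ Icc a' a, HasDerivWithinAt
      (fun u => (u + b) * Real.sin (Real.pi / (u + b) * u))
      (Real.sin (Real.pi / (u + b) * u)
        + Real.pi * b / (u + b) * Real.cos (Real.pi / (u + b) * u)) (Icc a' a) u := by
    intro u hu
    have hub : u + b ≠ 0 := by linarith [hu.1]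
    have h1 := (hasDerivAt_id u).add_const b
    have h2 := ((hasDerivAt_const u Real.pi).div h1 hub).mul (hasDerivAt_id u)
    refine ((h1.mul h2.sin).congr_deriv ?_).hasDerivWithinAt
    simp only [id_eq, Pi.mul_apply, Pi.div_apply]
    field_simp
    ring
  have hm := monotoneOn_of_hasDerivWithinAt_nonneg (convex_Icc a' a)
      (fun u hu => (hd u hu).continuousWithinAt)
      (fun u hu => (hd u (interior_subset hu)).mono interior_subset) fun u hu => by
    have hu' := interior_subset hu
    have hub : 0 < u + b := by linarith [hu'.1]
    have hu0 : 0 ≤ u := ha'.trans hu'.1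
    -- In terms of `v = π b / (u + b)` the derivative is `sin v - v cos v`.
    set v := Real.pi * b / (u + b) with hv
    have hv0 : 0 ≤ v := by positivity
    have hvpi : v ≤ Real.pi := by
      rw [hv, div_le_iff₀ hub]
      exact mul_le_mul_of_nonneg_left (by linarith) Real.pi_pos.le
    have he : Real.pi / (u + b) * u = Real.pi - v := by
      rw [hv]
      field_simp
      ring
    rw [he, Real.sin_pi_sub, Real.cos_pi_sub]
    rcases lt_or_ge v (Real.pi / 2) with h2 | h2
    · have hc : 0 < Real.cos v := Real.cos_pos_of_mem_Ioo ⟨by linarith, h2⟩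
      have ht := Real.le_tan hv0 h2
      rw [Real.tan_eq_sin_div_cos, le_div_iff₀ hc] at ht
      linarith
    · have hc := Real.cos_nonpos_of_pi_div_two_le_of_le h2 (by linarith)
      have hs := Real.sin_nonneg_of_nonneg_of_le_pi hv0 hvpi
      nlinarith
  exact hm (left_mem_Icc.2 h) (right_mem_Icc.2 h) h

/-- The barrier `L sin (π a / L)` is monotone in the lengths `a` and `b = L - a` of the two arcs. -/
theorem mul_sin_mono {a a' L L' : ℝ} (ha' : 0 ≤ a') (hb' : 0 ≤ L' - a') (hL' : 0 < L')
    (ha : a' ≤ a) (hb : L' - a' ≤ L - a) :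
    L' * Real.sin (Real.pi / L' * a') ≤ L * Real.sin (Real.pi / L * a) := by
  have h1 := add_mul_sin_mono_left (a := a) ha' hb' (by linarith) ha
  have hM : 0 < a + (L' - a') := by linarith
  have h2 := add_mul_sin_mono_left (a := L - a) (a' := L' - a') (b := a) hb' (by linarith)
    (by linarith) hb
  rw [add_sub_cancel] at h1
  rw [sub_add_cancel, add_comm (L' - a') a] at h2
  have h3 : Real.sin (Real.pi / (a + (L' - a')) * (L' - a'))
      = Real.sin (Real.pi / (a + (L' - a')) * a) := by
    rw [← sin_pi_div_mul_sub hM.ne' a, add_sub_cancel_left]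
  have hL : L ≠ 0 := by linarith
  rw [h3, sin_pi_div_mul_sub hL] at h2
  exact h1.trans h2

/-! ### Exclusion of first touching points -/

/-- The barrier `L sin (π a / L)` at time `t`, where `L` is the doubled length. -/
noncomputable def arcBarrier (γ : ℝ → ℝ → Plane) (t a : ℝ) : ℝ :=
  2 * arcParam (fun u => γ u t) 1 * Real.sin (Real.pi / (2 * arcParam (fun u => γ u t) 1) * a)

/-- If `C F ≤ d` near the zeros of `F`, then the largest `m ≤ C` with `m F ≤ d` exists, and
unless `m = C` equality holds somewhere off the zeros of `F`. -/
theorem exists_touching_multiple {X : Type*} [TopologicalSpace X] {K : Set X} (hK : IsCompact K)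
    {d F : X → ℝ} {C : ℝ} (hd : ContinuousOn d K) (hF : ContinuousOn F K)
    (hF0 : ∀ p ∈ K, 0 ≤ F p) (hdeg : ∀ p ∈ K, F p = 0 → ∀ᶠ q in 𝓝[K] p, C * F q ≤ d q) :
    ∃ m ≤ C, (∀ q ∈ K, m * F q ≤ d q) ∧ (m < C → ∃ p ∈ K, 0 < F p ∧ d p = m * F p) := by
  classical
  by_cases hall : ∀ p ∈ K, C * F p ≤ d p
  · exact ⟨C, le_rfl, hall, fun h => absurd h (lt_irrefl _)⟩
  push Not at hall
  obtain ⟨p₁, hp₁, hlt⟩ := hall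
  -- The quotient `d / F`, cut off at `C`, is continuous up to the zeros of `F`.
  set G : X → ℝ := fun p => if F p = 0 then C else min C (d p / F p) with hG
  have hGc : ContinuousOn G K := by
    intro p hp
    by_cases h0 : F p = 0
    · have hGp : G p = C := if_pos h0
      refine (continuousWithinAt_const (b := C)).congr_of_eventuallyEq ?_ hGp
      filter_upwards [hdeg p hp h0, self_mem_nhdsWithin] with q hq hqK
      by_cases hq0 : F q = 0
      · exact if_pos hq0
      · have hqpos : 0 < F q := lt_of_le_of_ne (hF0 q hqK) (Ne.symm hq0)
        simp only [hG, if_neg hq0]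
        exact min_eq_left ((le_div_iff₀ hqpos).2 hq)
    · have hc : ContinuousWithinAt (fun p => min C (d p / F p)) K p :=
        continuousWithinAt_const.min ((hd p hp).div (hF p hp) h0)
      refine hc.congr_of_eventuallyEq ?_ (if_neg h0)
      filter_upwards [(hF p hp).eventually_ne h0] with q hq
      exact if_neg hq
  obtain ⟨p, hp, hmin⟩ := hK.exists_isMinOn ⟨p₁, hp₁⟩ hGc
  have hself : ∀ q ∈ K, F q = 0 → 0 ≤ d q := by
    intro q hq h0
    have := (hdeg q hq h0).self_of_nhdsWithin hq
    rwa [h0, mul_zero] at this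
  have hF₁ : F p₁ ≠ 0 := by
    intro h0
    rw [h0, mul_zero] at hlt
    exact absurd (hself p₁ hp₁ h0) (not_le.2 hlt)
  have hlt' : G p < C := by
    have h1 : G p ≤ G p₁ := hmin hp₁
    have h2 : G p₁ ≤ d p₁ / F p₁ := by
      simp only [hG, if_neg hF₁]
      exact min_le_right _ _
    have hpos : 0 < F p₁ := lt_of_le_of_ne (hF0 p₁ hp₁) (Ne.symm hF₁)
    exact (h1.trans h2).trans_lt ((div_lt_iff₀ hpos).2 hlt)
  refine ⟨G p, hlt'.le, fun q hq => ?_, fun _ => ⟨p, hp, ?_⟩⟩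
  · by_cases h0 : F q = 0
    · rw [h0, mul_zero]
      exact hself q hq h0
    · have hpos : 0 < F q := lt_of_le_of_ne (hF0 q hq) (Ne.symm h0)
      rw [← le_div_iff₀ hpos]
      have h1 : G p ≤ G q := hmin hq
      refine h1.trans ?_
      simp only [hG, if_neg h0]
      exact min_le_right _ _
  · have h0 : F p ≠ 0 := by
      intro h0
      have : G p = C := if_pos h0
      exact absurd this hlt'.ne
    have hpos : 0 < F p := lt_of_le_of_ne (hF0 p hp) (Ne.symm h0)
    refine ⟨hpos, ?_⟩
    have hGp : G p = min C (d p / F p) := if_neg h0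
    have : G p = d p / F p := by
      rcases min_choice C (d p / F p) with h | h
      · rw [hGp, h] at hlt'
        exact absurd hlt' (lt_irrefl _)
      · rw [hGp, h]
    rw [this, div_mul_cancel₀ _ h0]

theorem arcBarrier_nonneg {γ : ℝ → ℝ → Plane} {t a : ℝ} (h0 : 0 ≤ a)
    (h1 : a ≤ 2 * arcParam (fun u => γ u t) 1) : 0 ≤ arcBarrier γ t a :=
  mul_nonneg (h0.trans h1) (sin_pi_div_mul_nonneg h0 h1)

namespace IsFreeBoundaryCSF

variable {Ω : Set Plane} {T : ℝ} {γ : ℝ → ℝ → Plane}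

theorem arcParam_one_pos (hγ : IsFreeBoundaryCSF Ω T γ) {t : ℝ} (ht : t ∈ Ico 0 T) :
    0 < arcParam (fun u => γ u t) 1 := by
  have := strictMonoOn_arcParam (hγ.contDiffOn_slice ht) (hγ.immersed t ht)
    (a := 0) (b := 1) (by simp) (by simp) zero_lt_one
  rwa [arcParam_zero] at this

theorem arcParam_mem_Icc (hγ : IsFreeBoundaryCSF Ω T γ) {x t : ℝ} (hx : x ∈ Icc (0 : ℝ) 1)
    (ht : t ∈ Ico 0 T) : arcParam (fun u => γ u t) x ∈ Icc 0 (arcParam (fun u => γ u t) 1) :=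
  arcParam_mem (hγ.contDiffOn_slice ht) (hγ.immersed t ht) hx

theorem arcBarrier_sub (hγ : IsFreeBoundaryCSF Ω T γ) {t : ℝ} (ht : t ∈ Ico 0 T) (a : ℝ) :
    arcBarrier γ t (2 * arcParam (fun u => γ u t) 1 - a) = arcBarrier γ t a := by
  have := hγ.arcParam_one_pos ht
  rw [arcBarrier, sin_pi_div_mul_sub (by positivity), arcBarrier]

theorem arcBarrier_le (hγ : IsFreeBoundaryCSF Ω T γ) {t a : ℝ} (ht : t ∈ Ico 0 T) (ha : 0 ≤ a) :
    arcBarrier γ t a ≤ Real.pi * a := by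
  have hL := hγ.arcParam_one_pos ht
  have h := Real.sin_le (x := Real.pi / (2 * arcParam (fun u => γ u t) 1) * a) (by positivity)
  calc arcBarrier γ t a ≤ 2 * arcParam (fun u => γ u t) 1 *
        (Real.pi / (2 * arcParam (fun u => γ u t) 1) * a) :=
        mul_le_mul_of_nonneg_left h (by positivity)
    _ = Real.pi * a := by field_simp

theorem eq_zero_or_eq_of_arcBarrier_eq_zero (hγ : IsFreeBoundaryCSF Ω T γ) {t a : ℝ}
    (ht : t ∈ Ico 0 T) (h0 : 0 ≤ a) (h1 : a ≤ 2 * arcParam (fun u => γ u t) 1)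
    (h : arcBarrier γ t a = 0) : a = 0 ∨ a = 2 * arcParam (fun u => γ u t) 1 := by
  have hL := hγ.arcParam_one_pos ht
  by_contra! hne
  have h0' : 0 < a := lt_of_le_of_ne h0 hne.1.symm
  have h1' : a < 2 * arcParam (fun u => γ u t) 1 := lt_of_le_of_ne h1 hne.2
  have hs : 0 < Real.sin (Real.pi / (2 * arcParam (fun u => γ u t) 1) * a) := by
    refine Real.sin_pos_of_pos_of_lt_pi (by positivity) ?_
    rw [div_mul_eq_mul_div, div_lt_iff₀ (by positivity)]
    exact mul_lt_mul_of_pos_left h1' Real.pi_pos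
  have : 0 < arcBarrier γ t a := mul_pos (by positivity) hs
  exact this.ne' h

/-- The barrier of a chord is non-increasing in time. -/
theorem arcBarrier_sub_antitone (hγ : IsFreeBoundaryCSF Ω T γ) {x y s t : ℝ}
    (hx : x ∈ Icc (0 : ℝ) 1) (hy : y ∈ Icc (0 : ℝ) 1) (hxy : x ≤ y) (hs : s ∈ Ico 0 T)
    (ht : t ∈ Ico 0 T) (hst : s ≤ t) :
    arcBarrier γ t (arcParam (fun u => γ u t) y - arcParam (fun u => γ u t) x)
      ≤ arcBarrier γ s (arcParam (fun u => γ u s) y - arcParam (fun u => γ u s) x) := by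
  have h0 : (0 : ℝ) ∈ Icc (0 : ℝ) 1 := by simp
  have h1 : (1 : ℝ) ∈ Icc (0 : ℝ) 1 := by simp
  have hm := (strictMonoOn_arcParam (hγ.contDiffOn_slice ht) (hγ.immersed t ht)).monotoneOn
    hx hy hxy
  have m1 := hγ.arcParam_mem_Icc hx ht
  have m2 := hγ.arcParam_mem_Icc hy ht
  have a1 := hγ.arcParam_sub_le hx hy hxy hs ht hst
  have a2 := hγ.arcParam_sub_le h0 hx hx.1 hs ht hst
  have a3 := hγ.arcParam_sub_le hy h1 hy.2 hs ht hst
  have a4 := hγ.arcParam_sub_le h0 h1 zero_le_one hs ht hst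
  simp only [arcParam_zero, sub_zero] at a2 a4
  have hL := hγ.arcParam_one_pos ht
  exact mul_sin_mono (by linarith) (by linarith [m1.1, m2.2]) (by linarith) a1 (by linarith)

/-- The barrier of a reflected pair is non-increasing in time. -/
theorem arcBarrier_add_antitone (hγ : IsFreeBoundaryCSF Ω T γ) {x y s t : ℝ}
    (hx : x ∈ Icc (0 : ℝ) 1) (hy : y ∈ Icc (0 : ℝ) 1) (hs : s ∈ Ico 0 T)
    (ht : t ∈ Ico 0 T) (hst : s ≤ t) :
    arcBarrier γ t (arcParam (fun u => γ u t) x + arcParam (fun u => γ u t) y)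
      ≤ arcBarrier γ s (arcParam (fun u => γ u s) x + arcParam (fun u => γ u s) y) := by
  have h0 : (0 : ℝ) ∈ Icc (0 : ℝ) 1 := by simp
  have h1 : (1 : ℝ) ∈ Icc (0 : ℝ) 1 := by simp
  have m1 := hγ.arcParam_mem_Icc hx ht
  have m2 := hγ.arcParam_mem_Icc hy ht
  have a1 := hγ.arcParam_sub_le h0 hx hx.1 hs ht hst
  have a2 := hγ.arcParam_sub_le h0 hy hy.1 hs ht hst
  have a3 := hγ.arcParam_sub_le hx h1 hx.2 hs ht hst
  have a4 := hγ.arcParam_sub_le hy h1 hy.2 hs ht hst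
  simp only [arcParam_zero, sub_zero] at a1 a2
  have hL := hγ.arcParam_one_pos ht
  exact mul_sin_mono (by linarith [m1.1, m2.1]) (by linarith [m1.2, m2.2]) (by linarith)
    (by linarith) (by linarith)

/-- A chord cannot touch the decaying barrier for the first time: the first variation in time and
the second variation in space are incompatible. -/
theorem not_chord_touching (hγ : IsFreeBoundaryCSF Ω T γ) (hΩ : IsConvexC2Domain Ω)
    {t₀ m μ : ℝ} (ht₀ : t₀ ∈ Ico 0 T) (ht₀pos : 0 < t₀) (hm : 0 ≤ m)
    (hμ : 4 * (Real.pi / (2 * arcParam (fun u => γ u t₀) 1)) ^ 2 < μ)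
    (hchord : ∀ t ∈ Icc 0 t₀, ∀ x ∈ Icc (0 : ℝ) 1, ∀ y ∈ Icc (0 : ℝ) 1, x ≤ y →
      m * (Real.exp (-(μ * t)) *
        arcBarrier γ t (arcParam (fun u => γ u t) y - arcParam (fun u => γ u t) x))
        ≤ dist (γ x t) (γ y t))
    (hrefl : ∀ x ∈ Icc (0 : ℝ) 1, ∀ y ∈ Icc (0 : ℝ) 1,
      m * (Real.exp (-(μ * t₀)) *
        arcBarrier γ t₀ (arcParam (fun u => γ u t₀) x + arcParam (fun u => γ u t₀) y))
        ≤ reflectedDist Ω (γ x t₀) (γ y t₀))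
    {x₀ y₀ : ℝ} (hx₀ : x₀ ∈ Icc (0 : ℝ) 1) (hy₀ : y₀ ∈ Icc (0 : ℝ) 1) (hlt : x₀ < y₀) :
    dist (γ x₀ t₀) (γ y₀ t₀) ≠ m * (Real.exp (-(μ * t₀)) *
        arcBarrier γ t₀ (arcParam (fun u => γ u t₀) y₀ - arcParam (fun u => γ u t₀) x₀)) := by
  intro heq
  have hne : γ x₀ t₀ ≠ γ y₀ t₀ := fun h => hlt.ne (hγ.embedded t₀ ht₀ hx₀ hy₀ h)
  have hpos : 0 < ‖γ x₀ t₀ - γ y₀ t₀‖ := norm_pos_iff.2 (sub_ne_zero.2 hne)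
  have hL := hγ.arcParam_one_pos ht₀
  have hA : 0 ≤ m * Real.exp (-(μ * t₀)) * (2 * arcParam (fun u => γ u t₀) 1) := by positivity
  have hspace := second_variation_chord (g := fun u => γ u t₀) hΩ.isClosed
    (hγ.contDiffOn_slice ht₀) (hγ.immersed t₀ ht₀) (fun x hx => hγ.mem hΩ.isClosed hx ht₀)
    (hγ.meetsBoundaryOrthogonally hΩ (by simp) ht₀)
    (hγ.meetsBoundaryOrthogonally hΩ (by simp) ht₀) hA
    (fun x hx y hy hxy => by
      have := hchord t₀ ⟨ht₀.1, le_rfl⟩ x hx y hy hxy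
      rw [arcBarrier] at this
      linarith)
    (fun x hx y hy => by
      have := hrefl x hx y hy
      rw [arcBarrier] at this
      linarith)
    hx₀ hy₀ hlt hpos (by
      rw [← dist_eq_norm, heq, arcBarrier]
      ring)
  have htime := inner_deriv_le_of_exp_barrier (D := fun t => γ x₀ t - γ y₀ t) (μ := μ)
    (K := m * arcBarrier γ t₀ (arcParam (fun u => γ u t₀) y₀ - arcParam (fun u => γ u t₀) x₀))
    ht₀pos (Ico_subset_Ico_right ht₀.2.le)
    ((hγ.hasDerivWithinAt_time hx₀ ht₀).sub (hγ.hasDerivWithinAt_time hy₀ ht₀))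
    (by
      have m1 := hγ.arcParam_mem_Icc hx₀ ht₀
      have m2 := hγ.arcParam_mem_Icc hy₀ ht₀
      have hmono := (strictMonoOn_arcParam (hγ.contDiffOn_slice ht₀)
        (hγ.immersed t₀ ht₀)).monotoneOn hx₀ hy₀ hlt.le
      exact mul_nonneg hm (arcBarrier_nonneg (by linarith) (by linarith [m1.1, m2.2])))
    (fun t ht => by
      rw [← dist_eq_norm]
      refine le_trans ?_ (hchord t ⟨ht.1, ht.2.le⟩ x₀ hx₀ y₀ hy₀ hlt.le)
      rw [mul_assoc, mul_comm (arcBarrier _ _ _)]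
      refine mul_le_mul_of_nonneg_left (mul_le_mul_of_nonneg_left ?_ (Real.exp_pos _).le) hm
      exact hγ.arcBarrier_sub_antitone hx₀ hy₀ hlt.le ⟨ht.1, ht.2.trans ht₀.2⟩ ht₀ ht.2.le)
    (by
      rw [← dist_eq_norm, heq]
      ring)
  have : 0 < ‖γ x₀ t₀ - γ y₀ t₀‖ ^ 2 := by positivity
  have := mul_lt_mul_of_pos_right hμ this
  linarith

/-- A reflected pair of interior points cannot touch the decaying barrier for the first time.
The reflected distance is replaced by the length of the chord to the mirror image in the
supporting line at the boundary point that realises it. -/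
theorem not_reflected_touching (hγ : IsFreeBoundaryCSF Ω T γ) (hΩ : IsConvexC2Domain Ω)
    {t₀ m μ : ℝ} (ht₀ : t₀ ∈ Ico 0 T) (ht₀pos : 0 < t₀) (hm : 0 ≤ m)
    (hμ : 4 * (Real.pi / (2 * arcParam (fun u => γ u t₀) 1)) ^ 2 < μ)
    (hrefl : ∀ t ∈ Icc 0 t₀, ∀ x ∈ Icc (0 : ℝ) 1, ∀ y ∈ Icc (0 : ℝ) 1,
      m * (Real.exp (-(μ * t)) *
        arcBarrier γ t (arcParam (fun u => γ u t) x + arcParam (fun u => γ u t) y))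
        ≤ reflectedDist Ω (γ x t) (γ y t))
    {x₀ y₀ : ℝ} (hx₀ : x₀ ∈ Ioo (0 : ℝ) 1) (hy₀ : y₀ ∈ Ioo (0 : ℝ) 1) :
    reflectedDist Ω (γ x₀ t₀) (γ y₀ t₀) ≠ m * (Real.exp (-(μ * t₀)) *
        arcBarrier γ t₀ (arcParam (fun u => γ u t₀) x₀ + arcParam (fun u => γ u t₀) y₀)) := by
  intro heq
  have hx := Ioo_subset_Icc_self hx₀
  have hy := Ioo_subset_Icc_self hy₀
  obtain ⟨z, hz, hzeq⟩ := exists_reflectedDist_eq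
    ⟨_, hγ.endpoint_mem t₀ ht₀ 0 (by simp)⟩ (γ x₀ t₀) (γ y₀ t₀)
  obtain ⟨n, -, hn, hsup, -⟩ := hΩ.exists_normal hz
  -- The chord to the mirror image realises the reflected distance at this pair only; at other
  -- points and times it is an upper bound for it.
  have hmem : ∀ t ∈ Ico 0 T, ∀ x ∈ Icc (0 : ℝ) 1, γ x t ∈ Ω :=
    fun t ht x hx => hγ.mem hΩ.isClosed hx ht
  have hdist : dist (γ x₀ t₀) (lineReflection z n (γ y₀ t₀))
      = reflectedDist Ω (γ x₀ t₀) (γ y₀ t₀) := by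
    refine le_antisymm ?_ (reflectedDist_le_dist_lineReflection hΩ.isClosed hn hsup
      (hmem t₀ ht₀ _ hx) (hmem t₀ ht₀ _ hy))
    rw [hzeq]
    refine (dist_triangle _ z _).trans_eq ?_
    rw [dist_comm z, lineReflection_eq, dist_self_add_left, norm_lineReflectionLinear hn,
      ← dist_eq_norm]
  have hpos : 0 < ‖γ x₀ t₀ - lineReflection z n (γ y₀ t₀)‖ := by
    rw [← dist_eq_norm, hdist, hzeq]
    have : γ x₀ t₀ ≠ z := fun h => hz.2 (h ▸ hγ.mem_interior t₀ ht₀ x₀ hx₀)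
    have := dist_pos.2 this
    positivity
  have hL := hγ.arcParam_one_pos ht₀
  have hA : 0 ≤ m * Real.exp (-(μ * t₀)) * (2 * arcParam (fun u => γ u t₀) 1) := by positivity
  have hspace := second_variation_reflected (g := fun u => γ u t₀) hΩ.isClosed
    (hγ.contDiffOn_slice ht₀) (hγ.immersed t₀ ht₀) (hmem t₀ ht₀) hA
    (fun x hx y hy => by
      have := hrefl t₀ ⟨ht₀.1, le_rfl⟩ x hx y hy
      rw [arcBarrier] at this
      linarith)
    hx₀ hy₀ hn hsup hpos (by
      rw [← dist_eq_norm, hdist, heq, arcBarrier]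
      ring)
  have hderiv : HasDerivWithinAt (fun t => γ x₀ t - lineReflection z n (γ y₀ t))
      (curvatureVector (fun u => γ u t₀) x₀
        - lineReflectionLinear n (curvatureVector (fun u => γ u t₀) y₀)) (Ico 0 T) t₀ := by
    simp only [lineReflection_eq]
    have h1 := (hγ.hasDerivWithinAt_time hy ht₀).sub_const z
    exact (hγ.hasDerivWithinAt_time hx ht₀).sub
      (((lineReflectionLinear n).hasFDerivAt.comp_hasDerivWithinAt t₀ h1).const_add z)
  have htime := inner_deriv_le_of_exp_barrier (μ := μ)
    (K := m * arcBarrier γ t₀ (arcParam (fun u => γ u t₀) x₀ + arcParam (fun u => γ u t₀) y₀))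
    ht₀pos (Ico_subset_Ico_right ht₀.2.le) hderiv
    (by
      have m1 := hγ.arcParam_mem_Icc hx ht₀
      have m2 := hγ.arcParam_mem_Icc hy ht₀
      exact mul_nonneg hm (arcBarrier_nonneg (by linarith [m1.1, m2.1])
        (by linarith [m1.2, m2.2])))
    (fun t ht => by
      have ht' : t ∈ Ico 0 T := ⟨ht.1, ht.2.trans ht₀.2⟩
      rw [← dist_eq_norm]
      refine le_trans ?_ ((hrefl t ⟨ht.1, ht.2.le⟩ x₀ hx y₀ hy).trans
        (reflectedDist_le_dist_lineReflection hΩ.isClosed hn hsup (hmem t ht' _ hx)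
          (hmem t ht' _ hy)))
      rw [mul_assoc, mul_comm (arcBarrier _ _ _)]
      refine mul_le_mul_of_nonneg_left (mul_le_mul_of_nonneg_left ?_ (Real.exp_pos _).le) hm
      exact hγ.arcBarrier_add_antitone hx hy ht' ht₀ ht.2.le)
    (by
      rw [← dist_eq_norm, hdist, heq]
      ring)
  have : 0 < ‖γ x₀ t₀ - lineReflection z n (γ y₀ t₀)‖ ^ 2 := by positivity
  have := mul_lt_mul_of_pos_right hμ this
  linarith

end IsFreeBoundaryCSF

/-! ### The minimum principle -/

theorem arcDist_eq {g : ℝ → Plane} (hg : ContDiffOn ℝ ∞ g (Icc 0 1)) {x y : ℝ}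
    (hx : x ∈ Icc (0 : ℝ) 1) (hy : y ∈ Icc (0 : ℝ) 1) :
    arcDist g x y = |arcParam g y - arcParam g x| := by
  rw [arcDist, integral_norm_velocity hg hx hy]

theorem reflectedArcDist_eq {g : ℝ → Plane} (hg : ContDiffOn ℝ ∞ g (Icc 0 1))
    (himm : ∀ x ∈ Icc (0 : ℝ) 1, velocity g x ≠ 0) {x y : ℝ}
    (hx : x ∈ Icc (0 : ℝ) 1) (hy : y ∈ Icc (0 : ℝ) 1) :
    reflectedArcDist g x y = min (arcParam g x + arcParam g y)
      (2 * arcParam g 1 - (arcParam g x + arcParam g y)) := by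
  have m1 := arcParam_mem hg himm hx
  have m2 := arcParam_mem hg himm hy
  have h0 : (0 : ℝ) ∈ Icc (0 : ℝ) 1 := by simp
  have h1 : (1 : ℝ) ∈ Icc (0 : ℝ) 1 := by simp
  rw [reflectedArcDist, arcDist_eq hg hx h0, arcDist_eq hg hy h0, arcDist_eq hg hx h1,
    arcDist_eq hg hy h1, arcParam_zero, zero_sub, zero_sub, abs_neg, abs_neg,
    abs_of_nonneg m1.1, abs_of_nonneg m2.1, abs_of_nonneg (sub_nonneg.2 m1.2),
    abs_of_nonneg (sub_nonneg.2 m2.2)]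
  congr 1
  ring

namespace IsFreeBoundaryCSF

variable {Ω : Set Plane} {T : ℝ} {γ : ℝ → ℝ → Plane}

/-- A lower bound `k L sin (π δ / L)` for the extended chord-arc profile, in terms of pairs of
points. -/
theorem le_extendedChordArcProfile_iff (hγ : IsFreeBoundaryCSF Ω T γ) {t : ℝ} (ht : t ∈ Ico 0 T)
    (k : ℝ) :
    (∀ δ : ℝ, ((k * arcBarrier γ t δ : ℝ) : EReal)
      ≤ extendedChordArcProfile Ω (fun u => γ u t) δ) ↔
    (∀ x ∈ Icc (0 : ℝ) 1, ∀ y ∈ Icc (0 : ℝ) 1, x ≤ y →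
      k * arcBarrier γ t (arcParam (fun u => γ u t) y - arcParam (fun u => γ u t) x)
        ≤ dist (γ x t) (γ y t)) ∧
    (∀ x ∈ Icc (0 : ℝ) 1, ∀ y ∈ Icc (0 : ℝ) 1,
      k * arcBarrier γ t (arcParam (fun u => γ u t) x + arcParam (fun u => γ u t) y)
        ≤ reflectedDist Ω (γ x t) (γ y t)) := by
  have hg := hγ.contDiffOn_slice ht
  have himm := hγ.immersed t ht
  have hmono := (strictMonoOn_arcParam hg himm).monotoneOn
  have hmin : ∀ a : ℝ, arcBarrier γ t (min a (2 * arcParam (fun u => γ u t) 1 - a))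
      = arcBarrier γ t a := by
    intro a
    rcases min_choice a (2 * arcParam (fun u => γ u t) 1 - a) with h | h
    · rw [h]
    · rw [h, hγ.arcBarrier_sub ht]
  constructor
  · intro h
    constructor
    · intro x hx y hy hxy
      have h1 := (le_min_iff.1 (h (arcDist (fun u => γ u t) x y))).1
      have h2 := h1.trans (sInf_le ⟨x, hx, y, hy, rfl, rfl⟩)
      rwa [EReal.coe_le_coe_iff, arcDist_eq hg hx hy,
        abs_of_nonneg (sub_nonneg.2 (hmono hx hy hxy))] at h2
    · intro x hx y hy
      have h1 := (le_min_iff.1 (h (reflectedArcDist (fun u => γ u t) x y))).2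
      have h2 := h1.trans (sInf_le ⟨x, hx, y, hy, rfl, rfl⟩)
      rwa [EReal.coe_le_coe_iff, reflectedArcDist_eq hg himm hx hy, hmin] at h2
  · rintro ⟨hc, hr⟩ δ
    refine le_min (le_sInf ?_) (le_sInf ?_)
    · rintro _ ⟨x, hx, y, hy, rfl, rfl⟩
      rw [EReal.coe_le_coe_iff, arcDist_eq hg hx hy]
      rcases le_total x y with hxy | hxy
      · rw [abs_of_nonneg (sub_nonneg.2 (hmono hx hy hxy))]
        exact hc x hx y hy hxy
      · rw [abs_sub_comm, abs_of_nonneg (sub_nonneg.2 (hmono hy hx hxy)), dist_comm]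
        exact hc y hy x hx hxy
    · rintro _ ⟨x, hx, y, hy, rfl, rfl⟩
      rw [EReal.coe_le_coe_iff, reflectedArcDist_eq hg himm hx hy, hmin]
      exact hr x hx y hy

/-- Short chords have almost the length of their arcs, so the constant of a sine lower bound is at
most `1 / π`. -/
theorem mul_pi_le_one (hγ : IsFreeBoundaryCSF Ω T γ) {t c : ℝ} (ht : t ∈ Ico 0 T)
    (hchord : ∀ x ∈ Icc (0 : ℝ) 1, ∀ y ∈ Icc (0 : ℝ) 1, x ≤ y →
      c * arcBarrier γ t (arcParam (fun u => γ u t) y - arcParam (fun u => γ u t) x)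
        ≤ dist (γ x t) (γ y t)) : c * Real.pi ≤ 1 := by
  have hg := hγ.contDiffOn_slice ht
  have h0 : (0 : ℝ) ∈ Icc (0 : ℝ) 1 := by simp
  have hL := hγ.arcParam_one_pos ht
  set L := 2 * arcParam (fun u => γ u t) 1 with hLdef
  set v := ‖velocity (fun u => γ u t) 0‖ with hv
  have hv0 : 0 < v := norm_pos_iff.2 (hγ.immersed t ht 0 h0)
  have hs : HasDerivWithinAt (arcParam fun u => γ u t) v (Icc 0 1) 0 :=
    hasDerivWithinAt_arcParam hg h0
  -- The difference of arclength and barrier vanishes at `y = 0` and is non-negative for `y > 0`.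
  have hd : HasDerivWithinAt (fun y => arcParam (fun u => γ u t) y
      - c * (L * Real.sin (Real.pi / L * arcParam (fun u => γ u t) y)))
      (v * (1 - c * Real.pi)) (Icc 0 1) 0 := by
    have h := hs.sub ((((hs.const_mul (Real.pi / L)).sin).const_mul L).const_mul c)
    refine h.congr_deriv ?_
    rw [arcParam_zero, mul_zero, Real.cos_zero]
    have : L ≠ 0 := by positivity
    field_simp
  have hd' := hd.mono Ioc_subset_Icc_self
  rw [hasDerivWithinAt_iff_tendsto_slope' (by simp)] at hd'
  have hne : (𝓝[Ioc (0 : ℝ) 1] 0).NeBot := by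
    rw [nhdsWithin_Ioc_eq_nhdsGT zero_lt_one]
    infer_instance
  have hnonneg : 0 ≤ v * (1 - c * Real.pi) := by
    refine ge_of_tendsto hd' ?_
    filter_upwards [self_mem_nhdsWithin] with y hy
    have hyI := Ioc_subset_Icc_self hy
    have h1 := hchord 0 h0 y hyI hyI.1
    have h2 := norm_sub_le_arcParam_sub hg h0 hyI hyI.1
    rw [dist_comm, dist_eq_norm] at h1
    have h3 := h1.trans h2
    rw [arcParam_zero, sub_zero, arcBarrier] at h3
    rw [slope_def_field, arcParam_zero, mul_zero, Real.sin_zero, mul_zero, mul_zero, sub_zero,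
      sub_zero, sub_zero]
    exact div_nonneg (sub_nonneg.2 h3) hyI.1
  have := nonneg_of_mul_nonneg_right hnonneg hv0
  linarith

theorem continuousOn_exp_mul_arcBarrier (hγ : IsFreeBoundaryCSF Ω T γ) {t₁ : ℝ}
    (ht₁ : t₁ ∈ Ico 0 T) (μ : ℝ) {a : ℝ × ℝ × ℝ → ℝ} {K : Set (ℝ × ℝ × ℝ)}
    (hK : ∀ p ∈ K, p.2.2 ∈ Icc 0 t₁) (ha : ContinuousOn a K) :
    ContinuousOn (fun p => Real.exp (-(μ * p.2.2)) * arcBarrier γ p.2.2 (a p)) K := by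
  have hL : ContinuousOn (fun p : ℝ × ℝ × ℝ => arcParam (fun u => γ u p.2.2) 1) K :=
    (hγ.continuousOn_arcParam ht₁).comp (f := fun p : ℝ × ℝ × ℝ => ((1 : ℝ), p.2.2))
      (by fun_prop) fun p hp => ⟨by simp, hK p hp⟩
  have hne : ∀ p ∈ K, 2 * arcParam (fun u => γ u p.2.2) 1 ≠ 0 := fun p hp => by
    have := hγ.arcParam_one_pos ⟨(hK p hp).1, (hK p hp).2.trans_lt ht₁.2⟩
    positivity
  have h2L : ContinuousOn (fun p : ℝ × ℝ × ℝ => 2 * arcParam (fun u => γ u p.2.2) 1) K :=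
    continuousOn_const.mul hL
  have hs := Real.continuous_sin.comp_continuousOn
    (((continuousOn_const (c := Real.pi)).div h2L hne).mul ha)
  exact ContinuousOn.mul (by fun_prop) (h2L.mul hs)

/-- The pairs of points of the curves, in increasing order, with times up to `t₁`. -/
def chordSet (t₁ : ℝ) : Set (ℝ × ℝ × ℝ) :=
  (Icc 0 1 ×ˢ Icc 0 1 ×ˢ Icc 0 t₁) ∩ {p | p.1 ≤ p.2.1}

theorem continuousOn_arcParam_fst (hγ : IsFreeBoundaryCSF Ω T γ) {t₁ : ℝ} (ht₁ : t₁ ∈ Ico 0 T) :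
    ContinuousOn (fun p : ℝ × ℝ × ℝ => arcParam (fun u => γ u p.2.2) p.1)
      (Icc 0 1 ×ˢ Icc 0 1 ×ˢ Icc 0 t₁) :=
  (hγ.continuousOn_arcParam ht₁).comp (f := fun p : ℝ × ℝ × ℝ => (p.1, p.2.2))
    (by fun_prop) fun _ hp => ⟨hp.1, hp.2.2⟩

theorem continuousOn_arcParam_snd (hγ : IsFreeBoundaryCSF Ω T γ) {t₁ : ℝ} (ht₁ : t₁ ∈ Ico 0 T) :
    ContinuousOn (fun p : ℝ × ℝ × ℝ => arcParam (fun u => γ u p.2.2) p.2.1)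
      (Icc 0 1 ×ˢ Icc 0 1 ×ˢ Icc 0 t₁) :=
  (hγ.continuousOn_arcParam ht₁).comp (f := fun p : ℝ × ℝ × ℝ => (p.2.1, p.2.2))
    (by fun_prop) fun _ hp => ⟨hp.2.1, hp.2.2⟩

theorem continuousOn_apply_fst (hγ : IsFreeBoundaryCSF Ω T γ) {t₁ : ℝ} (ht₁ : t₁ ∈ Ico 0 T) :
    ContinuousOn (fun p : ℝ × ℝ × ℝ => γ p.1 p.2.2) (Icc 0 1 ×ˢ Icc 0 1 ×ˢ Icc 0 t₁) :=
  hγ.smooth.continuousOn.comp (f := fun p : ℝ × ℝ × ℝ => (p.1, p.2.2)) (by fun_prop)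
    fun _ hp => ⟨hp.1, hp.2.2.1, hp.2.2.2.trans_lt ht₁.2⟩

theorem continuousOn_apply_snd (hγ : IsFreeBoundaryCSF Ω T γ) {t₁ : ℝ} (ht₁ : t₁ ∈ Ico 0 T) :
    ContinuousOn (fun p : ℝ × ℝ × ℝ => γ p.2.1 p.2.2) (Icc 0 1 ×ˢ Icc 0 1 ×ˢ Icc 0 t₁) :=
  hγ.smooth.continuousOn.comp (f := fun p : ℝ × ℝ × ℝ => (p.2.1, p.2.2)) (by fun_prop)
    fun _ hp => ⟨hp.2.1, hp.2.2.1, hp.2.2.2.trans_lt ht₁.2⟩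

/-- On chords, the best constant `m ≤ C` in the decaying sine lower bound is `C` or is attained. -/
theorem exists_touching_chord (hγ : IsFreeBoundaryCSF Ω T γ) {t₁ C μ : ℝ} (ht₁ : t₁ ∈ Ico 0 T)
    (hC : 0 ≤ C) (hCπ : C * Real.pi < 1) (hμ : 0 ≤ μ) :
    ∃ m ≤ C, (∀ t ∈ Icc 0 t₁, ∀ x ∈ Icc (0 : ℝ) 1, ∀ y ∈ Icc (0 : ℝ) 1, x ≤ y →
      m * (Real.exp (-(μ * t)) *
        arcBarrier γ t (arcParam (fun u => γ u t) y - arcParam (fun u => γ u t) x))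
        ≤ dist (γ x t) (γ y t)) ∧
      (m < C → ∃ t ∈ Icc 0 t₁, ∃ x ∈ Icc (0 : ℝ) 1, ∃ y ∈ Icc (0 : ℝ) 1, x < y ∧
        0 < Real.exp (-(μ * t)) *
          arcBarrier γ t (arcParam (fun u => γ u t) y - arcParam (fun u => γ u t) x) ∧
        dist (γ x t) (γ y t) = m * (Real.exp (-(μ * t)) *
          arcBarrier γ t (arcParam (fun u => γ u t) y - arcParam (fun u => γ u t) x))) := by
  have hKc : IsCompact (chordSet t₁) :=
    (isCompact_Icc.prod (isCompact_Icc.prod isCompact_Icc)).inter_right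
      (isClosed_le continuous_fst (continuous_fst.comp continuous_snd))
  have hsub : chordSet t₁ ⊆ Icc 0 1 ×ˢ Icc 0 1 ×ˢ Icc 0 t₁ := inter_subset_left
  have hT : ∀ p ∈ chordSet t₁, p.2.2 ∈ Ico 0 T := fun p hp =>
    ⟨hp.1.2.2.1, hp.1.2.2.2.trans_lt ht₁.2⟩
  have harc : ∀ p ∈ chordSet t₁,
      0 ≤ arcParam (fun u => γ u p.2.2) p.2.1 - arcParam (fun u => γ u p.2.2) p.1 := fun p hp =>
    sub_nonneg.2 ((strictMonoOn_arcParam (hγ.contDiffOn_slice (hT p hp))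
      (hγ.immersed _ (hT p hp))).monotoneOn hp.1.1 hp.1.2.1 hp.2)
  have harc' : ∀ p ∈ chordSet t₁,
      arcParam (fun u => γ u p.2.2) p.2.1 - arcParam (fun u => γ u p.2.2) p.1
        ≤ arcParam (fun u => γ u p.2.2) 1 := fun p hp => by
    have m1 := hγ.arcParam_mem_Icc hp.1.1 (hT p hp)
    have m2 := hγ.arcParam_mem_Icc hp.1.2.1 (hT p hp)
    linarith [m1.1, m2.2]
  obtain ⟨m, hmC, hle, hex⟩ := exists_touching_multiple (C := C) hKc
    (d := fun p => dist (γ p.1 p.2.2) (γ p.2.1 p.2.2))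
    (F := fun p => Real.exp (-(μ * p.2.2)) * arcBarrier γ p.2.2
      (arcParam (fun u => γ u p.2.2) p.2.1 - arcParam (fun u => γ u p.2.2) p.1))
    ((continuous_dist.comp_continuousOn
      ((hγ.continuousOn_apply_fst ht₁).prodMk (hγ.continuousOn_apply_snd ht₁))).mono hsub)
    (hγ.continuousOn_exp_mul_arcBarrier ht₁ μ (fun p hp => hp.1.2.2)
      (((hγ.continuousOn_arcParam_snd ht₁).sub (hγ.continuousOn_arcParam_fst ht₁)).mono hsub))
    (fun p hp => mul_nonneg (Real.exp_pos _).le (arcBarrier_nonneg (harc p hp)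
      (by linarith [harc' p hp, hγ.arcParam_one_pos (hT p hp)])))
    (fun p hp h0 => by
      have hb := (mul_eq_zero.1 h0).resolve_left (Real.exp_pos _).ne'
      have hpos := hγ.arcParam_one_pos (hT p hp)
      have hzero := (hγ.eq_zero_or_eq_of_arcBarrier_eq_zero (hT p hp) (harc p hp)
        (by linarith [harc' p hp]) hb).resolve_right (by linarith [harc' p hp])
      have hxy : p.2.1 = p.1 := (strictMonoOn_arcParam (hγ.contDiffOn_slice (hT p hp))
        (hγ.immersed _ (hT p hp))).injOn hp.1.2.1 hp.1.1 (sub_eq_zero.1 hzero)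
      obtain ⟨r, hr, hlow⟩ := hγ.exists_chord_lower_bound hp.1.1 (hT p hp)
        (ε := 1 - C * Real.pi) (by linarith)
      refine Metric.mem_nhdsWithin_iff.2 ⟨r, hr, fun q hq => ?_⟩
      obtain ⟨hqr, hqK⟩ := hq
      rw [Metric.mem_ball, Prod.dist_eq, Prod.dist_eq, max_lt_iff, max_lt_iff, Real.dist_eq,
        Real.dist_eq, Real.dist_eq, hxy] at hqr
      have h1 := hlow q.2.2 (hT q hqK) hqr.2.2 q.1 hqK.1.1 q.2.1 hqK.1.2.1 hqr.1 hqr.2.1 hqK.2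
      refine le_trans ?_ h1
      have h2 := hγ.arcBarrier_le (hT q hqK) (harc q hqK)
      have h3 : Real.exp (-(μ * q.2.2)) ≤ 1 :=
        Real.exp_le_one_iff.2 (by have := mul_nonneg hμ hqK.1.2.2.1; linarith)
      have h4 := arcBarrier_nonneg (γ := γ) (t := q.2.2) (harc q hqK)
        (by linarith [harc' q hqK, hγ.arcParam_one_pos (hT q hqK)])
      have h5 := mul_le_mul_of_nonneg_left ((mul_le_of_le_one_left h4 h3).trans h2) hC
      rw [sub_sub_cancel]
      linarith)
  refine ⟨m, hmC, fun t ht x hx y hy hxy => hle (x, y, t) ⟨⟨hx, hy, ht⟩, hxy⟩, fun h => ?_⟩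
  obtain ⟨⟨x, y, t⟩, hp, hFpos, heq⟩ := hex h
  refine ⟨t, hp.1.2.2, x, hp.1.1, y, hp.1.2.1, lt_of_le_of_ne hp.2 fun hxy => ?_, hFpos, heq⟩
  have hxy' : x = y := hxy
  subst hxy'
  simp [arcBarrier] at hFpos

/-- The lower bound near a degenerate reflected pair, at the endpoint with parameter `e`. -/
theorem eventually_le_reflectedDist (hγ : IsFreeBoundaryCSF Ω T γ) (hΩ : IsConvexC2Domain Ω)
    {t₁ C μ : ℝ} (ht₁ : t₁ ∈ Ico 0 T) (hC : 0 < C) (hCπ : C * Real.pi < 1) (hμ : 0 ≤ μ)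
    {p : ℝ × ℝ × ℝ} (hp : p ∈ Icc 0 1 ×ˢ Icc 0 1 ×ˢ Icc 0 t₁) {e : ℝ}
    (he : e ∈ ({0, 1} : Set ℝ)) (hp1 : p.1 = e) (hp2 : p.2.1 = e)
    (hbar : ∀ q ∈ Icc 0 1 ×ˢ Icc 0 1 ×ˢ Icc 0 t₁, arcBarrier γ q.2.2
        (arcParam (fun u => γ u q.2.2) q.1 + arcParam (fun u => γ u q.2.2) q.2.1) ≤
        Real.pi * (|arcParam (fun u => γ u q.2.2) q.1 - arcParam (fun u => γ u q.2.2) e|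
          + |arcParam (fun u => γ u q.2.2) q.2.1 - arcParam (fun u => γ u q.2.2) e|)) :
    ∀ᶠ q in 𝓝[Icc 0 1 ×ˢ Icc 0 1 ×ˢ Icc 0 t₁] p,
      C * (Real.exp (-(μ * q.2.2)) * arcBarrier γ q.2.2
        (arcParam (fun u => γ u q.2.2) q.1 + arcParam (fun u => γ u q.2.2) q.2.1))
        ≤ reflectedDist Ω (γ q.1 q.2.2) (γ q.2.1 q.2.2) := by
  have hT : ∀ p ∈ Icc (0 : ℝ) 1 ×ˢ Icc (0 : ℝ) 1 ×ˢ Icc 0 t₁, p.2.2 ∈ Ico 0 T := fun p hp =>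
    ⟨hp.2.2.1, hp.2.2.2.trans_lt ht₁.2⟩
  have hne : (frontier Ω).Nonempty := ⟨_, hγ.endpoint_mem t₁ ht₁ 0 (by simp)⟩
  have hCpos : 0 < C * Real.pi := mul_pos hC Real.pi_pos
  obtain ⟨r, hr, hlow⟩ := hγ.exists_boundary_dist_lower_bound hΩ he (hT p hp)
    (ε := 1 - C * Real.pi) (by linarith) (by linarith)
  refine Metric.mem_nhdsWithin_iff.2 ⟨r, hr, fun q hq => ?_⟩
  obtain ⟨hqr, hqK⟩ := hq
  rw [Metric.mem_ball, Prod.dist_eq, Prod.dist_eq, max_lt_iff, max_lt_iff, Real.dist_eq,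
    Real.dist_eq, Real.dist_eq, hp1, hp2] at hqr
  refine le_reflectedDist hne fun z hz => ?_
  have h1 := hlow q.2.2 (hT q hqK) hqr.2.2 q.1 hqK.1 hqr.1 z hz
  have h1' := hlow q.2.2 (hT q hqK) hqr.2.2 q.2.1 hqK.2.1 hqr.2.1 z hz
  have h2 := hbar q hqK
  have h3 : Real.exp (-(μ * q.2.2)) ≤ 1 :=
    Real.exp_le_one_iff.2 (by have := mul_nonneg hμ hqK.2.2.1; linarith)
  have m1 := hγ.arcParam_mem_Icc hqK.1 (hT q hqK)
  have m2 := hγ.arcParam_mem_Icc hqK.2.1 (hT q hqK)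
  have h4 := arcBarrier_nonneg (γ := γ) (t := q.2.2) (add_nonneg m1.1 m2.1) (by linarith [m1.2, m2.2])
  have h5 := mul_le_mul_of_nonneg_left ((mul_le_of_le_one_left h4 h3).trans h2) hC.le
  rw [sub_sub_cancel] at h1 h1'
  linarith

/-- On reflected pairs, the best constant `m ≤ C` in the decaying sine lower bound is `C` or is
attained. -/
theorem exists_touching_reflected (hγ : IsFreeBoundaryCSF Ω T γ) (hΩ : IsConvexC2Domain Ω)
    {t₁ C μ : ℝ} (ht₁ : t₁ ∈ Ico 0 T)
    (hC : 0 < C) (hCπ : C * Real.pi < 1) (hμ : 0 ≤ μ) :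
    ∃ m ≤ C, (∀ t ∈ Icc 0 t₁, ∀ x ∈ Icc (0 : ℝ) 1, ∀ y ∈ Icc (0 : ℝ) 1,
      m * (Real.exp (-(μ * t)) *
        arcBarrier γ t (arcParam (fun u => γ u t) x + arcParam (fun u => γ u t) y))
        ≤ reflectedDist Ω (γ x t) (γ y t)) ∧
      (m < C → ∃ t ∈ Icc 0 t₁, ∃ x ∈ Icc (0 : ℝ) 1, ∃ y ∈ Icc (0 : ℝ) 1,
        0 < Real.exp (-(μ * t)) *
          arcBarrier γ t (arcParam (fun u => γ u t) x + arcParam (fun u => γ u t) y) ∧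
        reflectedDist Ω (γ x t) (γ y t) = m * (Real.exp (-(μ * t)) *
          arcBarrier γ t (arcParam (fun u => γ u t) x + arcParam (fun u => γ u t) y))) := by
  set K : Set (ℝ × ℝ × ℝ) := Icc 0 1 ×ˢ Icc 0 1 ×ˢ Icc 0 t₁ with hK
  have hKc : IsCompact K := isCompact_Icc.prod (isCompact_Icc.prod isCompact_Icc)
  have hT : ∀ p ∈ K, p.2.2 ∈ Ico 0 T := fun p hp => ⟨hp.2.2.1, hp.2.2.2.trans_lt ht₁.2⟩
  have hne : (frontier Ω).Nonempty :=
    ⟨_, hγ.endpoint_mem t₁ ht₁ 0 (by simp)⟩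
  have harc : ∀ p ∈ K,
      0 ≤ arcParam (fun u => γ u p.2.2) p.1 + arcParam (fun u => γ u p.2.2) p.2.1 ∧
      arcParam (fun u => γ u p.2.2) p.1 + arcParam (fun u => γ u p.2.2) p.2.1
        ≤ 2 * arcParam (fun u => γ u p.2.2) 1 := fun p hp => by
    have m1 := hγ.arcParam_mem_Icc hp.1 (hT p hp)
    have m2 := hγ.arcParam_mem_Icc hp.2.1 (hT p hp)
    exact ⟨by linarith [m1.1, m2.1], by linarith [m1.2, m2.2]⟩
  obtain ⟨m, hmC, hle, hex⟩ := exists_touching_multiple (C := C) hKc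
    (d := fun p => reflectedDist Ω (γ p.1 p.2.2) (γ p.2.1 p.2.2))
    (F := fun p => Real.exp (-(μ * p.2.2)) * arcBarrier γ p.2.2
      (arcParam (fun u => γ u p.2.2) p.1 + arcParam (fun u => γ u p.2.2) p.2.1))
    (ContinuousOn.reflectedDist hne (hγ.continuousOn_apply_fst ht₁)
      (hγ.continuousOn_apply_snd ht₁))
    (hγ.continuousOn_exp_mul_arcBarrier ht₁ μ (fun p hp => hp.2.2)
      ((hγ.continuousOn_arcParam_fst ht₁).add (hγ.continuousOn_arcParam_snd ht₁)))
    (fun p hp => mul_nonneg (Real.exp_pos _).le (arcBarrier_nonneg (harc p hp).1 (harc p hp).2))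
    (fun p hp h0 => by
      have hb := (mul_eq_zero.1 h0).resolve_left (Real.exp_pos _).ne'
      have hinj := (strictMonoOn_arcParam (hγ.contDiffOn_slice (hT p hp))
        (hγ.immersed _ (hT p hp))).injOn
      have m1 := hγ.arcParam_mem_Icc hp.1 (hT p hp)
      have m2 := hγ.arcParam_mem_Icc hp.2.1 (hT p hp)
      rcases hγ.eq_zero_or_eq_of_arcBarrier_eq_zero (hT p hp) (harc p hp).1 (harc p hp).2 hb
        with h | h
      · refine hγ.eventually_le_reflectedDist hΩ ht₁ hC hCπ hμ hp (e := 0) (by simp) (hinj hp.1 (by simp) ?_) (hinj hp.2.1 (by simp) ?_)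
          fun q hq => ?_
        · rw [arcParam_zero]; linarith [m1.1, m2.1]
        · rw [arcParam_zero]; linarith [m1.1, m2.1]
        · rw [arcParam_zero, sub_zero, sub_zero,
            abs_of_nonneg (hγ.arcParam_mem_Icc hq.1 (hT q hq)).1,
            abs_of_nonneg (hγ.arcParam_mem_Icc hq.2.1 (hT q hq)).1]
          exact hγ.arcBarrier_le (hT q hq) (harc q hq).1
      · refine hγ.eventually_le_reflectedDist hΩ ht₁ hC hCπ hμ hp (e := 1) (by simp) (hinj hp.1 (by simp) ?_) (hinj hp.2.1 (by simp) ?_)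
          fun q hq => ?_
        · linarith [m1.2, m2.2]
        · linarith [m1.2, m2.2]
        · rw [abs_sub_comm, abs_sub_comm (arcParam _ q.2.1),
            abs_of_nonneg (sub_nonneg.2 (hγ.arcParam_mem_Icc hq.1 (hT q hq)).2),
            abs_of_nonneg (sub_nonneg.2 (hγ.arcParam_mem_Icc hq.2.1 (hT q hq)).2),
            ← hγ.arcBarrier_sub (hT q hq)]
          refine (hγ.arcBarrier_le (hT q hq) (sub_nonneg.2 (harc q hq).2)).trans_eq ?_
          ring)
  refine ⟨m, hmC, fun t ht x hx y hy => hle (x, y, t) ⟨hx, hy, ht⟩, fun h => ?_⟩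
  obtain ⟨⟨x, y, t⟩, hp, hFpos, heq⟩ := hex h
  exact ⟨t, hp.2.2, x, hp.1, y, hp.2.1, hFpos, heq⟩

/-- A sine lower bound with constant `C < 1 / π` at the initial time persists, with a factor
`exp (-μ t)`, as long as `μ > 4 π² / L²`. -/
theorem exp_mul_arcBarrier_le (hγ : IsFreeBoundaryCSF Ω T γ) (hΩ : IsConvexC2Domain Ω)
    {t₁ C μ : ℝ} (ht₁ : t₁ ∈ Ico 0 T) (hC : 0 < C) (hCπ : C * Real.pi < 1)
    (hμ : ∀ t ∈ Icc 0 t₁, 4 * (Real.pi / (2 * arcParam (fun u => γ u t) 1)) ^ 2 < μ)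
    (hchord : ∀ x ∈ Icc (0 : ℝ) 1, ∀ y ∈ Icc (0 : ℝ) 1, x ≤ y →
      C * arcBarrier γ 0 (arcParam (fun u => γ u 0) y - arcParam (fun u => γ u 0) x)
        ≤ dist (γ x 0) (γ y 0))
    (hrefl : ∀ x ∈ Icc (0 : ℝ) 1, ∀ y ∈ Icc (0 : ℝ) 1,
      C * arcBarrier γ 0 (arcParam (fun u => γ u 0) x + arcParam (fun u => γ u 0) y)
        ≤ reflectedDist Ω (γ x 0) (γ y 0)) :
    (∀ t ∈ Icc 0 t₁, ∀ x ∈ Icc (0 : ℝ) 1, ∀ y ∈ Icc (0 : ℝ) 1, x ≤ y →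
      C * (Real.exp (-(μ * t)) *
        arcBarrier γ t (arcParam (fun u => γ u t) y - arcParam (fun u => γ u t) x))
        ≤ dist (γ x t) (γ y t)) ∧
    (∀ t ∈ Icc 0 t₁, ∀ x ∈ Icc (0 : ℝ) 1, ∀ y ∈ Icc (0 : ℝ) 1,
      C * (Real.exp (-(μ * t)) *
        arcBarrier γ t (arcParam (fun u => γ u t) x + arcParam (fun u => γ u t) y))
        ≤ reflectedDist Ω (γ x t) (γ y t)) := by
  have hμ0 : 0 ≤ μ := le_trans (by positivity) (hμ t₁ ⟨ht₁.1, le_rfl⟩).le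
  obtain ⟨m₁, hm₁, hle₁, hex₁⟩ := hγ.exists_touching_chord ht₁ hC.le hCπ hμ0
  obtain ⟨m₂, hm₂, hle₂, hex₂⟩ := hγ.exists_touching_reflected hΩ ht₁ hC hCπ hμ0
  have hTt : ∀ t ∈ Icc 0 t₁, t ∈ Ico 0 T := fun t ht => ⟨ht.1, ht.2.trans_lt ht₁.2⟩
  -- Both lower bounds hold with the smaller of the two constants.
  have hle₁' : ∀ m ≤ m₁, ∀ t ∈ Icc 0 t₁, ∀ x ∈ Icc (0 : ℝ) 1, ∀ y ∈ Icc (0 : ℝ) 1, x ≤ y →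
      m * (Real.exp (-(μ * t)) *
        arcBarrier γ t (arcParam (fun u => γ u t) y - arcParam (fun u => γ u t) x))
        ≤ dist (γ x t) (γ y t) := by
    intro m hm t ht x hx y hy hxy
    refine le_trans (mul_le_mul_of_nonneg_right hm (mul_nonneg (Real.exp_pos _).le ?_))
      (hle₁ t ht x hx y hy hxy)
    have a1 := hγ.arcParam_mem_Icc hx (hTt t ht)
    have a2 := hγ.arcParam_mem_Icc hy (hTt t ht)
    exact arcBarrier_nonneg (sub_nonneg.2 ((strictMonoOn_arcParam (hγ.contDiffOn_slice (hTt t ht))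
      (hγ.immersed t (hTt t ht))).monotoneOn hx hy hxy)) (by linarith [a1.1, a2.1, a2.2])
  have hle₂' : ∀ m ≤ m₂, ∀ t ∈ Icc 0 t₁, ∀ x ∈ Icc (0 : ℝ) 1, ∀ y ∈ Icc (0 : ℝ) 1,
      m * (Real.exp (-(μ * t)) *
        arcBarrier γ t (arcParam (fun u => γ u t) x + arcParam (fun u => γ u t) y))
        ≤ reflectedDist Ω (γ x t) (γ y t) := by
    intro m hm t ht x hx y hy
    refine le_trans (mul_le_mul_of_nonneg_right hm (mul_nonneg (Real.exp_pos _).le ?_))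
      (hle₂ t ht x hx y hy)
    have a1 := hγ.arcParam_mem_Icc hx (hTt t ht)
    have a2 := hγ.arcParam_mem_Icc hy (hTt t ht)
    exact arcBarrier_nonneg (by linarith [a1.1, a2.1]) (by linarith [a1.2, a2.2])
  have hnochord : ∀ m ≤ m₁, m ≤ m₂ → m < C → ∀ t ∈ Icc 0 t₁, ∀ x ∈ Icc (0 : ℝ) 1,
      ∀ y ∈ Icc (0 : ℝ) 1, x < y →
      0 < Real.exp (-(μ * t)) *
          arcBarrier γ t (arcParam (fun u => γ u t) y - arcParam (fun u => γ u t) x) →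
      dist (γ x t) (γ y t) ≠ m * (Real.exp (-(μ * t)) *
          arcBarrier γ t (arcParam (fun u => γ u t) y - arcParam (fun u => γ u t) x)) := by
    intro m hmm₁ hmm₂ hmC t ht x hx y hy hxy hF heq
    have hm0 : 0 ≤ m := le_of_mul_le_mul_right (by rw [zero_mul, ← heq]; exact dist_nonneg) hF
    have ht0 : 0 < t := by
      refine lt_of_le_of_ne ht.1 fun h => ?_
      subst h
      rw [mul_zero, neg_zero, Real.exp_zero, one_mul] at heq hF
      have := hchord x hx y hy hxy.le
      rw [heq] at this
      exact absurd (mul_lt_mul_of_pos_right hmC hF) (not_lt.2 this)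
    exact hγ.not_chord_touching hΩ (hTt t ht) ht0 hm0 (hμ t ht)
      (fun s hs => hle₁' m hmm₁ s ⟨hs.1, hs.2.trans ht.2⟩) (hle₂' m hmm₂ t ht) hx hy hxy heq
  have hnorefl : ∀ m ≤ m₁, m ≤ m₂ → m < C → ∀ t ∈ Icc 0 t₁, ∀ x ∈ Icc (0 : ℝ) 1,
      ∀ y ∈ Icc (0 : ℝ) 1,
      0 < Real.exp (-(μ * t)) *
          arcBarrier γ t (arcParam (fun u => γ u t) x + arcParam (fun u => γ u t) y) →
      reflectedDist Ω (γ x t) (γ y t) ≠ m * (Real.exp (-(μ * t)) *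
          arcBarrier γ t (arcParam (fun u => γ u t) x + arcParam (fun u => γ u t) y)) := by
    intro m hmm₁ hmm₂ hmC t ht
    have htT := hTt t ht
    have h0 : (0 : ℝ) ∈ Icc (0 : ℝ) 1 := by simp
    have h1 : (1 : ℝ) ∈ Icc (0 : ℝ) 1 := by simp
    -- A reflected pair that contains an endpoint is a chord.
    have hend0 : ∀ y ∈ Icc (0 : ℝ) 1, 0 < Real.exp (-(μ * t)) *
          arcBarrier γ t (arcParam (fun u => γ u t) 0 + arcParam (fun u => γ u t) y) →
        reflectedDist Ω (γ 0 t) (γ y t) ≠ m * (Real.exp (-(μ * t)) *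
          arcBarrier γ t (arcParam (fun u => γ u t) 0 + arcParam (fun u => γ u t) y)) := by
      intro y hy hF heq
      rw [reflectedDist_eq_dist (hγ.endpoint_mem t htT 0 (by simp))] at heq
      rw [arcParam_zero, zero_add] at hF heq
      have hne : (0 : ℝ) ≠ y := by
        rintro rfl
        simp [arcBarrier, arcParam_zero] at hF
      exact hnochord m hmm₁ hmm₂ hmC t ht 0 h0 y hy (lt_of_le_of_ne hy.1 hne)
        (by rwa [arcParam_zero, sub_zero]) (by rw [heq, arcParam_zero, sub_zero])
    have hend1 : ∀ y ∈ Icc (0 : ℝ) 1, 0 < Real.exp (-(μ * t)) *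
          arcBarrier γ t (arcParam (fun u => γ u t) 1 + arcParam (fun u => γ u t) y) →
        reflectedDist Ω (γ 1 t) (γ y t) ≠ m * (Real.exp (-(μ * t)) *
          arcBarrier γ t (arcParam (fun u => γ u t) 1 + arcParam (fun u => γ u t) y)) := by
      intro y hy hF heq
      have hsub : 2 * arcParam (fun u => γ u t) 1
          - (arcParam (fun u => γ u t) 1 + arcParam (fun u => γ u t) y)
          = arcParam (fun u => γ u t) 1 - arcParam (fun u => γ u t) y := by ring
      rw [reflectedDist_eq_dist (hγ.endpoint_mem t htT 1 (by simp)), dist_comm] at heq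
      rw [← hγ.arcBarrier_sub htT, hsub] at hF heq
      have hne : y ≠ 1 := by
        rintro rfl
        simp [arcBarrier] at hF
      exact hnochord m hmm₁ hmm₂ hmC t ht y hy 1 h1 (lt_of_le_of_ne hy.2 hne) hF heq
    intro x hx y hy hF heq
    rcases hx.1.eq_or_lt with rfl | hx0
    · exact hend0 y hy hF heq
    rcases hx.2.eq_or_lt with rfl | hx1
    · exact hend1 y hy hF heq
    rcases hy.1.eq_or_lt with rfl | hy0
    · rw [reflectedDist_comm, add_comm] at heq
      exact hend0 x hx (by rwa [add_comm]) heq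
    rcases hy.2.eq_or_lt with rfl | hy1
    · rw [reflectedDist_comm, add_comm] at heq
      exact hend1 x hx (by rwa [add_comm]) heq
    have hne : (frontier Ω).Nonempty := ⟨_, hγ.endpoint_mem t htT 0 (by simp)⟩
    have hm0 : 0 ≤ m := le_of_mul_le_mul_right
      (by rw [zero_mul, ← heq]; exact reflectedDist_nonneg hne _ _) hF
    have ht0 : 0 < t := by
      refine lt_of_le_of_ne ht.1 fun h => ?_
      subst h
      rw [mul_zero, neg_zero, Real.exp_zero, one_mul] at heq hF
      have := hrefl x hx y hy
      rw [heq] at this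
      exact absurd (mul_lt_mul_of_pos_right hmC hF) (not_lt.2 this)
    exact hγ.not_reflected_touching hΩ htT ht0 hm0 (hμ t ht)
      (fun s hs => hle₂' m hmm₂ s ⟨hs.1, hs.2.trans ht.2⟩) ⟨hx0, hx1⟩ ⟨hy0, hy1⟩ heq
  have hC₁ : C ≤ min m₁ m₂ := by
    by_contra! hlt
    rcases le_total m₁ m₂ with h | h
    · rw [min_eq_left h] at hlt
      obtain ⟨t, ht, x, hx, y, hy, hxy, hF, heq⟩ := hex₁ hlt
      exact hnochord m₁ le_rfl h hlt t ht x hx y hy hxy hF heq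
    · rw [min_eq_right h] at hlt
      obtain ⟨t, ht, x, hx, y, hy, hF, heq⟩ := hex₂ hlt
      exact hnorefl m₂ h le_rfl hlt t ht x hx y hy hF heq
  exact ⟨hle₁' C (hC₁.trans (min_le_left _ _)), hle₂' C (hC₁.trans (min_le_right _ _))⟩

/-- The doubled length is bounded below by its limit. -/
theorem le_doubledLength (hγ : IsFreeBoundaryCSF Ω T γ) {LT : ℝ}
    (hlim : Tendsto (fun t => doubledLength (fun u => γ u t)) (𝓝[<] T) (𝓝 LT)) {t : ℝ}
    (ht : t ∈ Ico 0 T) : LT ≤ 2 * arcParam (fun u => γ u t) 1 := by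
  refine le_of_tendsto hlim ?_
  filter_upwards [Ioo_mem_nhdsLT ht.2] with s hs
  have h := hγ.arcParam_sub_le (x := 0) (y := 1) (by simp) (by simp) zero_le_one ht
    ⟨ht.1.trans hs.1.le, hs.2⟩ hs.1.le
  rw [arcParam_zero, arcParam_zero, sub_zero, sub_zero] at h
  exact mul_le_mul_of_nonneg_left h zero_le_two

end IsFreeBoundaryCSF

theorem mainTheorem3 (Ω : Set Plane) (hΩ : IsConvexC2Domain Ω)
    (T : ℝ) (hT : 0 < T) (γ : ℝ → ℝ → Plane) (hγ : IsFreeBoundaryCSF Ω T γ)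
    (LT : ℝ) (hLT : 0 < LT)
    (hlim : Tendsto (fun t => doubledLength (fun u => γ u t)) (𝓝[<] T) (𝓝 LT))
    (c : ℝ)
    (hinit : ∀ δ : ℝ,
      ((c * doubledLength (fun u => γ u 0) *
          Real.sin (Real.pi * δ / doubledLength (fun u => γ u 0)) : ℝ) : EReal)
        ≤ extendedChordArcProfile Ω (fun u => γ u 0) δ) :
    ∀ t ∈ Ico 0 T, ∀ δ : ℝ,
      ((c * doubledLength (fun u => γ u t) * Real.exp (-(4 * Real.pi ^ 2 * T / LT ^ 2)) *
          Real.sin (Real.pi * δ / doubledLength (fun u => γ u t)) : ℝ) : EReal)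
        ≤ extendedChordArcProfile Ω (fun u => γ u t) δ := by
  have hbar : ∀ t δ, doubledLength (fun u => γ u t)
      * Real.sin (Real.pi * δ / doubledLength (fun u => γ u t)) = arcBarrier γ t δ := by
    intro t δ
    rw [mul_div_right_comm]
    rfl
  intro t ht
  set k := Real.exp (-(4 * Real.pi ^ 2 * T / LT ^ 2)) with hk
  suffices h : ∀ δ : ℝ, ((c * k * arcBarrier γ t δ : ℝ) : EReal)
      ≤ extendedChordArcProfile Ω (fun u => γ u t) δ by
    intro δ
    have := h δ
    rw [← hbar] at this
    convert this using 2
    ring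
  rw [hγ.le_extendedChordArcProfile_iff ht]
  have h0T : (0 : ℝ) ∈ Ico 0 T := ⟨le_rfl, hT⟩
  have hinit' := (hγ.le_extendedChordArcProfile_iff h0T c).1 fun δ => by
    rw [← hbar, ← mul_assoc]
    exact hinit δ
  have hb1 : ∀ s ∈ Ico 0 T, ∀ x ∈ Icc (0 : ℝ) 1, ∀ y ∈ Icc (0 : ℝ) 1, x ≤ y →
      0 ≤ arcBarrier γ s (arcParam (fun u => γ u s) y - arcParam (fun u => γ u s) x) := by
    intro s hs x hx y hy hxy
    have a1 := hγ.arcParam_mem_Icc hx hs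
    have a2 := hγ.arcParam_mem_Icc hy hs
    exact arcBarrier_nonneg (sub_nonneg.2 ((strictMonoOn_arcParam (hγ.contDiffOn_slice hs)
      (hγ.immersed s hs)).monotoneOn hx hy hxy)) (by linarith [a1.1, a2.1, a2.2])
  have hb2 : ∀ s ∈ Ico 0 T, ∀ x ∈ Icc (0 : ℝ) 1, ∀ y ∈ Icc (0 : ℝ) 1,
      0 ≤ arcBarrier γ s (arcParam (fun u => γ u s) x + arcParam (fun u => γ u s) y) := by
    intro s hs x hx y hy
    have a1 := hγ.arcParam_mem_Icc hx hs
    have a2 := hγ.arcParam_mem_Icc hy hs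
    exact arcBarrier_nonneg (by linarith [a1.1, a2.1]) (by linarith [a1.2, a2.2])
  have hk0 : 0 < k := Real.exp_pos _
  -- For `c ≤ 0` the lower bound is not positive.
  rcases le_or_gt c 0 with hc | hc
  · have hck : c * k ≤ 0 := mul_nonpos_of_nonpos_of_nonneg hc hk0.le
    refine ⟨fun x hx y hy hxy => ?_, fun x hx y hy => ?_⟩
    · exact (mul_nonpos_of_nonpos_of_nonneg hck (hb1 t ht x hx y hy hxy)).trans dist_nonneg
    · exact (mul_nonpos_of_nonpos_of_nonneg hck (hb2 t ht x hx y hy)).trans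
        (reflectedDist_nonneg ⟨_, hγ.endpoint_mem t ht 0 (by simp)⟩ _ _)
  -- Since `t < T`, there is room both to lower the constant `c` and to increase the rate.
  set R := 4 * Real.pi ^ 2 / LT ^ 2 with hR
  have hR0 : 0 < R := by positivity
  set η := R * (T - t) / 2 with hη
  have hη0 : 0 < η := div_pos (mul_pos hR0 (sub_pos.2 ht.2)) two_pos
  have ht0 : 0 ≤ t := ht.1
  set μ := R + η / (t + 1) with hμ
  have hRμ : R < μ := by
    have : 0 < η / (t + 1) := by positivity
    linarith
  have hCc : c * Real.exp (-η) < c :=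
    mul_lt_of_lt_one_right hc (Real.exp_lt_one_iff.2 (by linarith))
  have hcπ := hγ.mul_pi_le_one h0T hinit'.1
  have hmain := hγ.exp_mul_arcBarrier_le hΩ ht (C := c * Real.exp (-η)) (μ := μ) (by positivity)
    ((mul_lt_mul_of_pos_right hCc Real.pi_pos).trans_le hcπ)
    (fun s hs => by
      refine lt_of_le_of_lt ?_ hRμ
      have hL := hγ.le_doubledLength hlim ⟨hs.1, hs.2.trans_lt ht.2⟩
      rw [div_pow, hR, mul_div_assoc]
      gcongr)
    (fun x hx y hy hxy => le_trans (mul_le_mul_of_nonneg_right hCc.le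
      (hb1 0 h0T x hx y hy hxy)) (hinit'.1 x hx y hy hxy))
    (fun x hx y hy => le_trans (mul_le_mul_of_nonneg_right hCc.le
      (hb2 0 h0T x hx y hy)) (hinit'.2 x hx y hy))
  have hkle : c * k ≤ c * Real.exp (-η) * Real.exp (-(μ * t)) := by
    rw [mul_assoc, ← Real.exp_add]
    refine mul_le_mul_of_nonneg_left (Real.exp_le_exp.2 ?_) hc.le
    have h1 : η / (t + 1) * t ≤ η := by
      rw [div_mul_eq_mul_div, div_le_iff₀ (by positivity)]
      nlinarith
    have h2 : 4 * Real.pi ^ 2 * T / LT ^ 2 = R * T := by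
      rw [hR]
      ring
    have h3 : μ * t = R * t + η / (t + 1) * t := by
      rw [hμ]
      ring
    have h4 : 2 * η = R * T - R * t := by
      rw [hη]
      ring
    rw [h2, h3]
    linarith
  refine ⟨fun x hx y hy hxy => ?_, fun x hx y hy => ?_⟩
  · refine le_trans (mul_le_mul_of_nonneg_right hkle (hb1 t ht x hx y hy hxy)) ?_
    rw [mul_assoc]
    exact hmain.1 t ⟨ht.1, le_rfl⟩ x hx y hy hxy
  · refine le_trans (mul_le_mul_of_nonneg_right hkle (hb2 t ht x hx y hy)) ?_
    rw [mul_assoc]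
    exact hmain.2 t ⟨ht.1, le_rfl⟩ x hx y hy
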